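/- Let $p,q\ge 0$ be integers and $d=p+q+2$ (so $q=d-p-2$). Work on Minkowski space $\mathbb R^{1,d-1}$ with metric $\mathrm{diag}(-1,1,\dots,1)$, coordinates $x^0,\dots,x^{d-1}$, volume form $\mathrm{vol}=dx^0\wedge\dots\wedge dx^{d-1}$ and Hodge star normalised by $\alpha\wedge\star\beta=\langle\alpha,\beta\rangle\,\mathrm{vol}$. The fields are smooth: $p$-forms $A_1,R_1$, $q$-forms $A_2,R_2$ and a scalar $a$. Put $F_i=dA_i$, $Q_i=dR_i$, $H_i=F_i+aQ_i$, $(\partial a)^2=\partial_\mu a\,\partial^\mu a$. Let $\mathcal F$ be an arbitrary $C^1$ real function of a $(p+1)$-form (at a point), and let $$\mathcal L_{\mathcal F}=H_1\wedge\star H_1+H_2\wedge\star H_2-2a\,Q_2\wedge F_1+2a\,F_2\wedge Q_1+\mathcal F(H_1+\star H_2)\,\mathrm{vol},$$ the free Lagrangian being $\mathcal L_0$. Let $X(Y)$ be the $(p+1)$-form $X_{i_1\dots i_{p+1}}=\tfrac12\,\partial\mathcal F/\partial Y^{i_1\dots i_{p+1}}$ (related components identified before differentiating), i.e. $D\mathcal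 F(Y)G=2\langle X(Y),G\rangle$ for all $G$. A configuration is *on shell* if the action $\int\mathcal L_{\mathcal F}$ is stationary under all smooth compactly supported variations of the five fields. Say that $G_1,G_2$ satisfy the *twisted duality relation* if $G_1-\star G_2+X(G_1+\star G_2)=0$. 1. (Gauge symmetries.) Consider the following variations (fields not listed do not vary), with arbitrary smooth $(p-1)$-form $U$ (if $p\ge1$), $(q-1)$-form $V$ (if $q\ge1$) and scalar $\varphi$: $\delta A_1=dU$; $\delta A_2=dV$; $\delta R_1=dU$; $\delta R_2=dV$; $(\delta A_1,\delta R_1)=(-a\,da\wedge U,\,da\wedge U)$; $(\delta A_2,\delta R_2)=(-a\,da\wedge V,\,da\wedge V)$; and, if $(\partial a)^2\ne0$ at all points, $$\delta a=\varphi,\quad \delta R_1=\tfrac{\varphi}{(\partial a)^2}\iota_{da}(Q_1+\star Q_2),\quad \delta R_2=\tfrac{\varphi}{(\partial a)^2}\iota_{da}\big(Q_2+(-1)^{p+d+pd}\star Q_1\big),\quad \delta A_i=-a\,\delta R_i.$$ Under each of them $\delta$ is smooth, $\delta(H_1+\star H_2)=0$, and $\delta\mathcal L_0=\delta\mathcal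 L_{\mathcal F}=dK$ for a smooth $(d-1)$-form $K$ supported in the support of the gauge parameter. So the interacting Lagrangian has all the gauge symmetries of the free one, unchanged. 2. (Equations of motion.) If $(\partial a)^2\neq0$ at all points, then a configuration is on shell if and only if $H_1,H_2$ satisfy the twisted duality relation and $da\wedge dR_1=0$, $da\wedge dR_2=0$. Stationarity under variations with $\delta a=0$ already implies that the configuration is on shell, i.e. the equation of motion of $a$ follows from the others. 3. (The auxiliary forms are pure gauge.) Let $p\ge1$ and $q\ge1$, let $(\partial a)^2\ne0$ at all points, and let the configuration be on shell. Then every point has a neighbourhood $N$ for which there are smooth $(p-1)$-forms $B_1,C_1$ and $(q-1)$-forms $B_2,C_2$ on $\mathbb R^{1,d-1}$ such that the gauge transformation $R_i\mapsto R_i+dB_i+da\wedge C_i$, $A_i\mapsto A_i-a\,da\wedge C_i$ leads to an on-shell configuration with $R_1=R_2=0$ on $N$ and with $F_1,F_2$ satisfying on $N$ $$F_1-\star F_2+X=0,\qquad X=X(Y)\big|_{Y=F_1+\star F_2}.$$ One can take $N$ to be all of $\mathbb R^{1,d-1}$ if the level sets of $a$ are contractible in the sense that there is a smooth $h:\mathbb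 R\times\mathbb R^{1,d-1}\to\mathbb R^{1,d-1}$ with $h(1,\cdot)=\mathrm{id}$, $a(h(s,x))=a(x)$, and $h(0,x)=h(0,y)$ whenever $a(x)=a(y)$. 4. (Remaining dynamics.) Let $R_1=R_2=0$. If $F_1-\star F_2+X(F_1+\star F_2)=0$, the configuration is on shell, whatever the smooth scalar $a$ is; if $(\partial a)^2\ne0$ at all points, the converse holds too. The last transformation in 1 then reduces to $\delta a=\varphi$, with all other fields unchanged, so that $a$ is also pure gauge. -/

import Mathlib

open scoped ContDiff Topology

noncomputable section

namespace Democratic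

/-- Minkowski space `ℝ^{1,d-1}` in Cartesian coordinates `x⁰, …, x^{d-1}`. -/
abbrev Spacetime (d : ℕ) : Type := Fin d → ℝ

/-- Exterior `k`-forms at a point. -/
abbrev Alt (d k : ℕ) : Type := (Spacetime d) [⋀^Fin k]→L[ℝ] ℝ

/-- Differential `k`-forms. -/
abbrev Form (d k : ℕ) : Type := Spacetime d → Alt d k

/-- The Minkowski metric `diag(-1, 1, …, 1)`. -/
def eta {d : ℕ} (i : Fin d) : ℝ := if i.val = 0 then -1 else 1

/-- The coordinate vector `∂_i`. -/
def e {d : ℕ} (i : Fin d) : Spacetime d := Pi.single i 1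

/-- `dx^{i₁} ∧ … ∧ dx^{i_k}`, that is `w ↦ det (dx^{i_b}(w_a))`. -/
def dx {d k : ℕ} (i : Fin k → Fin d) : Alt d k :=
  { (Matrix.detRowAlternating (n := Fin k) (R := ℝ)).compLinearMap (LinearMap.funLeft ℝ ℝ i) with
    cont := by
      change Continuous fun w : Fin k → Spacetime d =>
        Matrix.det (Matrix.of fun a b => w a (i b))
      refine Continuous.matrix_det ?_
      fun_prop }

theorem dx_apply {d k : ℕ} (i : Fin k → Fin d) (w : Fin k → Spacetime d) :
    dx i w = Matrix.det (Matrix.of fun a b => w a (i b)) := rfl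

/-- Concatenation of multi-indices. -/
def join {d k l n : ℕ} (h : k + l = n) (i : Fin k → Fin d) (j : Fin l → Fin d) : Fin n → Fin d :=
  fun m => Fin.append i j (Fin.cast h.symm m)

/-- The wedge product: `α ∧ β = (1 / k! l!) ∑ α_{i₁…i_k} β_{j₁…j_l} dx^{i₁} ∧ … ∧ dx^{j_l}`. -/
def wedge {d k l n : ℕ} (h : k + l = n) (α : Alt d k) (β : Alt d l) : Alt d n :=
  ((k.factorial : ℝ) * (l.factorial : ℝ))⁻¹ •
    ∑ i : Fin k → Fin d, ∑ j : Fin l → Fin d,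
      (α (fun m => e (i m)) * β (fun m => e (j m))) • dx (join h i j)

/-- The volume form `dx⁰ ∧ … ∧ dx^{d-1}`. -/
def vol (d : ℕ) : Alt d d := dx (fun i => i)

/-- The component of a top-degree form with respect to the volume form. -/
def density {d : ℕ} (α : Alt d d) : ℝ := α (fun i => e i)

/-- The Levi-Civita symbol `ε_{i₁…i_k j₁…j_l}`. -/
def levi {d k l : ℕ} (h : k + l = d) (i : Fin k → Fin d) (j : Fin l → Fin d) : ℝ :=
  vol d (fun m => e (join h i j m))

/-- The Hodge star of the Minkowski metric,
`⋆α = (1 / k! l!) ∑ α^{i₁…i_k} ε_{i₁…i_k j₁…j_l} dx^{j₁} ∧ … ∧ dx^{j_l}`, with indices raised by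
the metric; thus `α ∧ ⋆β = ⟨α, β⟩ vol`. -/
def hodge {d k l : ℕ} (h : k + l = d) (α : Alt d k) : Alt d l :=
  ((k.factorial : ℝ) * (l.factorial : ℝ))⁻¹ •
    ∑ i : Fin k → Fin d, ∑ j : Fin l → Fin d,
      ((∏ m, eta (i m)) * α (fun m => e (i m)) * levi h i j) • dx j

/-- The form `X` with components `X_{i₁…i_k} = ½ ∂𝓕/∂Y^{i₁…i_k}`, where the related components of
`Y` are identified before differentiating; equivalently `D𝓕(Y) G = 2 ⟨X, G⟩` for all `G`. -/
def halfGrad {d k : ℕ} (𝓕 : Alt d k → ℝ) (Y : Alt d k) : Alt d k :=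
  (1 / 2 : ℝ) • (k.factorial : ℝ)⁻¹ •
    ∑ i : Fin k → Fin d, ((∏ m, eta (i m)) * fderiv ℝ 𝓕 Y (dx i)) • dx i

/-- The exterior derivative, with the degree of the result stated as `n = k + 1`. -/
def extD {d k n : ℕ} (h : k + 1 = n) (α : Form d k) : Form d n := h ▸ extDeriv α

/-- The differential of a scalar as a `1`-form. -/
def dScalar {d : ℕ} (a : Spacetime d → ℝ) : Form d 1 :=
  fun x => ContinuousAlternatingMap.ofSubsingleton ℝ (Spacetime d) ℝ (0 : Fin 1) (fderiv ℝ a x)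

/-- The vector `∂^i a` dual to `da`. -/
def gradVec {d : ℕ} (a : Spacetime d → ℝ) (x : Spacetime d) : Spacetime d :=
  fun i => eta i * fderiv ℝ a x (e i)

/-- `(∂a)² = ∂_i a ∂^i a`. -/
def gradSq {d : ℕ} (a : Spacetime d → ℝ) (x : Spacetime d) : ℝ :=
  ∑ i, eta i * (fderiv ℝ a x (e i)) ^ 2

/-- The interior product `ι_{da} α`. -/
def iota {d k : ℕ} (a : Spacetime d → ℝ) (x : Spacetime d) (α : Alt d (k + 1)) : Alt d k :=
  α.curryLeft (gradVec a x)

/-- The admissibility condition `(∂a)² ≠ 0` at all spacetime points. -/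
def Nonnull {d : ℕ} (a : Spacetime d → ℝ) : Prop := ∀ x, gradSq a x ≠ 0

/-- The field content of the theory in `d = p + q + 2` dimensions, so that `q = d - p - 2`.
The same type is used for variations of the fields. -/
structure Config (p q : ℕ) where
  A₁ : Form (p + q + 2) p
  A₂ : Form (p + q + 2) q
  R₁ : Form (p + q + 2) p
  R₂ : Form (p + q + 2) q
  a : Spacetime (p + q + 2) → ℝ

variable {p q : ℕ}

theorem deg₁₂ : (p + 1) + (q + 1) = p + q + 2 := by omega

theorem deg₂₁ : (q + 1) + (p + 1) = p + q + 2 := by omega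

namespace Config

/-- All fields are smooth. -/
def Smooth (Ψ : Config p q) : Prop :=
  ContDiff ℝ ∞ Ψ.A₁ ∧ ContDiff ℝ ∞ Ψ.A₂ ∧ ContDiff ℝ ∞ Ψ.R₁ ∧ ContDiff ℝ ∞ Ψ.R₂ ∧ ContDiff ℝ ∞ Ψ.a

/-- All fields have compact support. -/
def Compact (δ : Config p q) : Prop :=
  HasCompactSupport δ.A₁ ∧ HasCompactSupport δ.A₂ ∧ HasCompactSupport δ.R₁ ∧
    HasCompactSupport δ.R₂ ∧ HasCompactSupport δ.a

/-- The configuration `Ψ + t δ`. -/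
def vary (Ψ : Config p q) (t : ℝ) (δ : Config p q) : Config p q where
  A₁ := fun x => Ψ.A₁ x + t • δ.A₁ x
  A₂ := fun x => Ψ.A₂ x + t • δ.A₂ x
  R₁ := fun x => Ψ.R₁ x + t • δ.R₁ x
  R₂ := fun x => Ψ.R₂ x + t • δ.R₂ x
  a := fun x => Ψ.a x + t * δ.a x

def F₁ (Ψ : Config p q) : Form (p + q + 2) (p + 1) := extDeriv Ψ.A₁
def F₂ (Ψ : Config p q) : Form (p + q + 2) (q + 1) := extDeriv Ψ.A₂
def Q₁ (Ψ : Config p q) : Form (p + q + 2) (p + 1) := extDeriv Ψ.R₁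
def Q₂ (Ψ : Config p q) : Form (p + q + 2) (q + 1) := extDeriv Ψ.R₂

def H₁ (Ψ : Config p q) : Form (p + q + 2) (p + 1) := fun x => Ψ.F₁ x + Ψ.a x • Ψ.Q₁ x
def H₂ (Ψ : Config p q) : Form (p + q + 2) (q + 1) := fun x => Ψ.F₂ x + Ψ.a x • Ψ.Q₂ x

/-- `Y = H₁ + ⋆H₂`. -/
def Y (Ψ : Config p q) : Form (p + q + 2) (p + 1) := fun x => Ψ.H₁ x + hodge deg₂₁ (Ψ.H₂ x)

end Config

open Config

/-- The democratic Lagrangian (a top-degree form)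
`H₁ ∧ ⋆H₁ + H₂ ∧ ⋆H₂ - 2 a Q₂ ∧ F₁ + 2 a F₂ ∧ Q₁ + 𝓕(H₁ + ⋆H₂) vol`.
The free Lagrangian is the case `𝓕 = 0`. -/
def lagrangian (𝓕 : Alt (p + q + 2) (p + 1) → ℝ) (Ψ : Config p q) :
    Form (p + q + 2) (p + q + 2) := fun x =>
  wedge deg₁₂ (Ψ.H₁ x) (hodge deg₁₂ (Ψ.H₁ x)) + wedge deg₂₁ (Ψ.H₂ x) (hodge deg₂₁ (Ψ.H₂ x))
    - (2 * Ψ.a x) • wedge deg₂₁ (Ψ.Q₂ x) (Ψ.F₁ x)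
    + (2 * Ψ.a x) • wedge deg₂₁ (Ψ.F₂ x) (Ψ.Q₁ x)
    + 𝓕 (Ψ.Y x) • vol (p + q + 2)

/-- The difference of the actions of `Ψ'` and `Ψ`, for `Ψ'` equal to `Ψ` off a compact set. -/
def actionDiff (𝓕 : Alt (p + q + 2) (p + 1) → ℝ) (Ψ Ψ' : Config p q) : ℝ :=
  ∫ x, (density (lagrangian 𝓕 Ψ' x) - density (lagrangian 𝓕 Ψ x))

/-- The action is stationary at `Ψ` in the direction `δ`. -/
def Stationary (𝓕 : Alt (p + q + 2) (p + 1) → ℝ) (Ψ δ : Config p q) : Prop :=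
  HasDerivAt (fun t : ℝ => actionDiff 𝓕 Ψ (Ψ.vary t δ)) 0 0

/-- `Ψ` satisfies the equations of motion: the action is stationary under all compactly
supported variations of all the fields. -/
def OnShell (𝓕 : Alt (p + q + 2) (p + 1) → ℝ) (Ψ : Config p q) : Prop :=
  ∀ δ : Config p q, δ.Smooth → δ.Compact → Stationary 𝓕 Ψ δ

/-- `Ψ` satisfies the equations of motion of `A₁`, `A₂`, `R₁`, `R₂` (but possibly not that
of `a`). -/
def OnShellForms (𝓕 : Alt (p + q + 2) (p + 1) → ℝ) (Ψ : Config p q) : Prop :=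
  ∀ δ : Config p q, δ.Smooth → δ.Compact → δ.a = 0 → Stationary 𝓕 Ψ δ

/-- `δA₁ = dU`. -/
def gaugeA₁ {k : ℕ} (hk : k + 1 = p) (U : Form (p + q + 2) k) : Config p q :=
  ⟨extD hk U, 0, 0, 0, 0⟩

/-- `δA₂ = dV`. -/
def gaugeA₂ {l : ℕ} (hl : l + 1 = q) (V : Form (p + q + 2) l) : Config p q :=
  ⟨0, extD hl V, 0, 0, 0⟩

/-- `δR₁ = dU`. -/
def gaugeR₁ {k : ℕ} (hk : k + 1 = p) (U : Form (p + q + 2) k) : Config p q :=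
  ⟨0, 0, extD hk U, 0, 0⟩

/-- `δR₂ = dV`. -/
def gaugeR₂ {l : ℕ} (hl : l + 1 = q) (V : Form (p + q + 2) l) : Config p q :=
  ⟨0, 0, 0, extD hl V, 0⟩

/-- `da ∧ U`. -/
def daWedge {d k n : ℕ} (h : k + 1 = n) (a : Spacetime d → ℝ) (U : Form d k) : Form d n :=
  fun x => wedge ((Nat.add_comm 1 k).trans h) (dScalar a x) (U x)

/-- `δA₁ = -a da ∧ U`, `δR₁ = da ∧ U`. -/
def gaugeS₁ {k : ℕ} (hk : k + 1 = p) (a : Spacetime (p + q + 2) → ℝ) (U : Form (p + q + 2) k) :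
    Config p q :=
  ⟨fun x => -(a x • daWedge hk a U x), 0, daWedge hk a U, 0, 0⟩

/-- `δA₂ = -a da ∧ V`, `δR₂ = da ∧ V`. -/
def gaugeS₂ {l : ℕ} (hl : l + 1 = q) (a : Spacetime (p + q + 2) → ℝ) (V : Form (p + q + 2) l) :
    Config p q :=
  ⟨0, fun x => -(a x • daWedge hl a V x), 0, daWedge hl a V, 0⟩

/-- `(φ / (∂a)²) ι_{da} (Q₁ + ⋆Q₂)`. -/
def shiftR₁ (Ψ : Config p q) (φ : Spacetime (p + q + 2) → ℝ) : Form (p + q + 2) p := fun x =>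
  (φ x / gradSq Ψ.a x) • iota Ψ.a x (Ψ.Q₁ x + hodge deg₂₁ (Ψ.Q₂ x))

/-- `(φ / (∂a)²) ι_{da} (Q₂ + (-1)^{p+d+pd} ⋆Q₁)`. -/
def shiftR₂ (Ψ : Config p q) (φ : Spacetime (p + q + 2) → ℝ) : Form (p + q + 2) q := fun x =>
  (φ x / gradSq Ψ.a x) • iota Ψ.a x
    (Ψ.Q₂ x + (-1 : ℝ) ^ (p + (p + q + 2) + p * (p + q + 2)) • hodge deg₁₂ (Ψ.Q₁ x))

/-- The transformation shifting `a` by an arbitrary function `φ`. -/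
def gaugeShift (Ψ : Config p q) (φ : Spacetime (p + q + 2) → ℝ) : Config p q :=
  ⟨fun x => -(Ψ.a x • shiftR₁ Ψ φ x), fun x => -(Ψ.a x • shiftR₂ Ψ φ x),
    shiftR₁ Ψ φ, shiftR₂ Ψ φ, φ⟩

/-- `GaugeVariation Ψ δ S`: `δ` is the variation of `Ψ` under one of the seven gauge symmetries of
the free theory, with a smooth gauge parameter whose support is `S`. -/
inductive GaugeVariation (Ψ : Config p q) : Config p q → Set (Spacetime (p + q + 2)) → Prop
  | A₁ {k : ℕ} (hk : k + 1 = p) (U : Form (p + q + 2) k) (hU : ContDiff ℝ ∞ U) :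
      GaugeVariation Ψ (gaugeA₁ hk U) (tsupport U)
  | A₂ {l : ℕ} (hl : l + 1 = q) (V : Form (p + q + 2) l) (hV : ContDiff ℝ ∞ V) :
      GaugeVariation Ψ (gaugeA₂ hl V) (tsupport V)
  | R₁ {k : ℕ} (hk : k + 1 = p) (U : Form (p + q + 2) k) (hU : ContDiff ℝ ∞ U) :
      GaugeVariation Ψ (gaugeR₁ hk U) (tsupport U)
  | R₂ {l : ℕ} (hl : l + 1 = q) (V : Form (p + q + 2) l) (hV : ContDiff ℝ ∞ V) :
      GaugeVariation Ψ (gaugeR₂ hl V) (tsupport V)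
  | S₁ {k : ℕ} (hk : k + 1 = p) (U : Form (p + q + 2) k) (hU : ContDiff ℝ ∞ U) :
      GaugeVariation Ψ (gaugeS₁ hk Ψ.a U) (tsupport U)
  | S₂ {l : ℕ} (hl : l + 1 = q) (V : Form (p + q + 2) l) (hV : ContDiff ℝ ∞ V) :
      GaugeVariation Ψ (gaugeS₂ hl Ψ.a V) (tsupport V)
  | shift (ha : Nonnull Ψ.a) (φ : Spacetime (p + q + 2) → ℝ) (hφ : ContDiff ℝ ∞ φ) :
      GaugeVariation Ψ (gaugeShift Ψ φ) (tsupport φ)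

/-- The finite gauge transformation of `Ψ` generated by the gauge symmetries `δR₁ = dB₁`,
`δR₂ = dB₂`, `(δA₁, δR₁) = (-a da ∧ C₁, da ∧ C₁)` and `(δA₂, δR₂) = (-a da ∧ C₂, da ∧ C₂)`.
These do not change `a` and the variations depend on no other field, so that they integrate
to translations. -/
def gaugeTransform {k l : ℕ} (hk : k + 1 = p) (hl : l + 1 = q) (Ψ : Config p q)
    (B₁ C₁ : Form (p + q + 2) k) (B₂ C₂ : Form (p + q + 2) l) : Config p q :=
  (((Ψ.vary 1 (gaugeR₁ hk B₁)).vary 1 (gaugeR₂ hl B₂)).vary 1 (gaugeS₁ hk Ψ.a C₁)).vary 1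
    (gaugeS₂ hl Ψ.a C₂)

/-- The nonlinear twisted duality relation `G₁ - ⋆G₂ + X = 0` at a point, with `X` evaluated
at `G₁ + ⋆G₂`. -/
def TwistedDuality (𝓕 : Alt (p + q + 2) (p + 1) → ℝ) (G₁ : Alt (p + q + 2) (p + 1))
    (G₂ : Alt (p + q + 2) (q + 1)) : Prop :=
  G₁ - hodge deg₂₁ G₂ + halfGrad 𝓕 (G₁ + hodge deg₂₁ G₂) = 0

/-- On the region `N`, the auxiliary fields `R₁`, `R₂` of `Ψ` can be gauged away: some gauge
transformation with smooth parameters maps `Ψ` to a solution with `R₁ = R₂ = 0` on `N`, where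
`A₁`, `A₂` are related by the nonlinear twisted duality relation. -/
def ReducesOn (𝓕 : Alt (p + q + 2) (p + 1) → ℝ) {k l : ℕ} (hk : k + 1 = p) (hl : l + 1 = q)
    (Ψ : Config p q) (N : Set (Spacetime (p + q + 2))) : Prop :=
  ∃ (B₁ C₁ : Form (p + q + 2) k) (B₂ C₂ : Form (p + q + 2) l),
    ContDiff ℝ ∞ B₁ ∧ ContDiff ℝ ∞ C₁ ∧ ContDiff ℝ ∞ B₂ ∧ ContDiff ℝ ∞ C₂ ∧
    OnShell 𝓕 (gaugeTransform hk hl Ψ B₁ C₁ B₂ C₂) ∧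
    ∀ x ∈ N, (gaugeTransform hk hl Ψ B₁ C₁ B₂ C₂).R₁ x = 0 ∧
      (gaugeTransform hk hl Ψ B₁ C₁ B₂ C₂).R₂ x = 0 ∧
      TwistedDuality 𝓕 ((gaugeTransform hk hl Ψ B₁ C₁ B₂ C₂).F₁ x)
        ((gaugeTransform hk hl Ψ B₁ C₁ B₂ C₂).F₂ x)

/-- The level sets of `a` are smoothly contractible, uniformly in the level: a smooth homotopy
along the level sets joins the identity to a map that is constant on each of them. -/
def LevelsContractible {d : ℕ} (a : Spacetime d → ℝ) : Prop :=
  ∃ h : ℝ × Spacetime d → Spacetime d, ContDiff ℝ ∞ h ∧ (∀ x, h (1, x) = x) ∧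
    (∀ s x, a (h (s, x)) = a x) ∧ (∀ x y, a x = a y → h (0, x) = h (0, y))

end Democratic

end

/-!
The Lagrangian depends on the fields only through `a`, `F₁`, `F₂`, `Q₁`, `Q₂` at a point. Write
`D = H₁ - ⋆H₂ + X(Y)` and `cᵢ = δAᵢ + a δRᵢ`. The first variation of the Lagrangian is

  `2 ⟨D, δY⟩ vol + 4 (Q₂ ∧ da ∧ c₁ - da ∧ c₂ ∧ Q₁) + dK`

with `K` not depending on `𝓕` (`firstVar_eq`). The remainder of the file reads off this formula,
in which `δHᵢ = dcᵢ - da ∧ δRᵢ + δa Qᵢ`.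

*Gauge symmetries.* Closed variations of the potentials change no field strength. All other gauge
variations have `cᵢ = 0`, so that what is needed is `δY = 0`. This is `da ∧ da = 0` for
`δRᵢ = da ∧ Uᵢ`; for the shift of `a` it is the identity
`⟨μ, μ⟩ ⋆ψ = μ ∧ ι_μ ⋆ψ + ⋆(μ ∧ ι_μ ψ)` (`sharp_smul_hodge`), which says that the projections
`μ ∧ ι_μ / ⟨μ, μ⟩` on the two sides of the Hodge star are complementary.

*Equations of motion.* If `D = 0` and `da ∧ Qᵢ = 0`, the pairing above vanishes for every
variation, including those of `a` (`onShell_of`). Conversely, variations with `cᵢ = 0` and `δa = 0`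
give `⟨D, da ∧ ρ₁ + ⋆(da ∧ ρ₂)⟩ = 0` for all `ρᵢ`, that is `ι_{da} D = 0` and `da ∧ D = 0`; as
`(∂a)² ≠ 0`, Cartan's formula yields `D = 0`. The variations with `δRᵢ = 0` then give `da ∧ Qᵢ = 0`
(`eom_of_onShellForms`). No derivative of `D` is taken, which is why `𝓕` need only be `C¹`.

*The auxiliary forms.* The equation `da ∧ dRᵢ = 0` says that `Rᵢ` restricts to closed forms on the
level sets of `a`. If these contract, `Rᵢ = dB + da ∧ C` by a Poincaré lemma with the level as a
parameter (`exists_potential`). It is the homotopy formula for a homotopy `h` along the level sets: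
`dRᵢ = da ∧ S`, the contraction of `h^*(da ∧ S)` with `∂_s` is again a multiple of `da`, and the
pullback along `h(0, ·)`, a map whose derivative vanishes on the kernel of `da`, is a multiple of
`da` as well. For contractible level sets the homotopy is given
(`LevelsContractible.exists_contractsLevels`); near a point it comes from the inverse function
theorem, which makes `a` affine (`exists_contractsLevels_nhds`). A gauge transformation changes
neither `Hᵢ` nor `da ∧ Qᵢ`, hence it preserves the equations of motion
(`reducesOn_of_contractsLevels`).

*Remaining dynamics.* For `R₁ = R₂ = 0` one has `Qᵢ = 0` and `Hᵢ = Fᵢ`, so that the equations of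
motion are the twisted duality relation of `F₁` and `F₂`.
-/

noncomputable section

namespace Democratic

/-! ### Exterior algebra in components -/

section Algebra

variable {d : ℕ}

theorem e_apply (i j : Fin d) : (e i : Spacetime d) j = if j = i then 1 else 0 := by
  simp [e, Pi.single_apply]

/-- Two forms agreeing on all tuples of distinct coordinate vectors are equal. -/
theorem ext_e {k : ℕ} {α β : Alt d k}
    (h : ∀ i : Fin k → Fin d, Function.Injective i →
      α (fun m => e (i m)) = β (fun m => e (i m))) : α = β := by
  apply ContinuousAlternatingMap.toAlternatingMap_injective
  refine Module.Basis.ext_alternating (Pi.basisFun ℝ (Fin d)) fun i hi => ?_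
  have : (fun m => (Pi.basisFun ℝ (Fin d)) (i m)) = fun m => e (i m) := by
    funext m; simp [e, Pi.basisFun_apply]
  rw [this]
  exact h i hi

theorem dx_comp_perm {k : ℕ} (i : Fin k → Fin d) (σ : Equiv.Perm (Fin k)) :
    dx (fun m => i (σ m)) = (Equiv.Perm.sign σ : ℝ) • dx i := by
  ext w
  rw [ContinuousAlternatingMap.smul_apply, dx_apply, dx_apply, smul_eq_mul]
  exact Matrix.det_permute' σ (Matrix.of fun a b => w a (i b))

theorem dx_eq_zero {k : ℕ} {i : Fin k → Fin d} (hi : ¬ Function.Injective i) : dx i = 0 := by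
  ext w
  obtain ⟨a, b, hab, hne⟩ : ∃ a b, i a = i b ∧ a ≠ b := by
    simpa [Function.Injective] using hi
  rw [dx_apply]
  exact Matrix.det_zero_of_column_eq hne fun c => by simp [hab]

/-- The components of `dx i` are symmetric under exchanging the two multi-indices. -/
theorem dx_apply_e_comm {k : ℕ} (i j : Fin k → Fin d) :
    dx i (fun m => e (j m)) = dx j (fun m => e (i m)) := by
  rw [dx_apply, dx_apply, ← Matrix.det_transpose]
  congr 1
  ext a b
  simp [e_apply, eq_comm]

/-- Contracting an antisymmetric family with the components of `dx i`. -/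
theorem sum_dx_smul {k : ℕ} {V : Type*} [AddCommGroup V] [Module ℝ V]
    (g : (Fin k → Fin d) → V)
    (hg : ∀ i (σ : Equiv.Perm (Fin k)), g (fun m => i (σ m)) = (Equiv.Perm.sign σ : ℝ) • g i)
    (i : Fin k → Fin d) :
    ∑ j : Fin k → Fin d, dx i (fun m => e (j m)) • g j = (k.factorial : ℝ) • g i := by
  have h1 : ∀ j : Fin k → Fin d, dx i (fun m => e (j m)) • g j =
      ∑ σ : Equiv.Perm (Fin k), if j = (fun m => i (σ m)) then g i else 0 := by
    intro j
    rw [dx_apply_e_comm, dx_apply, Matrix.det_apply, Finset.sum_smul]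
    refine Finset.sum_congr rfl fun σ _ => ?_
    have h2 : ∏ m, (Matrix.of fun a b => (e (i a) : Spacetime d) (j b)) (σ m) m =
        if j = (fun m => i (σ m)) then (1 : ℝ) else 0 := by
      simp only [Matrix.of_apply, e_apply]
      split_ifs with h
      · simp [h]
      · obtain ⟨m, hm⟩ := Function.ne_iff.1 h
        exact Finset.prod_eq_zero (Finset.mem_univ m) (if_neg hm)
    rw [h2]
    split_ifs with h
    · subst h
      rw [hg]
      rcases Int.units_eq_one_or (Equiv.Perm.sign σ) with hs | hs <;> simp [hs]
    · simp
  rw [Finset.sum_congr rfl fun j _ => h1 j, Finset.sum_comm]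
  simp [Fintype.card_perm, Nat.cast_smul_eq_nsmul]

theorem alt_perm {k : ℕ} (α : Alt d k) (i : Fin k → Fin d) (σ : Equiv.Perm (Fin k)) :
    α (fun m => e (i (σ m))) = (Equiv.Perm.sign σ : ℝ) • α (fun m => e (i m)) := by
  have := α.toAlternatingMap.map_perm (fun m => e (i m)) σ
  rcases Int.units_eq_one_or (Equiv.Perm.sign σ) with hs | hs <;>
    simpa [hs, Function.comp_def] using this

/-- The expansion of a form in its components. -/
theorem sum_smul_dx {k : ℕ} (α : Alt d k) :
    ∑ i : Fin k → Fin d, α (fun m => e (i m)) • dx i = (k.factorial : ℝ) • α := by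
  refine ext_e fun j _ => ?_
  rw [ContinuousAlternatingMap.sum_apply]
  simp only [ContinuousAlternatingMap.smul_apply, smul_eq_mul]
  rw [← smul_eq_mul, ← sum_dx_smul (fun i => α (fun m => e (i m))) (alt_perm α) j]
  refine Finset.sum_congr rfl fun i _ => ?_
  rw [dx_apply_e_comm, mul_comm, smul_eq_mul]

theorem fact_ne (k : ℕ) : (k.factorial : ℝ) ≠ 0 := by positivity

theorem eq_sum_dx {k : ℕ} (α : Alt d k) :
    α = (k.factorial : ℝ)⁻¹ • ∑ i : Fin k → Fin d, α (fun m => e (i m)) • dx i := by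
  rw [sum_smul_dx, smul_smul, inv_mul_cancel₀ (fact_ne k), one_smul]

/-- A property of forms that is stable under linear combinations may be checked on the
coordinate forms. -/
theorem dx_induction {k : ℕ} {P : Alt d k → Prop} (α : Alt d k) (h0 : P 0)
    (hadd : ∀ β γ, P β → P γ → P (β + γ)) (hsmul : ∀ (c : ℝ) β, P β → P (c • β))
    (hdx : ∀ i, P (dx i)) : P α := by
  rw [eq_sum_dx α]
  refine hsmul _ _ ?_
  refine Finset.sum_induction _ P hadd h0 fun i _ => hsmul _ _ (hdx i)

instance finiteDimensional_alt {k : ℕ} : FiniteDimensional ℝ (Alt d k) := by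
  classical
  refine ⟨⟨Finset.univ.image (dx : (Fin k → Fin d) → Alt d k), ?_⟩⟩
  rw [eq_top_iff]
  rintro α -
  refine dx_induction α (Submodule.zero_mem _) (fun _ _ => Submodule.add_mem _)
    (fun c _ => Submodule.smul_mem _ c) fun i => Submodule.subset_span ?_
  simp

/-! ### The wedge product -/

section Wedge

variable {k l m n : ℕ}

theorem wedge_add_left (h : k + l = n) (α α' : Alt d k) (β : Alt d l) :
    wedge h (α + α') β = wedge h α β + wedge h α' β := by
  simp only [wedge, ContinuousAlternatingMap.add_apply, add_mul, add_smul, Finset.sum_add_distrib,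
    smul_add]

theorem wedge_smul_left (h : k + l = n) (c : ℝ) (α : Alt d k) (β : Alt d l) :
    wedge h (c • α) β = c • wedge h α β := by
  simp only [wedge, ContinuousAlternatingMap.smul_apply, smul_eq_mul, Finset.smul_sum, smul_smul]
  refine Finset.sum_congr rfl fun i _ => Finset.sum_congr rfl fun j _ => ?_
  congr 1; ring

theorem wedge_add_right (h : k + l = n) (α : Alt d k) (β β' : Alt d l) :
    wedge h α (β + β') = wedge h α β + wedge h α β' := by
  simp only [wedge, ContinuousAlternatingMap.add_apply, mul_add, add_smul, Finset.sum_add_distrib,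
    smul_add]

theorem wedge_smul_right (h : k + l = n) (c : ℝ) (α : Alt d k) (β : Alt d l) :
    wedge h α (c • β) = c • wedge h α β := by
  simp only [wedge, ContinuousAlternatingMap.smul_apply, smul_eq_mul, Finset.smul_sum, smul_smul]
  refine Finset.sum_congr rfl fun i _ => Finset.sum_congr rfl fun j _ => ?_
  congr 1; ring

/-- The wedge product as a continuous bilinear map. -/
def wedgeL (h : k + l = n) : Alt d k →L[ℝ] Alt d l →L[ℝ] Alt d n :=
  (LinearMap.mk₂ ℝ (wedge h) (wedge_add_left h) (wedge_smul_left h) (wedge_add_right h)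
    (wedge_smul_right h)).toContinuousBilinearMap

theorem wedgeL_apply (h : k + l = n) (α : Alt d k) (β : Alt d l) :
    wedgeL h α β = wedge h α β := rfl

@[simp] theorem wedge_zero_left (h : k + l = n) (β : Alt d l) : wedge h (0 : Alt d k) β = 0 := by
  rw [← wedgeL_apply]; simp

@[simp] theorem wedge_zero_right (h : k + l = n) (α : Alt d k) : wedge h α (0 : Alt d l) = 0 := by
  rw [← wedgeL_apply]; simp

theorem wedge_sub_left (h : k + l = n) (α α' : Alt d k) (β : Alt d l) :
    wedge h (α - α') β = wedge h α β - wedge h α' β := by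
  simp [← wedgeL_apply]

theorem wedge_sub_right (h : k + l = n) (α : Alt d k) (β β' : Alt d l) :
    wedge h α (β - β') = wedge h α β - wedge h α β' := by
  simp [← wedgeL_apply]

theorem wedge_sum_left {ι : Type*} (s : Finset ι) (h : k + l = n) (α : ι → Alt d k)
    (β : Alt d l) : wedge h (∑ i ∈ s, α i) β = ∑ i ∈ s, wedge h (α i) β := by
  simp [← wedgeL_apply]

theorem wedge_sum_right {ι : Type*} (s : Finset ι) (h : k + l = n) (α : Alt d k)
    (β : ι → Alt d l) : wedge h α (∑ i ∈ s, β i) = ∑ i ∈ s, wedge h α (β i) := by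
  simp [← wedgeL_apply]

theorem dx_join_perm_left (h : k + l = n) (i : Fin k → Fin d) (j : Fin l → Fin d)
    (σ : Equiv.Perm (Fin k)) :
    dx (join h (fun m => i (σ m)) j) = (Equiv.Perm.sign σ : ℝ) • dx (join h i j) := by
  subst h
  let τ : Equiv.Perm (Fin (k + l)) := finSumFinEquiv.permCongr (Equiv.Perm.sumCongr σ 1)
  have hs : Equiv.Perm.sign τ = Equiv.Perm.sign σ := by
    simp [τ, Equiv.Perm.sign_permCongr]
  rw [← hs, ← dx_comp_perm]
  congr 1
  funext m
  refine Fin.addCases (fun a => ?_) (fun b => ?_) m <;>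
    simp [join, τ, Equiv.permCongr_apply]

theorem dx_join_perm_right (h : k + l = n) (i : Fin k → Fin d) (j : Fin l → Fin d)
    (σ : Equiv.Perm (Fin l)) :
    dx (join h i (fun m => j (σ m))) = (Equiv.Perm.sign σ : ℝ) • dx (join h i j) := by
  subst h
  let τ : Equiv.Perm (Fin (k + l)) := finSumFinEquiv.permCongr (Equiv.Perm.sumCongr 1 σ)
  have hs : Equiv.Perm.sign τ = Equiv.Perm.sign σ := by
    simp [τ, Equiv.Perm.sign_permCongr]
  rw [← hs, ← dx_comp_perm]
  congr 1
  funext m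
  refine Fin.addCases (fun a => ?_) (fun b => ?_) m <;>
    simp [join, τ, Equiv.permCongr_apply]

theorem wedge_dx (h : k + l = n) (i : Fin k → Fin d) (j : Fin l → Fin d) :
    wedge h (dx i) (dx j) = dx (join h i j) := by
  have h1 : ∀ i' : Fin k → Fin d, ∑ j' : Fin l → Fin d,
      (dx i (fun m => e (i' m)) * dx j (fun m => e (j' m))) • dx (join h i' j') =
      dx i (fun m => e (i' m)) • (l.factorial : ℝ) • dx (join h i' j) := by
    intro i'
    rw [← sum_dx_smul (fun j' => dx (join h i' j')) (dx_join_perm_right h i') j, Finset.smul_sum]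
    simp only [smul_smul]
  rw [wedge, Finset.sum_congr rfl fun i' _ => h1 i',
    sum_dx_smul (fun i' => (l.factorial : ℝ) • dx (join h i' j)) (fun i' σ => by
      rw [dx_join_perm_left, smul_comm]) i, smul_smul, smul_smul]
  rw [mul_assoc, inv_mul_cancel₀ (mul_ne_zero (fact_ne k) (fact_ne l)), one_smul]

theorem join_assoc {r s : ℕ} (h₁ : k + l = r) (h₂ : r + m = n) (h₃ : l + m = s) (h₄ : k + s = n)
    (i : Fin k → Fin d) (j : Fin l → Fin d) (u : Fin m → Fin d) :
    join h₂ (join h₁ i j) u = join h₄ i (join h₃ j u) := by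
  subst h₁ h₃ h₂
  funext a
  simp only [join, Fin.cast_refl, id]
  exact congrFun (Fin.append_assoc i j u) a

theorem wedge_assoc {r s : ℕ} (h₁ : k + l = r) (h₂ : r + m = n) (h₃ : l + m = s) (h₄ : k + s = n)
    (α : Alt d k) (β : Alt d l) (γ : Alt d m) :
    wedge h₂ (wedge h₁ α β) γ = wedge h₄ α (wedge h₃ β γ) := by
  induction α using dx_induction with
  | h0 => simp
  | hadd _ _ h h' => simp only [wedge_add_left, h, h']
  | hsmul _ _ h => simp only [wedge_smul_left, h]
  | hdx i =>
  induction β using dx_induction with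
  | h0 => simp
  | hadd _ _ h h' => simp only [wedge_add_left, wedge_add_right, h, h']
  | hsmul _ _ h => simp only [wedge_smul_left, wedge_smul_right, h]
  | hdx j =>
  induction γ using dx_induction with
  | h0 => simp
  | hadd _ _ h h' => simp only [wedge_add_right, h, h']
  | hsmul _ _ h => simp only [wedge_smul_right, h]
  | hdx u => simp only [wedge_dx, join_assoc h₁ h₂ h₃ h₄]

/-- Moving a one-form through a form. -/
theorem wedge_one_comm (h : 1 + k = n) (h' : k + 1 = n) (μ : Alt d 1) (β : Alt d k) :
    wedge h μ β = (-1 : ℝ) ^ k • wedge h' β μ := by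
  induction μ using dx_induction with
  | h0 => simp
  | hadd _ _ h h' => simp only [wedge_add_left, wedge_add_right, h, h', smul_add]
  | hsmul _ _ h => simp only [wedge_smul_left, wedge_smul_right, h]; rw [smul_comm]
  | hdx i =>
  induction β using dx_induction with
  | h0 => simp
  | hadd _ _ h h' => simp only [wedge_add_left, wedge_add_right, h, h', smul_add]
  | hsmul _ _ h => simp only [wedge_smul_left, wedge_smul_right, h]; rw [smul_comm]
  | hdx j =>
  subst h'
  rw [wedge_dx, wedge_dx]
  have h2 : join rfl j i = fun m => join h i j (finRotate (k + 1) m) := by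
    have e1 : join rfl j i = Fin.snoc (α := fun _ => Fin d) j (i 0) := by
      funext a
      refine Fin.lastCases ?_ (fun b => ?_) a
      · simp only [join, Fin.cast_refl, id, Fin.snoc_last]
        exact Fin.append_right j i 0
      · simp only [join, Fin.cast_refl, id, Fin.snoc_castSucc]
        exact Fin.append_left j i b
    have e2 : join h i j = Fin.cons (α := fun _ => Fin d) (i 0) j := by
      funext a
      refine Fin.cases ?_ (fun b => ?_) a
      · have : Fin.cast h.symm 0 = Fin.castAdd k (0 : Fin 1) := by ext; simp
        rw [join, this, Fin.append_left, Fin.cons_zero]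
      · have : Fin.cast h.symm b.succ = Fin.natAdd 1 b := by ext; simp [add_comm]
        rw [join, this, Fin.append_right, Fin.cons_succ]
    rw [e1, e2, Fin.snoc_eq_cons_rotate]
  rw [h2, dx_comp_perm, sign_finRotate, smul_smul]
  rw [show k + 1 - 1 = k from rfl]
  push_cast
  rw [← mul_pow]
  simp

theorem dx_succ (h : 1 + k = k + 1) (i : Fin (k + 1) → Fin d) :
    dx i = wedge h (dx fun _ => i 0) (dx fun m => i m.succ) := by
  rw [wedge_dx]
  congr 1
  funext a
  refine Fin.cases ?_ (fun b => ?_) a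
  · have : Fin.cast h.symm 0 = Fin.castAdd k (0 : Fin 1) := by ext; simp
    rw [join, this, Fin.append_left]
  · have : Fin.cast h.symm b.succ = Fin.natAdd 1 b := by ext; simp [add_comm]
    rw [join, this, Fin.append_right]

/-- Induction on the degree: every form of positive degree is a linear combination of wedge
products of one-forms with forms of lower degree. -/
theorem wedge_induction {P : Alt d (k + 1) → Prop} (h : 1 + k = k + 1) (α : Alt d (k + 1))
    (h0 : P 0) (hadd : ∀ β γ, P β → P γ → P (β + γ)) (hsmul : ∀ (c : ℝ) β, P β → P (c • β))
    (hw : ∀ (μ : Alt d 1) (β : Alt d k), P (wedge h μ β)) : P α :=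
  dx_induction α h0 hadd hsmul fun i => by rw [dx_succ h]; exact hw _ _

theorem wedge_zero_form (h : 0 + k = n) (h' : k = n) (α : Alt d 0) (β : Alt d k) :
    wedge h α β = α ![] • (h' ▸ β) := by
  subst h'
  induction β using dx_induction with
  | h0 => simp
  | hadd _ _ h h' => simp only [wedge_add_right, h, h', smul_add]
  | hsmul _ _ h => simp only [wedge_smul_right, h]; rw [smul_comm]
  | hdx j =>
  have hα : α = α ![] • dx ![] := by
    ext w
    rw [ContinuousAlternatingMap.smul_apply, dx_apply, Matrix.det_fin_zero, smul_eq_mul, mul_one]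
    congr 1; exact Subsingleton.elim _ _
  rw [hα, wedge_smul_left, wedge_dx, ← hα]
  congr 2
  funext a
  have : Fin.cast h.symm a = Fin.natAdd 0 a := by ext; simp
  rw [join, this, Fin.append_right]

theorem wedge_comm (h : k + l = n) (h' : l + k = n) (α : Alt d k) (β : Alt d l) :
    wedge h α β = (-1 : ℝ) ^ (k * l) • wedge h' β α := by
  induction k generalizing n with
  | zero =>
    obtain rfl : l = n := by omega
    rw [wedge_zero_form h rfl]
    simp only [zero_mul, pow_zero, one_smul]
    induction β using dx_induction with
    | h0 => simp
    | hadd _ _ h h' => simp only [wedge_add_left, smul_add, h, h']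
    | hsmul _ _ h => simp only [wedge_smul_left, ← h]; rw [smul_comm]
    | hdx j =>
    have hα : α = α ![] • dx ![] := by
      ext w
      rw [ContinuousAlternatingMap.smul_apply, dx_apply, Matrix.det_fin_zero, smul_eq_mul, mul_one]
      congr 1; exact Subsingleton.elim _ _
    rw [hα, wedge_smul_right, wedge_dx, ← hα]
    congr 2
    funext a
    have : Fin.cast h'.symm a = Fin.castAdd 0 a := by ext; simp
    rw [join, this, Fin.append_left]
  | succ k ih =>
    refine wedge_induction (P := fun α => wedge h α β = (-1 : ℝ) ^ ((k + 1) * l) • wedge h' β α)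
      (add_comm 1 k) α ?_ ?_ ?_ ?_
    · simp
    · intro _ _ h h'; simp only [wedge_add_left, wedge_add_right, h, h', smul_add]
    · intro _ _ h; simp only [wedge_smul_left, wedge_smul_right, h]; rw [smul_comm]
    · intro μ γ
      rw [wedge_assoc (add_comm 1 k) h (rfl : k + l = k + l) (by omega), ih rfl (add_comm l k),
        wedge_smul_right, ← wedge_assoc (rfl : 1 + l = 1 + l) (by omega) (add_comm l k) (by omega),
        wedge_one_comm rfl (add_comm l 1) μ β, wedge_smul_left, smul_smul, ← pow_add,
        wedge_assoc (add_comm l 1) (by omega) (add_comm 1 k) (by omega)]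
      congr 2; ring

end Wedge

end Algebra

section Algebra

variable {d : ℕ}

/-! ### One-forms and interior products -/

section Interior

variable {k l n : ℕ}

theorem form_eq_zero_of_lt (h : d < k) (α : Alt d k) : α = 0 :=
  ext_e fun i hi => absurd (Fintype.card_le_of_injective i hi) (by simpa using h)

theorem wedge_one_apply (h : 1 + k = k + 1) (μ : Alt d 1) (ψ : Alt d k)
    (w : Fin (k + 1) → Spacetime d) :
    wedge h μ ψ w = ∑ i : Fin (k + 1), (-1 : ℝ) ^ (i : ℕ) * μ (fun _ => w i) *
      ψ (i.removeNth w) := by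
  induction μ using dx_induction with
  | h0 => simp
  | hadd _ _ h h' =>
    simp only [wedge_add_left, ContinuousAlternatingMap.add_apply, h, h', mul_add, add_mul,
      Finset.sum_add_distrib]
  | hsmul c _ h =>
    simp only [wedge_smul_left, ContinuousAlternatingMap.smul_apply, h, smul_eq_mul,
      Finset.mul_sum]
    exact Finset.sum_congr rfl fun _ _ => by ring
  | hdx i =>
  induction ψ using dx_induction with
  | h0 => simp
  | hadd _ _ h h' =>
    simp only [wedge_add_right, ContinuousAlternatingMap.add_apply, h, h', mul_add,
      Finset.sum_add_distrib]
  | hsmul c _ h =>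
    simp only [wedge_smul_right, ContinuousAlternatingMap.smul_apply, h, smul_eq_mul,
      Finset.mul_sum]
    exact Finset.sum_congr rfl fun _ _ => by ring
  | hdx j =>
  let u : Fin (k + 1) → Fin d := Fin.cons (i 0) j
  have h1 : dx u = wedge h (dx i) (dx j) := by
    rw [dx_succ h u]
    congr 2
    funext a
    rw [Subsingleton.elim a 0]
    rfl
  rw [← h1, dx_apply, Matrix.det_succ_column_zero]
  refine Finset.sum_congr rfl fun a _ => ?_
  rw [dx_apply, dx_apply, Matrix.det_fin_one]
  rfl

/-- Wedging with a one-form, in the form in which it enters the exterior derivative. -/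
theorem wedge_ofSubsingleton (h : 1 + k = k + 1) (μ : Spacetime d →L[ℝ] ℝ) (ψ : Alt d k) :
    wedge h (ContinuousAlternatingMap.ofSubsingleton ℝ (Spacetime d) ℝ (0 : Fin 1) μ) ψ =
      ContinuousAlternatingMap.alternatizeUncurryFin (μ.smulRight ψ) := by
  ext w
  rw [wedge_one_apply, ContinuousAlternatingMap.alternatizeUncurryFin_apply]
  refine Finset.sum_congr rfl fun a _ => ?_
  simp only [ContinuousAlternatingMap.ofSubsingleton_apply_apply,
    ContinuousLinearMap.smulRight_apply, ContinuousAlternatingMap.smul_apply, smul_eq_mul,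
    zsmul_eq_mul]
  push_cast
  ring

theorem wedge_self (h : 1 + k = n) (h' : 1 + n = l) (μ : Alt d 1) (ψ : Alt d k) :
    wedge h' μ (wedge h μ ψ) = 0 := by
  have h2 : wedge (rfl : 1 + 1 = 2) μ μ = 0 := by
    ext w
    have := congrArg (fun α : Alt d 2 => α w) (wedge_one_comm (rfl : 1 + 1 = 2) rfl μ μ)
    simp only [pow_one, ContinuousAlternatingMap.smul_apply, smul_eq_mul] at this
    change wedge rfl μ μ w = 0
    linarith
  rw [← wedge_assoc (rfl : 1 + 1 = 2) (by omega) h h', h2, wedge_zero_left]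

/-- `ι_v (μ ∧ ψ) = μ(v) ψ - μ ∧ ι_v ψ`. -/
theorem curryLeft_wedge_one (h : 1 + (k + 1) = k + 1 + 1) (h' : 1 + k = k + 1) (μ : Alt d 1)
    (ψ : Alt d (k + 1)) (v : Spacetime d) :
    (wedge h μ ψ).curryLeft v = μ (fun _ => v) • ψ - wedge h' μ (ψ.curryLeft v) := by
  ext w
  simp only [ContinuousAlternatingMap.curryLeft_apply_apply, ContinuousAlternatingMap.sub_apply,
    ContinuousAlternatingMap.smul_apply, smul_eq_mul]
  rw [wedge_one_apply, wedge_one_apply, Fin.sum_univ_succ, sub_eq_add_neg, ← Finset.sum_neg_distrib]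
  congr 1
  · simp [Matrix.vecCons]
  · refine Finset.sum_congr rfl fun i _ => ?_
    have h3 : i.succ.removeNth (α := fun _ => Spacetime d) (Matrix.vecCons v w) =
        Matrix.vecCons v (i.removeNth w) := by
      funext a
      refine Fin.cases ?_ (fun b => ?_) a
      · simp [Fin.removeNth]
      · simp [Fin.removeNth]
    rw [h3, ContinuousAlternatingMap.curryLeft_apply_apply]
    simp only [Fin.val_succ, Matrix.cons_val_succ, pow_succ]
    ring

/-- A form annihilated by `μ ∧` is `μ ∧` something, if `μ(v) ≠ 0` for some `v`. -/
theorem eq_wedge_of_wedge_eq_zero (h : 1 + (k + 1) = k + 1 + 1) (h' : 1 + k = k + 1) (μ : Alt d 1)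
    (ψ : Alt d (k + 1)) (v : Spacetime d) (hv : μ (fun _ => v) ≠ 0) (hψ : wedge h μ ψ = 0) :
    ψ = wedge h' μ ((μ (fun _ => v))⁻¹ • ψ.curryLeft v) := by
  have := curryLeft_wedge_one h h' μ ψ v
  rw [hψ, ContinuousAlternatingMap.curryLeft_zero, _root_.zero_apply, eq_comm,
    sub_eq_zero] at this
  rw [wedge_smul_right, ← this, smul_smul, inv_mul_cancel₀ hv, one_smul]

theorem curryLeft_one (μ : Alt d 1) (v : Spacetime d) (ψ : Alt d l) :
    wedge (zero_add l) (μ.curryLeft v) ψ = μ (fun _ => v) • ψ := by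
  rw [wedge_zero_form _ rfl]
  congr 1
  refine congrArg μ (funext fun a => ?_)
  obtain rfl : a = 0 := Subsingleton.elim (α := Fin 1) a 0
  rfl

/-- Interior products can be moved across a wedge product of total degree `d + 1`, since the
product itself vanishes. -/
theorem curryLeft_wedge_comm (h : k + (l + 1) = d) (h' : (k + 1) + l = d) (α : Alt d (k + 1))
    (β : Alt d (l + 1)) (v : Spacetime d) :
    wedge h (α.curryLeft v) β = (-1 : ℝ) ^ k • wedge h' α (β.curryLeft v) := by
  induction k generalizing l with
  | zero =>
    have hl : wedge (add_comm 1 (l + 1)) α β = 0 := form_eq_zero_of_lt (by omega) _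
    have h1 := curryLeft_wedge_one (add_comm 1 (l + 1)) (add_comm 1 l) α β v
    rw [hl, ContinuousAlternatingMap.curryLeft_zero, _root_.zero_apply, eq_comm,
      sub_eq_zero] at h1
    obtain rfl : l + 1 = d := by omega
    rw [curryLeft_one, h1, pow_zero, one_smul]
  | succ k ih =>
    refine wedge_induction (P := fun α => wedge h (α.curryLeft v) β =
      (-1 : ℝ) ^ (k + 1) • wedge h' α (β.curryLeft v)) (add_comm 1 (k + 1)) α ?_ ?_ ?_ ?_
    · simp
    · intro _ _ h h'
      simp only [wedge_add_left, ContinuousAlternatingMap.curryLeft_add,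
        _root_.add_apply, h, h', smul_add]
    · intro _ _ h
      simp only [wedge_smul_left, ContinuousAlternatingMap.curryLeft_smul,
        _root_.smul_apply, h]
      rw [smul_comm]
    · intro μ γ
      rw [curryLeft_wedge_one (add_comm 1 (k + 1)) (add_comm 1 k), wedge_sub_left, wedge_smul_left,
        wedge_one_comm (add_comm 1 k) rfl, wedge_smul_left,
        wedge_assoc rfl h (add_comm 1 (l + 1)) (by omega), ih (by omega) (by omega),
        curryLeft_wedge_one (add_comm 1 (l + 1)) (add_comm 1 l), wedge_sub_right,
        wedge_smul_right, smul_smul, ← mul_pow, neg_one_mul, neg_neg, one_pow, one_smul,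
        wedge_one_comm (add_comm 1 (k + 1)) rfl, wedge_smul_left,
        wedge_assoc rfl h' (add_comm 1 l) (by omega), smul_smul, ← mul_pow, neg_one_mul, neg_neg,
        one_pow, one_smul]
      abel

end Interior

/-! ### The Minkowski inner product and the Hodge star -/

section Hodge

variable {k l n : ℕ}

theorem eta_mul_self (i : Fin d) : eta i * eta i = 1 := by
  unfold eta; split_ifs <;> norm_num

/-- The vector metrically dual to a one-form. -/
def sharp (μ : Alt d 1) : Spacetime d := fun i => eta i * μ (fun _ => e i)

theorem sharp_add (μ ν : Alt d 1) : sharp (μ + ν) = sharp μ + sharp ν := by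
  funext i; simp [sharp, mul_add]

theorem sharp_smul (c : ℝ) (μ : Alt d 1) : sharp (c • μ) = c • sharp μ := by
  funext i; simp [sharp, mul_left_comm]

theorem sharp_dx (i : Fin 1 → Fin d) : sharp (dx i) = eta (i 0) • e (i 0) := by
  funext j
  simp only [sharp, dx_apply, Matrix.det_fin_one, Matrix.of_apply, Pi.smul_apply, smul_eq_mul,
    e_apply]
  by_cases h : j = i 0
  · simp [h]
  · simp [h, Ne.symm h]

/-- The inner product `⟨α, β⟩ = (1 / k!) α^{i₁…i_k} β_{i₁…i_k}` of forms. -/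
def ip (α β : Alt d k) : ℝ :=
  (k.factorial : ℝ)⁻¹ *
    ∑ i : Fin k → Fin d, (∏ m, eta (i m)) * α (fun m => e (i m)) * β (fun m => e (i m))

theorem ip_comm (α β : Alt d k) : ip α β = ip β α := by
  unfold ip
  congr 1
  exact Finset.sum_congr rfl fun _ _ => by ring

theorem ip_add_right (α β γ : Alt d k) : ip α (β + γ) = ip α β + ip α γ := by
  simp only [ip, ContinuousAlternatingMap.add_apply, mul_add, Finset.sum_add_distrib]

theorem ip_smul_right (c : ℝ) (α β : Alt d k) : ip α (c • β) = c * ip α β := by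
  simp only [ip, ContinuousAlternatingMap.smul_apply, smul_eq_mul, Finset.mul_sum]
  exact Finset.sum_congr rfl fun _ _ => by ring

theorem ip_add_left (α β γ : Alt d k) : ip (α + β) γ = ip α γ + ip β γ := by
  rw [ip_comm, ip_add_right, ip_comm γ, ip_comm γ]

theorem ip_smul_left (c : ℝ) (α β : Alt d k) : ip (c • α) β = c * ip α β := by
  rw [ip_comm, ip_smul_right, ip_comm]

@[simp] theorem ip_zero_right (α : Alt d k) : ip α 0 = 0 := by
  simpa using ip_smul_right 0 α 0

@[simp] theorem ip_zero_left (α : Alt d k) : ip 0 α = 0 := by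
  rw [ip_comm, ip_zero_right]

theorem ip_sub_left (α β γ : Alt d k) : ip (α - β) γ = ip α γ - ip β γ := by
  rw [sub_eq_add_neg, ← neg_one_smul ℝ, ip_add_left, ip_smul_left]; ring

/-- The inner product as a continuous bilinear map. -/
def ipL : Alt d k →L[ℝ] Alt d k →L[ℝ] ℝ :=
  (LinearMap.mk₂ ℝ ip ip_add_left ip_smul_left ip_add_right
    ip_smul_right).toContinuousBilinearMap

theorem ipL_apply (α β : Alt d k) : ipL α β = ip α β := rfl

theorem prod_eta_perm (i : Fin k → Fin d) (σ : Equiv.Perm (Fin k)) :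
    ∏ m, eta (i (σ m)) = ∏ m, eta (i m) :=
  Equiv.prod_comp σ fun m => eta (i m)

theorem ip_dx (α : Alt d k) (i : Fin k → Fin d) :
    ip α (dx i) = (∏ m, eta (i m)) * α (fun m => e (i m)) := by
  have h := sum_dx_smul (fun j : Fin k → Fin d => (∏ m, eta (j m)) * α (fun m => e (j m)))
    (fun j σ => by rw [prod_eta_perm j σ, alt_perm, smul_eq_mul, smul_eq_mul]; ring) i
  simp only [smul_eq_mul] at h
  rw [ip, inv_mul_eq_iff_eq_mul₀ (fact_ne k), ← h]
  exact Finset.sum_congr rfl fun _ _ => by ring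

theorem ip_nondegenerate {α : Alt d k} (h : ∀ β, ip α β = 0) : α = 0 := by
  refine ext_e fun i _ => ?_
  have h1 := h (dx i)
  rw [ip_dx] at h1
  rcases mul_eq_zero.1 h1 with h2 | h2
  · obtain ⟨m, -, hm⟩ := Finset.prod_eq_zero_iff.1 h2
    have := eta_mul_self (i m)
    rw [hm] at this
    norm_num at this
  · simpa using h2

theorem ip_ext {α β : Alt d k} (h : ∀ γ, ip γ α = ip γ β) : α = β := by
  rw [← sub_eq_zero]
  refine ip_nondegenerate fun γ => ?_
  rw [ip_sub_left, ip_comm, h, ip_comm, sub_self]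

/-- The interior product with `μ♯` is adjoint to the wedge product with `μ`. -/
theorem ip_wedge_one (h : 1 + k = k + 1) (α : Alt d (k + 1)) (μ : Alt d 1) (β : Alt d k) :
    ip α (wedge h μ β) = ip (α.curryLeft (sharp μ)) β := by
  induction μ using dx_induction with
  | h0 =>
    have : sharp (0 : Alt d 1) = 0 := by funext i; simp [sharp]
    simp [this]
  | hadd _ _ h h' => simp only [wedge_add_left, ip_add_right, h, h', sharp_add, map_add,
      ip_add_left]
  | hsmul _ _ h => simp only [wedge_smul_left, ip_smul_right, h, sharp_smul, map_smul,
      ip_smul_left]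
  | hdx i =>
  induction β using dx_induction with
  | h0 => simp
  | hadd _ _ h h' => simp only [wedge_add_right, ip_add_right, h, h']
  | hsmul _ _ h => simp only [wedge_smul_right, ip_smul_right, h]
  | hdx j =>
  let u : Fin (k + 1) → Fin d := Fin.cons (i 0) j
  have h1 : dx u = wedge h (dx i) (dx j) := by
    rw [dx_succ h u]
    congr 2
    funext a
    rw [Subsingleton.elim a 0]
    rfl
  rw [← h1, ip_dx, ip_dx, sharp_dx, map_smul, Fin.prod_univ_succ,
    ContinuousAlternatingMap.smul_apply, ContinuousAlternatingMap.curryLeft_apply_apply]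
  have h2 : (fun m => e (u m)) = Matrix.vecCons (e (i 0)) (fun m => e (j m)) := by
    funext a
    refine Fin.cases ?_ (fun b => ?_) a <;> simp [u]
  rw [h2, smul_eq_mul]
  simp only [u, Fin.cons_zero, Fin.cons_succ]
  ring

theorem density_vol : density (vol d) = 1 := by
  rw [density, vol, dx_apply]
  have : (Matrix.of fun a b => (e a : Spacetime d) b) = 1 := by
    ext a b; simp [e_apply, Matrix.one_apply, eq_comm]
  rw [this, Matrix.det_one]

theorem density_smul (c : ℝ) (α : Alt d d) : density (c • α) = c * density α := rfl

/-- The component of a top-degree form, as a continuous linear map. -/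
def densityL : Alt d d →L[ℝ] ℝ := ContinuousAlternatingMap.apply ℝ (Spacetime d) ℝ (fun i => e i)

theorem densityL_apply (α : Alt d d) : densityL α = density α := rfl

theorem density_dx (i : Fin d → Fin d) : density (dx i) = vol d (fun m => e (i m)) := by
  rw [density, vol, dx_apply_e_comm]

theorem eq_density_smul_vol (α : Alt d d) : α = density α • vol d := by
  refine ext_e fun i hi => ?_
  let σ : Equiv.Perm (Fin d) := Equiv.ofBijective i (Finite.injective_iff_bijective.1 hi)
  have h1 := alt_perm α id σ
  have h2 := alt_perm (vol d) id σ
  have h3 : vol d (fun i => e i) = 1 := density_vol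
  simp only [id] at h1 h2
  change α (fun m => e (σ m)) = (density α • vol d) (fun m => e (σ m))
  rw [ContinuousAlternatingMap.smul_apply, h1, h2, h3, density]
  simp [mul_comm]

theorem density_wedge (h : k + l = d) (α : Alt d k) (β : Alt d l) :
    density (wedge h α β) = ((k.factorial : ℝ) * (l.factorial : ℝ))⁻¹ *
      ∑ i : Fin k → Fin d, ∑ j : Fin l → Fin d,
        α (fun m => e (i m)) * β (fun m => e (j m)) * levi h i j := by
  rw [← densityL_apply, wedge, map_smul, map_sum, smul_eq_mul]
  congr 1
  refine Finset.sum_congr rfl fun i _ => ?_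
  rw [map_sum]
  refine Finset.sum_congr rfl fun j _ => ?_
  rw [map_smul, densityL_apply, density_dx, smul_eq_mul, levi]

theorem prod_eta (hd : 0 < d) : ∏ i : Fin d, eta i = -1 := by
  obtain ⟨n, rfl⟩ : ∃ n, d = n + 1 := ⟨d - 1, by omega⟩
  rw [Fin.prod_univ_succ]
  simp [eta]

theorem eta_mul_levi (hd : 0 < d) (h : k + l = d) (i : Fin k → Fin d) (j : Fin l → Fin d) :
    (∏ m, eta (i m)) * (∏ m, eta (j m)) * levi h i j = -levi h i j := by
  by_cases hi : Function.Injective (join h i j)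
  · let σ : Equiv.Perm (Fin d) := Equiv.ofBijective _ (Finite.injective_iff_bijective.1 hi)
    have h1 : ∏ m, eta (join h i j m) = ∏ m : Fin d, eta m := Equiv.prod_comp σ fun m => eta m
    have h2 : ∏ m, eta (join h i j m) = (∏ m, eta (i m)) * ∏ m, eta (j m) := by
      subst h
      rw [Fin.prod_univ_add]
      simp [join]
    rw [← h2, h1, prod_eta hd, neg_one_mul]
  · have h0 : levi h i j = 0 := by
      rw [levi, ← density_dx, dx_eq_zero hi]
      rfl
    simp [h0]

theorem hodge_add (h : k + l = d) (α β : Alt d k) : hodge h (α + β) = hodge h α + hodge h β := by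
  simp only [hodge, ContinuousAlternatingMap.add_apply, mul_add, add_mul, add_smul,
    Finset.sum_add_distrib, smul_add]

theorem hodge_smul (h : k + l = d) (c : ℝ) (α : Alt d k) : hodge h (c • α) = c • hodge h α := by
  simp only [hodge, ContinuousAlternatingMap.smul_apply, smul_eq_mul, Finset.smul_sum, smul_smul]
  refine Finset.sum_congr rfl fun i _ => Finset.sum_congr rfl fun j _ => ?_
  congr 1; ring

/-- The Hodge star as a continuous linear map. -/
def hodgeL (h : k + l = d) : Alt d k →L[ℝ] Alt d l :=
  LinearMap.toContinuousLinearMap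
    { toFun := hodge h, map_add' := hodge_add h, map_smul' := hodge_smul h }

@[simp] theorem hodge_zero (h : k + l = d) : hodge h (0 : Alt d k) = 0 :=
  map_zero (hodgeL h)

theorem hodge_neg (h : k + l = d) (α : Alt d k) : hodge h (-α) = -hodge h α :=
  map_neg (hodgeL h) α

theorem hodge_sub (h : k + l = d) (α β : Alt d k) : hodge h (α - β) = hodge h α - hodge h β :=
  map_sub (hodgeL h) α β

/-- Pairing with a Hodge dual in the Lorentzian inner product. The sign is the determinant of the
metric. -/
theorem ip_hodge (hd : 0 < d) (h : k + l = d) (β : Alt d l) (α : Alt d k) :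
    ip β (hodge h α) = -density (wedge h α β) := by
  rw [density_wedge, hodge, ip_smul_right, ← mul_neg, ← Finset.sum_neg_distrib]
  congr 1
  rw [← ipL_apply, map_sum]
  refine Finset.sum_congr rfl fun i _ => ?_
  rw [map_sum, ← Finset.sum_neg_distrib]
  refine Finset.sum_congr rfl fun j _ => ?_
  rw [map_smul, ipL_apply, ip_dx, smul_eq_mul]
  have := eta_mul_levi hd h i j
  linear_combination (α (fun m => e (i m)) * β (fun m => e (j m))) * this

/-- `μ ∧ ⋆β = ± ⋆ ι_{μ♯} β`. -/
theorem wedge_one_hodge (hd : 0 < d) (h : (k + 1) + l = d) (h' : k + (l + 1) = d) (μ : Alt d 1)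
    (β : Alt d (k + 1)) :
    wedge (add_comm 1 l) μ (hodge h β) = (-1 : ℝ) ^ k • hodge h' (β.curryLeft (sharp μ)) := by
  refine ip_ext fun γ => ?_
  rw [ip_wedge_one, ip_hodge hd, ip_smul_right, ip_hodge hd, curryLeft_wedge_comm h' h,
    density_smul, mul_neg, ← mul_assoc, ← mul_pow, neg_one_mul, neg_neg, one_pow, one_mul]

theorem hodge_zero_form (h : 0 + d = d) (β : Alt d 0) : hodge h β = β ![] • vol d := by
  rw [hodge, Fintype.sum_eq_single (default : Fin 0 → Fin d)
    (fun x hx => absurd (Subsingleton.elim _ _) hx)]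
  have h2 : ∀ j : Fin d → Fin d, levi h default j = vol d (fun m => e (j m)) := by
    intro j
    rw [levi]
    congr 1
    funext m
    have : Fin.cast h.symm m = Fin.natAdd 0 m := by ext; simp
    rw [join, this, Fin.append_right]
  simp only [h2, Finset.univ_eq_empty, Finset.prod_empty, one_mul, ← smul_smul,
    ← Finset.smul_sum, sum_smul_dx]
  rw [smul_smul, smul_smul, Nat.factorial_zero, Nat.cast_one, one_mul]
  congr 1
  rw [mul_right_comm, inv_mul_cancel₀ (fact_ne d), one_mul]
  congr 1
  exact Subsingleton.elim _ _

/-- The normalisation `α ∧ ⋆β = ⟨α, β⟩ vol`. -/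
theorem wedge_hodge (hd : 0 < d) (h : k + l = d) (α β : Alt d k) :
    wedge h α (hodge h β) = ip α β • vol d := by
  induction k generalizing l with
  | zero =>
    obtain rfl : l = d := by omega
    rw [hodge_zero_form, wedge_zero_form _ rfl, smul_smul]
    congr 1
    simp only [ip, Nat.factorial_zero, Nat.cast_one, inv_one, one_mul, Finset.univ_eq_empty,
      Finset.prod_empty]
    rw [Fintype.sum_eq_single (default : Fin 0 → Fin l)
      (fun x hx => absurd (Subsingleton.elim _ _) hx)]
    congr 2 <;> exact Subsingleton.elim _ _
  | succ k ih =>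
    refine wedge_induction (P := fun α => wedge h α (hodge h β) = ip α β • vol d)
      (add_comm 1 k) α ?_ ?_ ?_ ?_
    · simp
    · intro _ _ h h'; simp only [wedge_add_left, h, h', ip_add_left, add_smul]
    · intro _ _ h; simp only [wedge_smul_left, h, ip_smul_left, mul_smul]
    · intro μ γ
      rw [wedge_one_comm (add_comm 1 k) rfl, wedge_smul_left,
        wedge_assoc rfl h (add_comm 1 l) (by omega), wedge_one_hodge hd h (by omega),
        wedge_smul_right, smul_smul, ← mul_pow, neg_one_mul, neg_neg, one_pow, one_smul,
        ih, ← wedge_one_comm (add_comm 1 k) rfl, ip_comm _ β, ip_wedge_one, ip_comm]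

theorem density_wedge_hodge (hd : 0 < d) (h : k + l = d) (α β : Alt d k) :
    density (wedge h α (hodge h β)) = ip α β := by
  rw [wedge_hodge hd, density_smul, density_vol, mul_one]

theorem hodge_hodge (hd : 0 < d) (h : k + l = d) (h' : l + k = d) (α : Alt d k) :
    hodge h' (hodge h α) = -(-1 : ℝ) ^ (k * l) • α := by
  refine ip_ext fun γ => ?_
  rw [ip_hodge hd, wedge_comm h' h, density_smul, density_wedge_hodge hd, ip_smul_right,
    mul_comm l k, neg_mul]

theorem ip_hodge_hodge (hd : 0 < d) (h : k + l = d) (α β : Alt d k) :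
    ip (hodge h α) (hodge h β) = -ip α β := by
  rw [ip_hodge hd, density_wedge_hodge hd, ip_comm]

theorem wedge_nondegenerate_left (hd : 0 < d) (h : k + l = d) {α : Alt d k}
    (hα : ∀ β : Alt d l, density (wedge h α β) = 0) : α = 0 :=
  ip_nondegenerate fun β => by rw [← density_wedge_hodge hd h, hα]

theorem wedge_nondegenerate_right (hd : 0 < d) (h : k + l = d) {β : Alt d l}
    (hβ : ∀ α : Alt d k, density (wedge h α β) = 0) : β = 0 := by
  refine wedge_nondegenerate_left hd ((add_comm l k).trans h) fun α => ?_
  rw [wedge_comm _ h, density_smul, hβ, mul_zero]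

/-- The `d`-dimensional identity behind the shift symmetry: `μ ∧ ι_{μ♯} + ⋆ (μ ∧ ι_{μ♯}) ⋆⁻¹` is
multiplication by `⟨μ, μ⟩`. -/
theorem sharp_smul_hodge (hd : 0 < d) (h : (k + 1) + (l + 1) = d) (μ : Alt d 1)
    (ψ : Alt d (k + 1)) :
    μ (fun _ => sharp μ) • hodge h ψ =
      wedge (add_comm 1 l) μ ((hodge h ψ).curryLeft (sharp μ)) +
        hodge h (wedge (add_comm 1 k) μ (ψ.curryLeft (sharp μ))) := by
  refine ip_ext fun γ => ?_
  -- by adjointness, the inner products with `γ` become densities of wedge products, of which the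
  -- two equal to `ψ ∧ μ ∧ ι_{μ♯} γ` cancel
  have c2 := curryLeft_wedge_one (add_comm 1 (k + 1)) (add_comm 1 k) μ ψ (sharp μ)
  have c3 : wedge (add_comm 1 k) μ (ψ.curryLeft (sharp μ)) =
      μ (fun _ => sharp μ) • ψ - (wedge (add_comm 1 (k + 1)) μ ψ).curryLeft (sharp μ) := by
    rw [c2]; abel
  have c4 : wedge h ((wedge (add_comm 1 (k + 1)) μ ψ).curryLeft (sharp μ)) γ =
      wedge h ψ (wedge (add_comm 1 l) μ (γ.curryLeft (sharp μ))) := by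
    rw [curryLeft_wedge_comm h (by omega : (k + 1 + 1) + l = d),
      wedge_one_comm (add_comm 1 (k + 1)) rfl, wedge_smul_left,
      wedge_assoc rfl _ (add_comm 1 l) h, smul_smul, ← mul_pow, neg_one_mul, neg_neg, one_pow,
      one_smul]
  rw [ip_smul_right, ip_add_right, ip_wedge_one, ip_comm (γ.curryLeft _),
    ← ip_wedge_one (add_comm 1 l), ip_hodge hd, ip_comm, ip_hodge hd, ip_hodge hd, c3, wedge_sub_left, c4, wedge_smul_left,
    ← densityL_apply, ← densityL_apply, ← densityL_apply, map_sub, map_smul, smul_eq_mul]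
  ring

end Hodge

end Algebra

/-! ### Exterior calculus -/

section Calculus

variable {d k l n : ℕ}

theorem minSmoothness_le_infty : minSmoothness ℝ 2 ≤ (∞ : WithTop ℕ∞) := by
  rw [minSmoothness_of_isRCLikeNormedField]
  exact WithTop.coe_le_coe.2 le_top

theorem smooth_ne_zero : (∞ : WithTop ℕ∞) ≠ 0 := by simp

theorem contDiff_extDeriv {α : Form d k} (hα : ContDiff ℝ ∞ α) :
    ContDiff ℝ ∞ (extDeriv α) := by
  have h := (ContinuousAlternatingMap.alternatizeUncurryFinCLM (n := k) ℝ (Spacetime d) ℝ).contDiff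
    (n := ∞) |>.comp (hα.fderiv_right (m := ∞) (by simp))
  exact h

theorem tsupport_extDeriv_subset (α : Form d k) : tsupport (extDeriv α) ⊆ tsupport α := by
  refine (closure_mono ?_).trans (tsupport_fderiv_subset ℝ (f := α))
  intro x hx
  contrapose! hx
  simp only [Function.mem_support, not_not] at hx ⊢
  rw [extDeriv, hx]
  simp [← ContinuousAlternatingMap.alternatizeUncurryFinCLM_apply]

theorem extDeriv_comp_self {α : Form d k} (hα : ContDiff ℝ ∞ α) (x : Spacetime d) :
    extDeriv (extDeriv α) x = 0 :=
  congrFun (extDeriv_extDeriv hα minSmoothness_le_infty) x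

theorem extDeriv_zero : extDeriv (0 : Form d k) = 0 := by
  funext x
  have := extDeriv_smul (𝕜 := ℝ) (x := x) 0 (0 : Form d k)
  simpa using this

theorem extDeriv_sub' {α β : Form d k} (hα : ContDiff ℝ ∞ α) (hβ : ContDiff ℝ ∞ β)
    (x : Spacetime d) :
    extDeriv (fun y => α y - β y) x = extDeriv α x - extDeriv β x := by
  have h1 : ContDiff ℝ ∞ fun y => (-1 : ℝ) • β y := hβ.const_smul (-1 : ℝ)
  have h := extDeriv_fun_add (𝕜 := ℝ) (x := x) (hα.differentiable smooth_ne_zero x)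
    (h1.differentiable smooth_ne_zero x)
  have h2 : extDeriv (fun y => (-1 : ℝ) • β y) x = (-1 : ℝ) • extDeriv β x :=
    extDeriv_fun_smul (-1) β
  have h3 : (fun y => α y - β y) = fun y => α y + (-1 : ℝ) • β y := by
    funext y; ext w; simp [sub_eq_add_neg]
  rw [h3, h, h2]
  ext w
  simp [sub_eq_add_neg]

/-- `d(f α) = df ∧ α + f dα`. -/
theorem extDeriv_smul_fun {f : Spacetime d → ℝ} {α : Form d k} (hf : ContDiff ℝ ∞ f)
    (hα : ContDiff ℝ ∞ α) (x : Spacetime d) :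
    extDeriv (fun y => f y • α y) x = daWedge rfl f α x + f x • extDeriv α x := by
  rw [daWedge, dScalar, wedge_ofSubsingleton, extDeriv, extDeriv,
    fderiv_fun_smul (hf.differentiable smooth_ne_zero x) (hα.differentiable smooth_ne_zero x),
    ContinuousAlternatingMap.alternatizeUncurryFin_add,
    ContinuousAlternatingMap.alternatizeUncurryFin_smul]
  exact add_comm _ _

/-- The exterior derivative as `∑ dx^i ∧ ∂_i`. -/
theorem alternatizeUncurryFin_eq_sum (h : 1 + k = k + 1) (L : Spacetime d →L[ℝ] Alt d k) :
    ContinuousAlternatingMap.alternatizeUncurryFin L =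
      ∑ i : Fin d, wedge h (dx fun _ => i) (L (e i)) := by
  ext w
  rw [ContinuousAlternatingMap.sum_apply, ContinuousAlternatingMap.alternatizeUncurryFin_apply]
  simp only [wedge_one_apply]
  rw [Finset.sum_comm]
  refine Finset.sum_congr rfl fun a _ => ?_
  have h1 : L (w a) = ∑ i, w a i • L (e i) := by
    conv_lhs => rw [pi_eq_sum_univ' (w a)]
    rw [map_sum]
    refine Finset.sum_congr rfl fun i _ => ?_
    rw [map_smul]
    rfl
  rw [h1, ContinuousAlternatingMap.sum_apply, Finset.smul_sum]
  refine Finset.sum_congr rfl fun i _ => ?_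
  simp only [dx_apply, Matrix.det_fin_one, Matrix.of_apply, ContinuousAlternatingMap.smul_apply,
    smul_eq_mul, zsmul_eq_mul]
  push_cast
  ring

/-- The Leibniz rule for the product with a closed form. -/
theorem extDeriv_wedge_closed (h : k + l = n) (h' : k + 1 + l = n + 1) {α : Form d k}
    {β : Form d l} (hα : ContDiff ℝ ∞ α) (hβ : ContDiff ℝ ∞ β) (x : Spacetime d)
    (hcl : extDeriv β x = 0) :
    extDeriv (fun y => wedge h (α y) (β y)) x = wedge h' (extDeriv α x) (β x) := by
  have hd : ∀ v, fderiv ℝ (fun y => wedge h (α y) (β y)) x v =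
      wedge h (α x) (fderiv ℝ β x v) + wedge h (fderiv ℝ α x v) (β x) := by
    intro v
    have := (wedgeL (d := d) h).hasFDerivAt_of_bilinear
      (hα.differentiable smooth_ne_zero x).hasFDerivAt
      (hβ.differentiable smooth_ne_zero x).hasFDerivAt
    have h2 := this.fderiv
    simp only [wedgeL_apply] at h2
    rw [h2]
    rfl
  rw [extDeriv, alternatizeUncurryFin_eq_sum (add_comm 1 l)] at hcl
  rw [extDeriv, extDeriv, alternatizeUncurryFin_eq_sum (add_comm 1 n),
    alternatizeUncurryFin_eq_sum (add_comm 1 k)]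
  simp only [hd, wedge_add_right, Finset.sum_add_distrib, wedge_sum_left]
  have h3 : ∑ i : Fin d, wedge (add_comm 1 n) (dx fun _ => i) (wedge h (α x) (fderiv ℝ β x (e i)))
      = 0 := by
    have h4 : ∀ i : Fin d, wedge (add_comm 1 n) (dx fun _ => i)
        (wedge h (α x) (fderiv ℝ β x (e i))) = (-1 : ℝ) ^ k •
        wedge (by omega : k + (l + 1) = n + 1) (α x)
          (wedge (add_comm 1 l) (dx fun _ => i) (fderiv ℝ β x (e i))) := by
      intro i
      rw [← wedge_assoc (rfl : 1 + k = 1 + k) (by omega) h (add_comm 1 n),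
        wedge_one_comm rfl (add_comm k 1), wedge_smul_left,
        wedge_assoc (add_comm k 1) _ (add_comm 1 l) (by omega)]
    rw [Finset.sum_congr rfl fun i _ => h4 i, ← Finset.smul_sum, ← wedge_sum_right, hcl,
      wedge_zero_right, smul_zero]
  rw [h3, zero_add]
  refine Finset.sum_congr rfl fun i _ => ?_
  rw [wedge_assoc (add_comm 1 k) h' h (add_comm 1 n)]

theorem contDiff_wedge {m : WithTop ℕ∞} (h : k + l = n) {α : Form d k} {β : Form d l}
    (hα : ContDiff ℝ m α) (hβ : ContDiff ℝ m β) :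
    ContDiff ℝ m fun x => wedge h (α x) (β x) := by
  have h1 := ((wedgeL (d := d) h).contDiff (n := m) |>.comp hα).clm_apply hβ
  exact h1

theorem contDiff_hodge {m : WithTop ℕ∞} (h : k + l = d) {α : Form d k} (hα : ContDiff ℝ m α) :
    ContDiff ℝ m fun x => hodge h (α x) := by
  have h1 := (hodgeL h).contDiff (n := m) |>.comp hα
  exact h1

theorem contDiff_dScalar {a : Spacetime d → ℝ} (ha : ContDiff ℝ ∞ a) :
    ContDiff ℝ ∞ (dScalar a) := by
  have h1 := (ContinuousAlternatingMap.ofSubsingletonLIE (𝕜 := ℝ) (E := Spacetime d) (F := ℝ)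
    (0 : Fin 1)).contDiff (n := ∞) |>.comp (ha.fderiv_right (m := ∞) (by simp))
  exact h1

theorem contDiff_daWedge (h : k + 1 = n) {a : Spacetime d → ℝ} {U : Form d k}
    (ha : ContDiff ℝ ∞ a) (hU : ContDiff ℝ ∞ U) : ContDiff ℝ ∞ (daWedge h a U) :=
  contDiff_wedge _ (contDiff_dScalar ha) hU

theorem dScalar_apply (a : Spacetime d → ℝ) (x v : Spacetime d) :
    dScalar a x (fun _ => v) = fderiv ℝ a x v := rfl

theorem gradVec_eq_sharp (a : Spacetime d → ℝ) (x : Spacetime d) :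
    gradVec a x = sharp (dScalar a x) := rfl

theorem fderiv_gradVec (a : Spacetime d → ℝ) (x : Spacetime d) :
    fderiv ℝ a x (gradVec a x) = gradSq a x := by
  conv_lhs => rw [pi_eq_sum_univ' (gradVec a x)]
  rw [map_sum, gradSq]
  refine Finset.sum_congr rfl fun i _ => ?_
  rw [map_smul, smul_eq_mul, gradVec, sq, mul_assoc]
  rfl

theorem contDiff_gradVec {a : Spacetime d → ℝ} (ha : ContDiff ℝ ∞ a) :
    ContDiff ℝ ∞ (gradVec a) := by
  refine contDiff_pi.2 fun i => ?_
  exact contDiff_const.mul ((ha.fderiv_right (m := ∞) (by simp)).clm_apply contDiff_const)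

theorem contDiff_gradSq {a : Spacetime d → ℝ} (ha : ContDiff ℝ ∞ a) :
    ContDiff ℝ ∞ (gradSq a) := by
  refine ContDiff.sum fun i _ => ?_
  exact contDiff_const.mul (((ha.fderiv_right (m := ∞) (by simp)).clm_apply contDiff_const).pow 2)

theorem contDiff_iota {a : Spacetime d → ℝ} {α : Form d (k + 1)} (ha : ContDiff ℝ ∞ a)
    (hα : ContDiff ℝ ∞ α) : ContDiff ℝ ∞ fun x => iota a x (α x) := by
  have h1 := ((ContinuousAlternatingMap.curryLeftLI
    (𝕜 := ℝ) (E := Spacetime d) (F := ℝ) (n := k)).contDiff (n := ∞) |>.comp hα).clm_apply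
    (contDiff_gradVec ha)
  exact h1

/-- A form annihilated by `da ∧` is `da ∧` a form of lower degree, by Cartan's formula. -/
theorem eq_daWedge_iota {a : Spacetime d → ℝ} {x : Spacetime d} (hx : gradSq a x ≠ 0)
    (h : 1 + (k + 1) = k + 1 + 1) (h' : 1 + k = k + 1) (α : Alt d (k + 1))
    (hα : wedge h (dScalar a x) α = 0) :
    α = wedge h' (dScalar a x) ((gradSq a x)⁻¹ • iota a x α) := by
  have h1 : dScalar a x (fun _ => gradVec a x) = gradSq a x := by
    rw [dScalar_apply, fderiv_gradVec]
  have := eq_wedge_of_wedge_eq_zero h h' (dScalar a x) α (gradVec a x) (by rwa [h1]) hα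
  rwa [h1] at this

/-- `d(da ∧ U) = -da ∧ dU`. -/
theorem extDeriv_daWedge {a : Spacetime d → ℝ} {U : Form d k} (ha : ContDiff ℝ ∞ a)
    (hU : ContDiff ℝ ∞ U) (x : Spacetime d) :
    extDeriv (daWedge rfl a U) x = -daWedge rfl a (extDeriv U) x := by
  have h1 : daWedge rfl a U = fun y => extDeriv (fun z => a z • U z) y - a y • extDeriv U y := by
    funext y
    rw [extDeriv_smul_fun ha hU, add_sub_cancel_right]
  have h2 : ContDiff ℝ ∞ fun z => a z • U z := ha.smul hU
  have h3 : ContDiff ℝ ∞ fun z => a z • extDeriv U z := ha.smul (contDiff_extDeriv hU)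
  rw [h1, extDeriv_sub' (contDiff_extDeriv h2) h3, extDeriv_comp_self h2,
    extDeriv_smul_fun ha (contDiff_extDeriv hU), extDeriv_comp_self hU, smul_zero, add_zero, zero_sub]

theorem daWedge_daWedge {r : ℕ} (h : k + 1 = n) (h' : n + 1 = r) (a : Spacetime d → ℝ)
    (U : Form d k) (x : Spacetime d) : daWedge h' a (daWedge h a U) x = 0 :=
  wedge_self _ _ _ _

/-! ### Integration -/

open MeasureTheory

theorem integral_fderiv_eq_zero {f : Spacetime d → ℝ} (hf : ContDiff ℝ ∞ f)
    (hc : HasCompactSupport f) (v : Spacetime d) : ∫ x, fderiv ℝ f x v = 0 := by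
  have hi : Integrable fun x => fderiv ℝ f x v :=
    (((hf.fderiv_right (m := ∞) (by simp)).clm_apply contDiff_const).continuous
      |>.integrable_of_hasCompactSupport (hc.fderiv_apply ℝ v))
  have := integral_mul_fderiv_eq_neg_fderiv_mul_of_integrable (μ := volume)
    (f := fun _ : Spacetime d => (1 : ℝ)) (g := f) (v := v) (by simp)
    (by simpa using hi) (by simpa using hf.continuous.integrable_of_hasCompactSupport hc)
    (fun x _ => differentiableAt_const _) (fun x _ => hf.differentiable smooth_ne_zero x)
  simpa using this

/-- Stokes' theorem for compactly supported forms on `ℝⁿ⁺¹`. -/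
theorem integral_density_extDeriv {K : Form (n + 1) n} (hK : ContDiff ℝ ∞ K)
    (hc : HasCompactSupport K) : ∫ x, density (extDeriv K x) = 0 := by
  have hcomp : ∀ w : Fin n → Spacetime (n + 1), ContDiff ℝ ∞ fun x => K x w := fun w =>
    (ContinuousAlternatingMap.apply ℝ (Spacetime (n + 1)) ℝ w).contDiff.comp hK
  have hsupp : ∀ w : Fin n → Spacetime (n + 1), HasCompactSupport fun x => K x w := fun w =>
    hc.comp_left (g := fun α : Alt (n + 1) n => α w) rfl
  have h1 : ∀ x, density (extDeriv K x) = ∑ i : Fin (n + 1), (-1 : ℝ) ^ (i : ℕ) *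
      fderiv ℝ (fun y => K y (i.removeNth fun j => e j)) x (e i) := by
    intro x
    rw [density, extDeriv_apply (hK.differentiable smooth_ne_zero x)]
    refine Finset.sum_congr rfl fun i _ => ?_
    rw [zsmul_eq_mul]
    push_cast
    rfl
  simp only [h1]
  rw [integral_finsetSum]
  · refine Finset.sum_eq_zero fun i _ => ?_
    rw [integral_const_mul, integral_fderiv_eq_zero (hcomp _) (hsupp _), mul_zero]
  · intro i _
    refine Integrable.const_mul ?_ _
    exact (((hcomp _).fderiv_right (m := ∞) (by simp)).clm_apply contDiff_const).continuous
      |>.integrable_of_hasCompactSupport ((hsupp _).fderiv_apply ℝ _)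

/-- The fundamental lemma of the calculus of variations. -/
theorem eq_zero_of_integral_smooth_mul {f : Spacetime d → ℝ} (hf : Continuous f)
    (h : ∀ g : Spacetime d → ℝ, ContDiff ℝ ∞ g → HasCompactSupport g → ∫ x, g x * f x = 0)
    (x : Spacetime d) : f x = 0 := by
  have := ae_eq_zero_of_integral_contDiff_smul_eq_zero (μ := volume) hf.locallyIntegrable h
  exact congrFun ((hf.ae_eq_iff_eq (μ := volume) continuous_const).1 this) x

/-- The derivative of an integral functional `∫ L(j)` with a `C¹` integrand, along a compactly
supported variation `k` of its argument `j`. -/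
theorem hasDerivAt_integral_comp_add_smul {V : Type*} [NormedAddCommGroup V] [NormedSpace ℝ V]
    {L : V → ℝ} (hL : ContDiff ℝ 1 L) {j k : Spacetime d → V} (hj : Continuous j)
    (hk : Continuous k) (hc : HasCompactSupport k) :
    HasDerivAt (fun t : ℝ => ∫ x, (L (j x + t • k x) - L (j x)))
      (∫ x, fderiv ℝ L (j x) (k x)) 0 := by
  have hL' : Continuous (fderiv ℝ L) := hL.continuous_fderiv one_ne_zero
  obtain ⟨C, hC⟩ : ∃ C, ∀ y ∈ (Metric.closedBall (0 : ℝ) 1) ×ˢ tsupport k,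
      ‖fderiv ℝ L (j y.2 + y.1 • k y.2)‖ ≤ C :=
    ((isCompact_closedBall (0 : ℝ) 1).prod hc).exists_bound_of_continuousOn
      (by fun_prop : Continuous fun y : ℝ × Spacetime d =>
        fderiv ℝ L (j y.2 + y.1 • k y.2)).continuousOn
  have hd : ∀ (x : Spacetime d) (t : ℝ), HasDerivAt (fun t : ℝ => L (j x + t • k x) - L (j x))
      (fderiv ℝ L (j x + t • k x) (k x)) t := by
    intro x t
    have h1 : HasDerivAt (fun t : ℝ => j x + t • k x) (k x) t := by
      simpa using ((hasDerivAt_id t).smul_const (k x)).const_add (j x)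
    exact ((hL.differentiable one_ne_zero _).hasFDerivAt.comp_hasDerivAt t h1).sub_const _
  have key := hasDerivAt_integral_of_dominated_loc_of_deriv_le (μ := volume) (𝕜 := ℝ)
    (F := fun t x => L (j x + t • k x) - L (j x))
    (F' := fun t x => fderiv ℝ L (j x + t • k x) (k x)) (x₀ := 0)
    (s := Metric.closedBall (0 : ℝ) 1) (bound := fun x => C * ‖k x‖)
    (Metric.closedBall_mem_nhds _ one_pos)
    (Filter.Eventually.of_forall fun t => by
      exact (by fun_prop : Continuous fun x =>
        L (j x + t • k x) - L (j x)).aestronglyMeasurable)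
    (by simp)
    (by exact (by fun_prop : Continuous fun x =>
        fderiv ℝ L (j x + (0 : ℝ) • k x) (k x)).aestronglyMeasurable)
    (Filter.Eventually.of_forall fun x t ht => by
      by_cases hx : x ∈ tsupport k
      · exact (fderiv ℝ L (j x + t • k x)).le_of_opNorm_le (hC (t, x) ⟨ht, hx⟩) _
      · simp [image_eq_zero_of_notMem_tsupport hx])
    ((hk.norm.integrable_of_hasCompactSupport hc.norm).const_mul C)
    (Filter.Eventually.of_forall fun x t _ => hd x t)
  simpa using key.2

end Calculus

/-! ### The first variation of the Lagrangian -/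

section Variation

variable {p q : ℕ}

theorem ip_sum_right {d k : ℕ} {ι : Type*} (s : Finset ι) (α : Alt d k) (β : ι → Alt d k) :
    ip α (∑ i ∈ s, β i) = ∑ i ∈ s, ip α (β i) :=
  map_sum (ipL α) β s

theorem ip_hodge_smul_vol {d k l : ℕ} (hd : 0 < d) (h : k + l = d) (β : Alt d l) (α : Alt d k) :
    ip β (hodge h α) • vol d = -wedge h α β := by
  rw [ip_hodge hd]
  ext u
  have := congrArg (fun γ : Alt d d => γ u) (eq_density_smul_vol (wedge h α β))
  simp only [ContinuousAlternatingMap.smul_apply, ContinuousAlternatingMap.neg_apply,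
    smul_eq_mul] at this ⊢
  rw [this]
  ring

theorem ip_halfGrad {d k : ℕ} (𝓕 : Alt d k → ℝ) (Y G : Alt d k) :
    2 * ip (halfGrad 𝓕 Y) G = fderiv ℝ 𝓕 Y G := by
  conv_rhs => rw [eq_sum_dx G, map_smul (fderiv ℝ 𝓕 Y), map_sum (fderiv ℝ 𝓕 Y)]
  rw [halfGrad, ip_smul_left, ip_smul_left, ip_comm, ip_sum_right, ← mul_assoc,
    mul_one_div_cancel two_ne_zero, one_mul, smul_eq_mul]
  congr 1
  refine Finset.sum_congr rfl fun i _ => ?_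
  have h1 : (∏ m, eta (i m)) * (∏ m, eta (i m)) = (1 : ℝ) := by
    rw [← Finset.prod_mul_distrib]
    exact Finset.prod_eq_one fun m _ => eta_mul_self _
  rw [ip_smul_right, ip_dx, map_smul, smul_eq_mul]
  linear_combination (fderiv ℝ 𝓕 Y (dx i) * G (fun m => e (i m))) * h1

/-- The values of `a`, `F₁`, `F₂`, `Q₁`, `Q₂` at a point. -/
abbrev Jet (p q : ℕ) : Type :=
  ℝ × Alt (p + q + 2) (p + 1) × Alt (p + q + 2) (q + 1) × Alt (p + q + 2) (p + 1) ×
    Alt (p + q + 2) (q + 1)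

namespace Jet

/-- The value of the scalar `a`. -/
def a (v : Jet p q) : ℝ := v.1

/-- The value of the field strength `F₁`. -/
def F₁ (v : Jet p q) : Alt (p + q + 2) (p + 1) := v.2.1

/-- The value of the field strength `F₂`. -/
def F₂ (v : Jet p q) : Alt (p + q + 2) (q + 1) := v.2.2.1

/-- The value of the field strength `Q₁`. -/
def Q₁ (v : Jet p q) : Alt (p + q + 2) (p + 1) := v.2.2.2.1

/-- The value of the field strength `Q₂`. -/
def Q₂ (v : Jet p q) : Alt (p + q + 2) (q + 1) := v.2.2.2.2

/-- The value of `H₁ = F₁ + a Q₁`. -/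
def H₁ (v : Jet p q) : Alt (p + q + 2) (p + 1) := v.F₁ + v.a • v.Q₁

/-- The value of `H₂ = F₂ + a Q₂`. -/
def H₂ (v : Jet p q) : Alt (p + q + 2) (q + 1) := v.F₂ + v.a • v.Q₂

/-- The value of `Y = H₁ + ⋆H₂`. -/
def Y (v : Jet p q) : Alt (p + q + 2) (p + 1) := v.H₁ + hodge deg₂₁ v.H₂

/-- The value of the twisted duality expression `H₁ - ⋆H₂ + X`. -/
def D (𝓕 : Alt (p + q + 2) (p + 1) → ℝ) (v : Jet p q) : Alt (p + q + 2) (p + 1) :=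
  v.H₁ - hodge deg₂₁ v.H₂ + halfGrad 𝓕 v.Y

/-- The variation of `H₁` at `v` in the direction `w`. -/
def varH₁ (v w : Jet p q) : Alt (p + q + 2) (p + 1) := w.F₁ + (v.a • w.Q₁ + w.a • v.Q₁)

/-- The variation of `H₂` at `v` in the direction `w`. -/
def varH₂ (v w : Jet p q) : Alt (p + q + 2) (q + 1) := w.F₂ + (v.a • w.Q₂ + w.a • v.Q₂)

/-- The variation of `Y` at `v` in the direction `w`. -/
def varY (v w : Jet p q) : Alt (p + q + 2) (p + 1) := varH₁ v w + hodge deg₂₁ (varH₂ v w)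

/-- The Lagrangian as a function of the values of the fields and field strengths. -/
def lagr (𝓕 : Alt (p + q + 2) (p + 1) → ℝ) (v : Jet p q) : Alt (p + q + 2) (p + q + 2) :=
  wedge deg₁₂ v.H₁ (hodge deg₁₂ v.H₁) + wedge deg₂₁ v.H₂ (hodge deg₂₁ v.H₂)
    - (2 * v.a) • wedge deg₂₁ v.Q₂ v.F₁ + (2 * v.a) • wedge deg₂₁ v.F₂ v.Q₁
    + 𝓕 v.Y • vol (p + q + 2)

theorem contDiff_H₁ {m : WithTop ℕ∞} : ContDiff ℝ m (H₁ : Jet p q → _) := by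
  unfold H₁ F₁ a Q₁; fun_prop

theorem contDiff_H₂ {m : WithTop ℕ∞} : ContDiff ℝ m (H₂ : Jet p q → _) := by
  unfold H₂ F₂ a Q₂; fun_prop

theorem contDiff_Y {m : WithTop ℕ∞} : ContDiff ℝ m (Y : Jet p q → _) := by
  have h := (hodgeL (deg₂₁ (p := p) (q := q))).contDiff (n := m) |>.comp contDiff_H₂
  exact contDiff_H₁.add h

theorem contDiff_lagr {𝓕 : Alt (p + q + 2) (p + 1) → ℝ} (h𝓕 : ContDiff ℝ 1 𝓕) :
    ContDiff ℝ 1 (lagr 𝓕) := by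
  have hw : ∀ {k l : ℕ} (h : k + l = p + q + 2) {f : Jet p q → Alt (p + q + 2) k}
      {g : Jet p q → Alt (p + q + 2) l}, ContDiff ℝ 1 f → ContDiff ℝ 1 g →
      ContDiff ℝ 1 fun v => wedge h (f v) (g v) := by
    intro k l h f g hf hg
    have h1 := ((wedgeL (d := p + q + 2) h).contDiff (n := 1) |>.comp hf).clm_apply hg
    exact h1
  have hs : ∀ {k l : ℕ} (h : k + l = p + q + 2) {f : Jet p q → Alt (p + q + 2) k},
      ContDiff ℝ 1 f → ContDiff ℝ 1 fun v => hodge h (f v) := by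
    intro k l h f hf
    have h1 := (hodgeL h).contDiff (n := 1) |>.comp hf
    exact h1
  have ha : ContDiff ℝ 1 (a : Jet p q → ℝ) := by unfold a; fun_prop
  have hF₁ : ContDiff ℝ 1 (F₁ : Jet p q → _) := by unfold F₁; fun_prop
  have hF₂ : ContDiff ℝ 1 (F₂ : Jet p q → _) := by unfold F₂; fun_prop
  have hQ₁ : ContDiff ℝ 1 (Q₁ : Jet p q → _) := by unfold Q₁; fun_prop
  have hQ₂ : ContDiff ℝ 1 (Q₂ : Jet p q → _) := by unfold Q₂; fun_prop
  exact ((((hw _ contDiff_H₁ (hs _ contDiff_H₁)).add (hw _ contDiff_H₂ (hs _ contDiff_H₂))).sub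
    ((contDiff_const.mul ha).smul (hw _ hQ₂ hF₁))).add
    ((contDiff_const.mul ha).smul (hw _ hF₂ hQ₁))).add
    ((h𝓕.comp contDiff_Y).smul contDiff_const)

theorem hasDerivAt_H₁ (v w : Jet p q) :
    HasDerivAt (fun t : ℝ => (v + t • w).H₁) (varH₁ v w) 0 := by
  have h1 : HasDerivAt (fun t : ℝ => v.F₁ + t • w.F₁) w.F₁ 0 := by
    simpa using ((hasDerivAt_id (0 : ℝ)).smul_const w.F₁).const_add v.F₁
  have h2 : HasDerivAt (fun t : ℝ => v.Q₁ + t • w.Q₁) w.Q₁ 0 := by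
    simpa using ((hasDerivAt_id (0 : ℝ)).smul_const w.Q₁).const_add v.Q₁
  have h3 : HasDerivAt (fun t : ℝ => v.a + t * w.a) w.a 0 := by
    simpa using ((hasDerivAt_id (0 : ℝ)).mul_const w.a).const_add v.a
  have := h1.add (h3.smul h2)
  simp only [zero_mul, zero_smul, add_zero] at this
  exact this

theorem hasDerivAt_H₂ (v w : Jet p q) :
    HasDerivAt (fun t : ℝ => (v + t • w).H₂) (varH₂ v w) 0 := by
  have h1 : HasDerivAt (fun t : ℝ => v.F₂ + t • w.F₂) w.F₂ 0 := by
    simpa using ((hasDerivAt_id (0 : ℝ)).smul_const w.F₂).const_add v.F₂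
  have h2 : HasDerivAt (fun t : ℝ => v.Q₂ + t • w.Q₂) w.Q₂ 0 := by
    simpa using ((hasDerivAt_id (0 : ℝ)).smul_const w.Q₂).const_add v.Q₂
  have h3 : HasDerivAt (fun t : ℝ => v.a + t * w.a) w.a 0 := by
    simpa using ((hasDerivAt_id (0 : ℝ)).mul_const w.a).const_add v.a
  have := h1.add (h3.smul h2)
  simp only [zero_mul, zero_smul, add_zero] at this
  exact this

theorem hasDerivAt_Y (v w : Jet p q) :
    HasDerivAt (fun t : ℝ => (v + t • w).Y) (varY v w) 0 :=
  (hasDerivAt_H₁ v w).add ((hodgeL deg₂₁).hasFDerivAt.comp_hasDerivAt 0 (hasDerivAt_H₂ v w))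

/-- The first variation of the Lagrangian. Up to the terms which become total derivatives, it is
the pairing of the twisted duality expression with the variation of `Y`. -/
def firstVar (𝓕 : Alt (p + q + 2) (p + 1) → ℝ) (v w : Jet p q) : Alt (p + q + 2) (p + q + 2) :=
  (2 * ip (D 𝓕 v) (varY v w)) • vol (p + q + 2) +
    (2 : ℝ) • (wedge deg₂₁ ((2 * v.a) • w.F₂ + v.a ^ 2 • w.Q₂) v.Q₁ -
      wedge deg₂₁ v.Q₂ ((2 * v.a) • w.F₁ + v.a ^ 2 • w.Q₁) -
      wedge deg₂₁ v.F₂ w.F₁ + wedge deg₂₁ w.F₂ v.F₁)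

theorem hasDerivAt_lagr {𝓕 : Alt (p + q + 2) (p + 1) → ℝ} (h𝓕 : ContDiff ℝ 1 𝓕)
    (v w : Jet p q) : HasDerivAt (fun t : ℝ => lagr 𝓕 (v + t • w)) (firstVar 𝓕 v w) 0 := by
  have hF₁ : HasDerivAt (fun t : ℝ => (v + t • w).F₁) w.F₁ 0 := by
    have := ((hasDerivAt_id (0 : ℝ)).smul_const w.F₁).const_add v.F₁
    rw [one_smul] at this
    exact this
  have hF₂ : HasDerivAt (fun t : ℝ => (v + t • w).F₂) w.F₂ 0 := by
    have := ((hasDerivAt_id (0 : ℝ)).smul_const w.F₂).const_add v.F₂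
    rw [one_smul] at this
    exact this
  have hQ₁ : HasDerivAt (fun t : ℝ => (v + t • w).Q₁) w.Q₁ 0 := by
    have := ((hasDerivAt_id (0 : ℝ)).smul_const w.Q₁).const_add v.Q₁
    rw [one_smul] at this
    exact this
  have hQ₂ : HasDerivAt (fun t : ℝ => (v + t • w).Q₂) w.Q₂ 0 := by
    have := ((hasDerivAt_id (0 : ℝ)).smul_const w.Q₂).const_add v.Q₂
    rw [one_smul] at this
    exact this
  have ha : HasDerivAt (fun t : ℝ => 2 * (v + t • w).a) (2 * w.a) 0 := by
    have := (((hasDerivAt_id (0 : ℝ)).mul_const w.a).const_add v.a).const_mul 2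
    rw [one_mul] at this
    exact this
  have hH₁ := hasDerivAt_H₁ v w
  have hH₂ := hasDerivAt_H₂ v w
  have hw : ∀ {k l : ℕ} (h : k + l = p + q + 2) {f : ℝ → Alt (p + q + 2) k}
      {g : ℝ → Alt (p + q + 2) l} {f' g'}, HasDerivAt f f' 0 → HasDerivAt g g' 0 →
      HasDerivAt (fun t => wedge h (f t) (g t)) (wedge h (f 0) g' + wedge h f' (g 0)) 0 := by
    intro k l h f g f' g' hf hg
    exact (wedgeL h).hasDerivAt_of_bilinear (fun _ => hf) (fun _ => hg)
  have hs : ∀ {k l : ℕ} (h : k + l = p + q + 2) {f : ℝ → Alt (p + q + 2) k} {f'},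
      HasDerivAt f f' 0 → HasDerivAt (fun t => hodge h (f t)) (hodge h f') 0 := by
    intro k l h f f' hf
    exact (hodgeL h).hasFDerivAt.comp_hasDerivAt 0 hf
  have hX : HasDerivAt (fun t : ℝ => 𝓕 (v + t • w).Y) (2 * ip (halfGrad 𝓕 v.Y) (varY v w)) 0 := by
    rw [ip_halfGrad]
    have h0 : (v + (0 : ℝ) • w).Y = v.Y := by simp
    have := (h𝓕.differentiable one_ne_zero (v + (0 : ℝ) • w).Y).hasFDerivAt.comp_hasDerivAt 0
      (hasDerivAt_Y v w)
    rw [h0] at this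
    exact this
  have key := ((((hw deg₁₂ hH₁ (hs deg₁₂ hH₁)).add (hw deg₂₁ hH₂ (hs deg₂₁ hH₂))).sub
    (ha.smul (hw deg₂₁ hQ₂ hF₁))).add (ha.smul (hw deg₂₁ hF₂ hQ₁))).add
    (hX.smul_const (vol (p + q + 2)))
  have h0 : v + (0 : ℝ) • w = v := by simp
  simp only [h0] at key
  refine key.congr_deriv ?_
  have hd : 0 < p + q + 2 := by omega
  have e1 := wedge_hodge hd deg₁₂ v.H₁ (varH₁ v w)
  have e2 := wedge_hodge hd deg₁₂ (varH₁ v w) v.H₁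
  have e3 := wedge_hodge hd deg₂₁ v.H₂ (varH₂ v w)
  have e4 := wedge_hodge hd deg₂₁ (varH₂ v w) v.H₂
  -- the cross terms of `⟨H₁ - ⋆H₂, δH₁ + ⋆δH₂⟩` are wedge products without Hodge star
  have e5 : ip v.H₁ (hodge deg₂₁ (varH₂ v w)) • vol (p + q + 2) =
      -wedge deg₂₁ (varH₂ v w) v.H₁ := ip_hodge_smul_vol hd _ _ _
  have e6 : ip (varH₁ v w) (hodge deg₂₁ v.H₂) • vol (p + q + 2) =
      -wedge deg₂₁ v.H₂ (varH₁ v w) := ip_hodge_smul_vol hd _ _ _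
  have e7 : ip (D 𝓕 v) (varY v w) = ip v.H₁ (varH₁ v w) + ip v.H₁ (hodge deg₂₁ (varH₂ v w)) -
      ip (varH₁ v w) (hodge deg₂₁ v.H₂) + ip v.H₂ (varH₂ v w) +
      ip (halfGrad 𝓕 v.Y) (varY v w) := by
    rw [D, ip_add_left, varY, ip_add_right (v.H₁ - _), ip_sub_left, ip_sub_left,
      ip_hodge_hodge hd, ip_comm (hodge deg₂₁ v.H₂)]
    ring
  rw [e1, e2, e3, e4, ip_comm (varH₁ v w), ip_comm (varH₂ v w), firstVar, e7]
  ext u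
  have f5 := congrArg (fun α : Alt (p + q + 2) (p + q + 2) => α u) e5
  have f6 := congrArg (fun α : Alt (p + q + 2) (p + q + 2) => α u) e6
  simp only [varH₁, varH₂, H₁, H₂, wedge_add_left, wedge_add_right, wedge_smul_left,
    wedge_smul_right, ContinuousAlternatingMap.smul_apply, ContinuousAlternatingMap.add_apply,
    ContinuousAlternatingMap.sub_apply, ContinuousAlternatingMap.neg_apply, smul_eq_mul] at f5 f6 ⊢
  linear_combination 2 * f6 - 2 * f5

end Jet

/-- The fields and field strengths of a configuration that enter the Lagrangian. -/
def jet (Ψ : Config p q) (x : Spacetime (p + q + 2)) : Jet p q :=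
  (Ψ.a x, Ψ.F₁ x, Ψ.F₂ x, Ψ.Q₁ x, Ψ.Q₂ x)

theorem lagrangian_eq (𝓕 : Alt (p + q + 2) (p + 1) → ℝ) (Ψ : Config p q)
    (x : Spacetime (p + q + 2)) : lagrangian 𝓕 Ψ x = Jet.lagr 𝓕 (jet Ψ x) := rfl

theorem extDeriv_add_smul {d k : ℕ} {α β : Form d k} (hα : ContDiff ℝ ∞ α)
    (hβ : ContDiff ℝ ∞ β) (t : ℝ) (x : Spacetime d) :
    extDeriv (fun y => α y + t • β y) x = extDeriv α x + t • extDeriv β x := by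
  have h1 : ContDiff ℝ ∞ fun y => t • β y := hβ.const_smul t
  have h := extDeriv_fun_add (𝕜 := ℝ) (x := x) (hα.differentiable smooth_ne_zero x)
    (h1.differentiable smooth_ne_zero x)
  have h2 : extDeriv (fun y => t • β y) x = t • extDeriv β x := extDeriv_fun_smul t β
  rw [h, h2]

theorem jet_vary {Ψ δ : Config p q} (hΨ : Ψ.Smooth) (hδ : δ.Smooth) (t : ℝ)
    (x : Spacetime (p + q + 2)) : jet (Ψ.vary t δ) x = jet Ψ x + t • jet δ x := by
  obtain ⟨h1, h2, h3, h4, -⟩ := hΨ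
  obtain ⟨k1, k2, k3, k4, -⟩ := hδ
  exact Prod.ext rfl (Prod.ext (extDeriv_add_smul h1 k1 t x) (Prod.ext
    (extDeriv_add_smul h2 k2 t x) (Prod.ext (extDeriv_add_smul h3 k3 t x)
      (extDeriv_add_smul h4 k4 t x))))

/-- The combination `2 a δA + a² δR`, whose exterior derivative is `2 a dδA + a² dδR` up to
`2 da ∧ (δA + a δR)`. -/
def potential {d k : ℕ} (a : Spacetime d → ℝ) (A R : Form d k) : Form d k :=
  fun x => a x • (A x + (A x + a x • R x))

theorem contDiff_potential {d k : ℕ} {a : Spacetime d → ℝ} {A R : Form d k}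
    (ha : ContDiff ℝ ∞ a) (hA : ContDiff ℝ ∞ A) (hR : ContDiff ℝ ∞ R) :
    ContDiff ℝ ∞ (potential a A R) :=
  ha.smul (hA.add (hA.add (ha.smul hR)))

theorem extDeriv_add_fun {d k : ℕ} {α β : Form d k} (hα : ContDiff ℝ ∞ α)
    (hβ : ContDiff ℝ ∞ β) (x : Spacetime d) :
    extDeriv (fun y => α y + β y) x = extDeriv α x + extDeriv β x :=
  extDeriv_fun_add (hα.differentiable smooth_ne_zero x) (hβ.differentiable smooth_ne_zero x)

theorem daWedge_add {d k n : ℕ} (h : k + 1 = n) (a : Spacetime d → ℝ) (U V : Form d k)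
    (x : Spacetime d) :
    daWedge h a (fun y => U y + V y) x = daWedge h a U x + daWedge h a V x :=
  wedge_add_right _ _ _ _

theorem daWedge_smul {d k n : ℕ} (h : k + 1 = n) (a f : Spacetime d → ℝ) (U : Form d k)
    (x : Spacetime d) : daWedge h a (fun y => f y • U y) x = f x • daWedge h a U x :=
  wedge_smul_right _ _ _ _

theorem extDeriv_potential {d k : ℕ} {a : Spacetime d → ℝ} {A R : Form d k}
    (ha : ContDiff ℝ ∞ a) (hA : ContDiff ℝ ∞ A) (hR : ContDiff ℝ ∞ R) (x : Spacetime d) :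
    extDeriv (potential a A R) x = (2 * a x) • extDeriv A x + a x ^ 2 • extDeriv R x +
      (2 : ℝ) • daWedge rfl a (fun y => A y + a y • R y) x := by
  have haR : ContDiff ℝ ∞ fun y => a y • R y := ha.smul hR
  have h1 : ContDiff ℝ ∞ fun y => A y + a y • R y := hA.add haR
  have h2 : ContDiff ℝ ∞ fun y => A y + (A y + a y • R y) := hA.add h1
  unfold potential
  rw [extDeriv_smul_fun ha h2, extDeriv_add_fun hA h1, extDeriv_add_fun hA haR,
    extDeriv_smul_fun ha hR, daWedge_add, daWedge_add, daWedge_smul]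
  ext u
  simp only [ContinuousAlternatingMap.smul_apply, ContinuousAlternatingMap.add_apply, smul_eq_mul]
  ring

/-- The total-derivative part of the variation of the Lagrangian. -/
def currentK (Ψ δ : Config p q) : Form (p + q + 2) (p + q + 1) := fun x =>
  (2 : ℝ) • (((wedge (by omega) (potential Ψ.a δ.A₂ δ.R₂ x) (Ψ.Q₁ x) -
    wedge (by omega) (Ψ.R₂ x) (extDeriv (potential Ψ.a δ.A₁ δ.R₁) x)) -
    wedge (by omega) (Ψ.A₂ x) (δ.F₁ x)) + wedge (by omega) (δ.A₂ x) (Ψ.F₁ x))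

theorem contDiff_currentK {Ψ δ : Config p q} (hΨ : Ψ.Smooth) (hδ : δ.Smooth) :
    ContDiff ℝ ∞ (currentK Ψ δ) := by
  obtain ⟨h1, h2, h3, h4, h5⟩ := hΨ
  obtain ⟨k1, k2, k3, k4, -⟩ := hδ
  have hp1 := contDiff_potential h5 k1 k3
  have hp2 := contDiff_potential h5 k2 k4
  have hw : q + (p + 1) = p + q + 1 := by omega
  have c1 := contDiff_wedge hw hp2 (contDiff_extDeriv h3)
  have c2 := contDiff_wedge hw h4 (contDiff_extDeriv hp1)
  have c3 := contDiff_wedge hw h2 (contDiff_extDeriv k1)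
  have c4 := contDiff_wedge hw k2 (contDiff_extDeriv h1)
  exact (((c1.sub c2).sub c3).add c4).const_smul (2 : ℝ)

theorem tsupport_currentK_subset (Ψ δ : Config p q) {S : Set (Spacetime (p + q + 2))}
    (hS : IsClosed S) (hA₁ : tsupport δ.A₁ ⊆ S) (hA₂ : tsupport δ.A₂ ⊆ S)
    (hR₁ : tsupport δ.R₁ ⊆ S) (hR₂ : tsupport δ.R₂ ⊆ S) : tsupport (currentK Ψ δ) ⊆ S := by
  have hpot : ∀ {k : ℕ} {A R : Form (p + q + 2) k}, tsupport A ⊆ S → tsupport R ⊆ S →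
      tsupport (potential Ψ.a A R) ⊆ S := by
    intro k A R hA hR
    refine closure_minimal (fun x hx => ?_) hS
    by_contra hxS
    refine hx ?_
    simp [potential, image_eq_zero_of_notMem_tsupport fun h => hxS (hA h),
      image_eq_zero_of_notMem_tsupport fun h => hxS (hR h)]
  refine closure_minimal (fun x hx => ?_) hS
  by_contra hxS
  refine hx ?_
  have e1 : potential Ψ.a δ.A₂ δ.R₂ x = 0 :=
    image_eq_zero_of_notMem_tsupport fun h => hxS (hpot hA₂ hR₂ h)
  have e2 : extDeriv (potential Ψ.a δ.A₁ δ.R₁) x = 0 :=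
    image_eq_zero_of_notMem_tsupport fun h => hxS (hpot hA₁ hR₁ (tsupport_extDeriv_subset _ h))
  have e3 : δ.F₁ x = 0 :=
    image_eq_zero_of_notMem_tsupport fun h => hxS (hA₁ (tsupport_extDeriv_subset _ h))
  have e4 : δ.A₂ x = 0 := image_eq_zero_of_notMem_tsupport fun h => hxS (hA₂ h)
  simp [currentK, e1, e2, e3, e4]

theorem extDeriv_currentK {Ψ δ : Config p q} (hΨ : Ψ.Smooth) (hδ : δ.Smooth)
    (x : Spacetime (p + q + 2)) :
    extDeriv (currentK Ψ δ) x = (2 : ℝ) • (((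
      wedge deg₂₁ (extDeriv (potential Ψ.a δ.A₂ δ.R₂) x) (Ψ.Q₁ x) -
      wedge deg₂₁ (Ψ.Q₂ x) (extDeriv (potential Ψ.a δ.A₁ δ.R₁) x)) -
      wedge deg₂₁ (Ψ.F₂ x) (δ.F₁ x)) + wedge deg₂₁ (δ.F₂ x) (Ψ.F₁ x)) := by
  obtain ⟨h1, h2, h3, h4, h5⟩ := hΨ
  obtain ⟨k1, k2, k3, k4, -⟩ := hδ
  have hp1 := contDiff_potential h5 k1 k3
  have hp2 := contDiff_potential h5 k2 k4
  have hw : q + (p + 1) = p + q + 1 := by omega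
  have c1 : ContDiff ℝ ∞ fun x => wedge hw (potential Ψ.a δ.A₂ δ.R₂ x) (Ψ.Q₁ x) :=
    contDiff_wedge hw hp2 (contDiff_extDeriv h3)
  have c2 := contDiff_wedge hw h4 (contDiff_extDeriv hp1)
  have c3 : ContDiff ℝ ∞ fun x => wedge hw (Ψ.A₂ x) (δ.F₁ x) :=
    contDiff_wedge hw h2 (contDiff_extDeriv k1)
  have c4 : ContDiff ℝ ∞ fun x => wedge hw (δ.A₂ x) (Ψ.F₁ x) :=
    contDiff_wedge hw k2 (contDiff_extDeriv h1)
  have e0 := extDeriv_fun_smul (𝕜 := ℝ) (x := x) 2 (fun x =>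
    ((wedge hw (potential Ψ.a δ.A₂ δ.R₂ x) (Ψ.Q₁ x) -
    wedge hw (Ψ.R₂ x) (extDeriv (potential Ψ.a δ.A₁ δ.R₁) x)) -
    wedge hw (Ψ.A₂ x) (δ.F₁ x)) + wedge hw (δ.A₂ x) (Ψ.F₁ x))
  refine e0.trans ?_
  congr 1
  rw [extDeriv_add_fun ((c1.sub c2).sub c3) c4, extDeriv_sub' (c1.sub c2) c3, extDeriv_sub' c1 c2]
  congr 1
  · congr 1
    · congr 1
      · exact extDeriv_wedge_closed hw deg₂₁ hp2 (contDiff_extDeriv h3) x (extDeriv_comp_self h3 x)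
      · exact extDeriv_wedge_closed hw deg₂₁ h4 (contDiff_extDeriv hp1) x
          (extDeriv_comp_self hp1 x)
    · exact extDeriv_wedge_closed hw deg₂₁ h2 (contDiff_extDeriv k1) x (extDeriv_comp_self k1 x)
  · exact extDeriv_wedge_closed hw deg₂₁ k2 (contDiff_extDeriv h1) x (extDeriv_comp_self h1 x)

/-- The first variation of the Lagrangian, with the total derivative split off: what remains
involves the variations of the potentials only through `δA + a δR` and the variation of `Y`. -/
theorem firstVar_eq (𝓕 : Alt (p + q + 2) (p + 1) → ℝ) {Ψ δ : Config p q} (hΨ : Ψ.Smooth)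
    (hδ : δ.Smooth) (x : Spacetime (p + q + 2)) :
    Jet.firstVar 𝓕 (jet Ψ x) (jet δ x) =
      (2 * ip (Jet.D 𝓕 (jet Ψ x)) (Jet.varY (jet Ψ x) (jet δ x))) • vol (p + q + 2) +
      (4 : ℝ) • (wedge deg₂₁ (Ψ.Q₂ x) (daWedge rfl Ψ.a (fun y => δ.A₁ y + Ψ.a y • δ.R₁ y) x) -
        wedge deg₂₁ (daWedge rfl Ψ.a (fun y => δ.A₂ y + Ψ.a y • δ.R₂ y) x) (Ψ.Q₁ x)) +
      extDeriv (currentK Ψ δ) x := by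
  rw [extDeriv_currentK hΨ hδ]
  obtain ⟨h1, h2, h3, h4, h5⟩ := hΨ
  obtain ⟨k1, k2, k3, k4, -⟩ := hδ
  rw [extDeriv_potential h5 k1 k3, extDeriv_potential h5 k2 k4]
  ext u
  simp only [Jet.firstVar, jet, Jet.a, Jet.F₁, Jet.F₂, Jet.Q₁, Jet.Q₂, Config.F₁, Config.F₂,
    Config.Q₁, Config.Q₂, wedge_add_left, wedge_add_right, wedge_smul_left,
    wedge_smul_right, ContinuousAlternatingMap.smul_apply, ContinuousAlternatingMap.add_apply,
    ContinuousAlternatingMap.sub_apply, smul_eq_mul]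
  ring

/-- The variation of `H₁`, in terms of `δA₁ + a δR₁`. -/
theorem varH₁_jet {Ψ δ : Config p q} (hΨ : Ψ.Smooth) (hδ : δ.Smooth)
    (x : Spacetime (p + q + 2)) :
    Jet.varH₁ (jet Ψ x) (jet δ x) = extDeriv (fun y => δ.A₁ y + Ψ.a y • δ.R₁ y) x -
      daWedge rfl Ψ.a δ.R₁ x + δ.a x • Ψ.Q₁ x := by
  have haR : ContDiff ℝ ∞ fun y => Ψ.a y • δ.R₁ y := hΨ.2.2.2.2.smul hδ.2.2.1
  rw [extDeriv_add_fun hδ.1 haR, extDeriv_smul_fun hΨ.2.2.2.2 hδ.2.2.1]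
  change extDeriv δ.A₁ x + (Ψ.a x • extDeriv δ.R₁ x + δ.a x • Ψ.Q₁ x) = _
  abel

/-- The variation of `H₂`, in terms of `δA₂ + a δR₂`. -/
theorem varH₂_jet {Ψ δ : Config p q} (hΨ : Ψ.Smooth) (hδ : δ.Smooth)
    (x : Spacetime (p + q + 2)) :
    Jet.varH₂ (jet Ψ x) (jet δ x) = extDeriv (fun y => δ.A₂ y + Ψ.a y • δ.R₂ y) x -
      daWedge rfl Ψ.a δ.R₂ x + δ.a x • Ψ.Q₂ x := by
  have haR : ContDiff ℝ ∞ fun y => Ψ.a y • δ.R₂ y := hΨ.2.2.2.2.smul hδ.2.2.2.1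
  rw [extDeriv_add_fun hδ.2.1 haR, extDeriv_smul_fun hΨ.2.2.2.2 hδ.2.2.2.1]
  change extDeriv δ.A₂ x + (Ψ.a x • extDeriv δ.R₂ x + δ.a x • Ψ.Q₂ x) = _
  abel

end Variation

/-! ### Gauge symmetries -/

section Gauge

variable {p q : ℕ}

/-- A variation under which `Y` does not change and the first variation of every Lagrangian of the
family is the same total derivative is a symmetry of all of them. -/
theorem gauge_symmetry {𝓕 : Alt (p + q + 2) (p + 1) → ℝ} (h𝓕 : ContDiff ℝ 1 𝓕)
    {Ψ δ : Config p q} {S : Set (Spacetime (p + q + 2))} (hΨ : Ψ.Smooth) (hδ : δ.Smooth)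
    (hY : ∀ x, Jet.varY (jet Ψ x) (jet δ x) = 0) (K : Form (p + q + 2) (p + q + 1))
    (hK : ContDiff ℝ ∞ K) (hS : tsupport K ⊆ S)
    (hL : ∀ 𝓖 x, Jet.firstVar 𝓖 (jet Ψ x) (jet δ x) = extDeriv K x) :
    δ.Smooth ∧ (∀ x, HasDerivAt (fun t : ℝ => (Ψ.vary t δ).Y x) 0 0) ∧
      ∃ K : Form (p + q + 2) (p + q + 1), ContDiff ℝ ∞ K ∧ tsupport K ⊆ S ∧ ∀ x,
        HasDerivAt (fun t : ℝ => lagrangian (fun _ => 0) (Ψ.vary t δ) x) (extDeriv K x) 0 ∧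
        HasDerivAt (fun t : ℝ => lagrangian 𝓕 (Ψ.vary t δ) x) (extDeriv K x) 0 := by
  refine ⟨hδ, fun x => ?_, K, hK, hS, fun x => ?_⟩
  · have h := Jet.hasDerivAt_Y (jet Ψ x) (jet δ x)
    rw [hY] at h
    simp only [← jet_vary hΨ hδ] at h
    exact h
  · have h : ∀ {𝓖 : Alt (p + q + 2) (p + 1) → ℝ}, ContDiff ℝ 1 𝓖 →
        HasDerivAt (fun t : ℝ => lagrangian 𝓖 (Ψ.vary t δ) x) (extDeriv K x) 0 := by
      intro 𝓖 h𝓖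
      have h := Jet.hasDerivAt_lagr h𝓖 (jet Ψ x) (jet δ x)
      rw [hL] at h
      simp only [← jet_vary hΨ hδ] at h
      exact h
    exact ⟨h contDiff_const, h h𝓕⟩

theorem varY_zero (v : Jet p q) : Jet.varY v 0 = 0 := by
  have h1 : Jet.varH₁ v 0 = 0 := by simp [Jet.varH₁, Jet.F₁, Jet.Q₁, Jet.a]
  have h2 : Jet.varH₂ v 0 = 0 := by simp [Jet.varH₂, Jet.F₂, Jet.Q₂, Jet.a]
  rw [Jet.varY, h1, h2, hodge_zero, add_zero]

theorem firstVar_zero (𝓕 : Alt (p + q + 2) (p + 1) → ℝ) (v : Jet p q) :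
    Jet.firstVar 𝓕 v 0 = 0 := by
  rw [Jet.firstVar, varY_zero]
  simp [Jet.F₁, Jet.F₂, Jet.Q₁, Jet.Q₂]

/-- Variations by closed forms leave the Lagrangian invariant, since it depends on the potentials
only through the field strengths. -/
theorem gauge_symmetry_of_jet_eq_zero {𝓕 : Alt (p + q + 2) (p + 1) → ℝ} (h𝓕 : ContDiff ℝ 1 𝓕)
    {Ψ δ : Config p q} {S : Set (Spacetime (p + q + 2))} (hΨ : Ψ.Smooth) (hδ : δ.Smooth)
    (h : ∀ x, jet δ x = 0) :
    δ.Smooth ∧ (∀ x, HasDerivAt (fun t : ℝ => (Ψ.vary t δ).Y x) 0 0) ∧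
      ∃ K : Form (p + q + 2) (p + q + 1), ContDiff ℝ ∞ K ∧ tsupport K ⊆ S ∧ ∀ x,
        HasDerivAt (fun t : ℝ => lagrangian (fun _ => 0) (Ψ.vary t δ) x) (extDeriv K x) 0 ∧
        HasDerivAt (fun t : ℝ => lagrangian 𝓕 (Ψ.vary t δ) x) (extDeriv K x) 0 := by
  refine gauge_symmetry h𝓕 hΨ hδ (fun x => by rw [h, varY_zero]) 0 contDiff_const
    (by simp [tsupport]) fun 𝓖 x => ?_
  rw [h, firstVar_zero, extDeriv_zero]
  rfl

/-- Variations with `δA_i = -a δR_i` that preserve `Y` change the Lagrangian by a total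
derivative. -/
theorem gauge_symmetry_of_twisted {𝓕 : Alt (p + q + 2) (p + 1) → ℝ} (h𝓕 : ContDiff ℝ 1 𝓕)
    {Ψ δ : Config p q} {S : Set (Spacetime (p + q + 2))} (hΨ : Ψ.Smooth) (hδ : δ.Smooth)
    (hS : IsClosed S) (hR₁S : tsupport δ.R₁ ⊆ S) (hR₂S : tsupport δ.R₂ ⊆ S)
    (h₁ : ∀ x, δ.A₁ x = -(Ψ.a x • δ.R₁ x)) (h₂ : ∀ x, δ.A₂ x = -(Ψ.a x • δ.R₂ x))
    (hY : ∀ x, δ.a x • Ψ.Q₁ x - daWedge rfl Ψ.a δ.R₁ x +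
      hodge deg₂₁ (δ.a x • Ψ.Q₂ x - daWedge rfl Ψ.a δ.R₂ x) = 0) :
    δ.Smooth ∧ (∀ x, HasDerivAt (fun t : ℝ => (Ψ.vary t δ).Y x) 0 0) ∧
      ∃ K : Form (p + q + 2) (p + q + 1), ContDiff ℝ ∞ K ∧ tsupport K ⊆ S ∧ ∀ x,
        HasDerivAt (fun t : ℝ => lagrangian (fun _ => 0) (Ψ.vary t δ) x) (extDeriv K x) 0 ∧
        HasDerivAt (fun t : ℝ => lagrangian 𝓕 (Ψ.vary t δ) x) (extDeriv K x) 0 := by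
  have c₁ : (fun y => δ.A₁ y + Ψ.a y • δ.R₁ y) = 0 := by
    funext y; rw [h₁]; exact neg_add_cancel _
  have c₂ : (fun y => δ.A₂ y + Ψ.a y • δ.R₂ y) = 0 := by
    funext y; rw [h₂]; exact neg_add_cancel _
  have hY' : ∀ x, Jet.varY (jet Ψ x) (jet δ x) = 0 := by
    intro x
    rw [Jet.varY, varH₁_jet hΨ hδ, varH₂_jet hΨ hδ, c₁, c₂, extDeriv_zero, extDeriv_zero, ← hY x]
    simp only [Pi.zero_apply, zero_sub]
    rw [neg_add_eq_sub, neg_add_eq_sub]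
  have hA : ∀ {k : ℕ} {A R : Form (p + q + 2) k}, (∀ x, A x = -(Ψ.a x • R x)) →
      tsupport R ⊆ S → tsupport A ⊆ S := by
    intro k A R hAR hR
    refine closure_minimal (fun x hx => ?_) hS
    by_contra hxS
    refine hx ?_
    rw [hAR, image_eq_zero_of_notMem_tsupport fun h => hxS (hR h)]
    simp
  refine gauge_symmetry h𝓕 hΨ hδ hY' (currentK Ψ δ) (contDiff_currentK hΨ hδ)
    (tsupport_currentK_subset Ψ δ hS (hA h₁ hR₁S) (hA h₂ hR₂S) hR₁S hR₂S) fun 𝓖 x => ?_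
  rw [firstVar_eq 𝓖 hΨ hδ, c₁, c₂, hY']
  have hz : ∀ {k : ℕ}, daWedge (rfl : k + 1 = k + 1) Ψ.a 0 x = 0 := fun {k} =>
    wedge_zero_right _ _
  rw [hz, hz]
  simp

theorem contDiff_extD {d k n : ℕ} (h : k + 1 = n) {U : Form d k} (hU : ContDiff ℝ ∞ U) :
    ContDiff ℝ ∞ (extD h U) := by
  subst h
  exact contDiff_extDeriv hU

theorem extDeriv_extD {d k n : ℕ} (h : k + 1 = n) {U : Form d k} (hU : ContDiff ℝ ∞ U) :
    extDeriv (extD h U) = 0 := by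
  subst h
  exact extDeriv_extDeriv hU minSmoothness_le_infty

theorem jet_eq_zero {Ψ : Config p q} (h₁ : extDeriv Ψ.A₁ = 0) (h₂ : extDeriv Ψ.A₂ = 0)
    (h₃ : extDeriv Ψ.R₁ = 0) (h₄ : extDeriv Ψ.R₂ = 0) (ha : Ψ.a = 0)
    (x : Spacetime (p + q + 2)) : jet Ψ x = 0 := by
  simp only [jet, Config.F₁, Config.F₂, Config.Q₁, Config.Q₂, h₁, h₂, h₃, h₄, ha]
  rfl

theorem daWedge_zero {d k n : ℕ} (h : k + 1 = n) (a : Spacetime d → ℝ) :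
    daWedge h a (0 : Form d k) = 0 := by
  funext x
  exact wedge_zero_right _ _

theorem tsupport_daWedge_subset {d k n : ℕ} (h : k + 1 = n) (a : Spacetime d → ℝ)
    (U : Form d k) : tsupport (daWedge h a U) ⊆ tsupport U := by
  refine closure_mono fun x hx hU => hx ?_
  rw [daWedge, hU, wedge_zero_right]

theorem tsupport_zero_subset {d k : ℕ} (S : Set (Spacetime d)) :
    tsupport (0 : Form d k) ⊆ S := by
  simp [tsupport]

theorem smooth_zero {d k : ℕ} : ContDiff ℝ ∞ (0 : Form d k) := contDiff_const

theorem contDiff_shift {d k : ℕ} {a φ : Spacetime d → ℝ} (ha : ContDiff ℝ ∞ a) (hn : Nonnull a)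
    (hφ : ContDiff ℝ ∞ φ) {α : Form d (k + 1)} (hα : ContDiff ℝ ∞ α) :
    ContDiff ℝ ∞ fun x => (φ x / gradSq a x) • iota a x (α x) :=
  (hφ.div (contDiff_gradSq ha) hn).smul (contDiff_iota ha hα)

theorem contDiff_shiftR₁ {Ψ : Config p q} (hΨ : Ψ.Smooth) (hn : Nonnull Ψ.a)
    {φ : Spacetime (p + q + 2) → ℝ} (hφ : ContDiff ℝ ∞ φ) : ContDiff ℝ ∞ (shiftR₁ Ψ φ) :=
  contDiff_shift hΨ.2.2.2.2 hn hφ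
    ((contDiff_extDeriv hΨ.2.2.1).add (contDiff_hodge _ (contDiff_extDeriv hΨ.2.2.2.1)))

theorem contDiff_shiftR₂ {Ψ : Config p q} (hΨ : Ψ.Smooth) (hn : Nonnull Ψ.a)
    {φ : Spacetime (p + q + 2) → ℝ} (hφ : ContDiff ℝ ∞ φ) : ContDiff ℝ ∞ (shiftR₂ Ψ φ) :=
  contDiff_shift hΨ.2.2.2.2 hn hφ
    ((contDiff_extDeriv hΨ.2.2.2.1).add
      ((contDiff_hodge _ (contDiff_extDeriv hΨ.2.2.1)).const_smul _))

/-- The sign in `shiftR₂` inverts the Hodge star: it is the sign of `⋆⋆` on `(p + 1)`-forms. -/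
theorem shift_sign (p q : ℕ) :
    (-1 : ℝ) ^ (p + (p + q + 2) + p * (p + q + 2)) * -(-1) ^ ((p + 1) * (q + 1)) = 1 := by
  rw [mul_neg, ← pow_add, neg_eq_iff_eq_neg]
  refine Odd.neg_one_pow ?_
  obtain ⟨m, hm⟩ := Nat.even_mul_succ_self p
  exact ⟨m + p + q + p * q + p + 1, by linarith⟩

/-- The shift of `a` is compensated in `Y` by the shifts of `R₁` and `R₂`: with
`W = Q₂ + ⋆⁻¹Q₁`, so that `⋆W = Q₁ + ⋆Q₂`, the two shifts are contractions of `⋆W` and of `W`, and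
`sharp_smul_hodge` applies to `W`. -/
theorem shift_identity {Ψ : Config p q} (hn : Nonnull Ψ.a) (φ : Spacetime (p + q + 2) → ℝ)
    (x : Spacetime (p + q + 2)) :
    φ x • Ψ.Q₁ x - daWedge rfl Ψ.a (shiftR₁ Ψ φ) x +
      hodge deg₂₁ (φ x • Ψ.Q₂ x - daWedge rfl Ψ.a (shiftR₂ Ψ φ) x) = 0 := by
  set W := Ψ.Q₂ x + (-1 : ℝ) ^ (p + (p + q + 2) + p * (p + q + 2)) • hodge deg₁₂ (Ψ.Q₁ x) with hW
  have hd : 0 < p + q + 2 := by omega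
  have hZ : hodge deg₂₁ W = Ψ.Q₁ x + hodge deg₂₁ (Ψ.Q₂ x) := by
    rw [hW, hodge_add, hodge_smul, hodge_hodge hd deg₁₂ deg₂₁, smul_smul, shift_sign, one_smul]
    exact add_comm _ _
  have hμ : dScalar Ψ.a x (fun _ => sharp (dScalar Ψ.a x)) = gradSq Ψ.a x := by
    rw [dScalar_apply, ← gradVec_eq_sharp, fderiv_gradVec]
  have key := sharp_smul_hodge hd deg₂₁ (dScalar Ψ.a x) W
  rw [hμ, hZ] at key
  have e₁ : daWedge rfl Ψ.a (shiftR₁ Ψ φ) x = (φ x / gradSq Ψ.a x) • wedge (add_comm 1 p)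
      (dScalar Ψ.a x) ((Ψ.Q₁ x + hodge deg₂₁ (Ψ.Q₂ x)).curryLeft (sharp (dScalar Ψ.a x))) :=
    wedge_smul_right _ _ _ _
  have e₂ : daWedge rfl Ψ.a (shiftR₂ Ψ φ) x = (φ x / gradSq Ψ.a x) • wedge (add_comm 1 q)
      (dScalar Ψ.a x) (W.curryLeft (sharp (dScalar Ψ.a x))) :=
    wedge_smul_right _ _ _ _
  rw [e₁, e₂, hodge_sub, hodge_smul, hodge_smul]
  ext u
  have key' := congrArg (fun γ : Alt (p + q + 2) (p + 1) => γ u) key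
  simp only [ContinuousAlternatingMap.smul_apply, ContinuousAlternatingMap.add_apply,
    ContinuousAlternatingMap.sub_apply, smul_eq_mul] at key' ⊢
  have hg := hn x
  change _ = (0 : ℝ)
  field_simp
  linear_combination φ x * key'

/-- All seven gauge symmetries of the free theory are symmetries of the interacting theory. -/
theorem gaugeVariation_symmetry {𝓕 : Alt (p + q + 2) (p + 1) → ℝ} (h𝓕 : ContDiff ℝ 1 𝓕)
    {Ψ δ : Config p q} {S : Set (Spacetime (p + q + 2))} (hΨ : Ψ.Smooth)
    (h : GaugeVariation Ψ δ S) :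
    δ.Smooth ∧ (∀ x, HasDerivAt (fun t : ℝ => (Ψ.vary t δ).Y x) 0 0) ∧
      ∃ K : Form (p + q + 2) (p + q + 1), ContDiff ℝ ∞ K ∧ tsupport K ⊆ S ∧ ∀ x,
        HasDerivAt (fun t : ℝ => lagrangian (fun _ => 0) (Ψ.vary t δ) x) (extDeriv K x) 0 ∧
        HasDerivAt (fun t : ℝ => lagrangian 𝓕 (Ψ.vary t δ) x) (extDeriv K x) 0 := by
  have hz : ContDiff ℝ ∞ (0 : Spacetime (p + q + 2) → ℝ) := contDiff_const
  have ha := hΨ.2.2.2.2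
  cases h with
  | A₁ hk U hU =>
    exact gauge_symmetry_of_jet_eq_zero h𝓕 hΨ
      ⟨contDiff_extD hk hU, smooth_zero, smooth_zero, smooth_zero, hz⟩
      (jet_eq_zero (extDeriv_extD hk hU) extDeriv_zero extDeriv_zero
        extDeriv_zero rfl)
  | A₂ hl V hV =>
    exact gauge_symmetry_of_jet_eq_zero h𝓕 hΨ
      ⟨smooth_zero, contDiff_extD hl hV, smooth_zero, smooth_zero, hz⟩
      (jet_eq_zero extDeriv_zero (extDeriv_extD hl hV) extDeriv_zero
        extDeriv_zero rfl)
  | R₁ hk U hU =>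
    exact gauge_symmetry_of_jet_eq_zero h𝓕 hΨ
      ⟨smooth_zero, smooth_zero, contDiff_extD hk hU, smooth_zero, hz⟩
      (jet_eq_zero extDeriv_zero extDeriv_zero (extDeriv_extD hk hU)
        extDeriv_zero rfl)
  | R₂ hl V hV =>
    exact gauge_symmetry_of_jet_eq_zero h𝓕 hΨ
      ⟨smooth_zero, smooth_zero, smooth_zero, contDiff_extD hl hV, hz⟩
      (jet_eq_zero extDeriv_zero extDeriv_zero extDeriv_zero
        (extDeriv_extD hl hV) rfl)
  | S₁ hk U hU =>
    have hW := contDiff_daWedge hk ha hU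
    refine gauge_symmetry_of_twisted h𝓕 hΨ ⟨(ha.smul hW).neg, smooth_zero, hW, smooth_zero, hz⟩
      (isClosed_tsupport _) (tsupport_daWedge_subset hk _ _) (tsupport_zero_subset _)
      (fun x => rfl) (fun x => ?_) (fun x => ?_)
    · simp [gaugeS₁]
    · simp only [gaugeS₁, Pi.zero_apply, zero_smul, daWedge_daWedge, daWedge_zero, sub_zero,
        hodge_zero, add_zero]
  | S₂ hl V hV =>
    have hW := contDiff_daWedge hl ha hV
    refine gauge_symmetry_of_twisted h𝓕 hΨ ⟨smooth_zero, (ha.smul hW).neg, smooth_zero, hW, hz⟩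
      (isClosed_tsupport _) (tsupport_zero_subset _) (tsupport_daWedge_subset hl _ _)
      (fun x => ?_) (fun x => rfl) (fun x => ?_)
    · simp [gaugeS₂]
    · simp only [gaugeS₂, Pi.zero_apply, zero_smul, daWedge_daWedge, daWedge_zero, sub_zero,
        hodge_zero, add_zero]
  | shift hn φ hφ =>
    have hR₁ := contDiff_shiftR₁ hΨ hn hφ
    have hR₂ := contDiff_shiftR₂ hΨ hn hφ
    have hs : ∀ {k : ℕ} (α : Form (p + q + 2) (k + 1)),
        tsupport (fun x => (φ x / gradSq Ψ.a x) • iota Ψ.a x (α x)) ⊆ tsupport φ := by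
      intro k α
      refine closure_mono fun x hx hφx => hx ?_
      simp [hφx]
    exact gauge_symmetry_of_twisted h𝓕 hΨ
      ⟨(ha.smul hR₁).neg, (ha.smul hR₂).neg, hR₁, hR₂, hφ⟩ (isClosed_tsupport _)
      (hs fun x => Ψ.Q₁ x + hodge deg₂₁ (Ψ.Q₂ x))
      (hs fun x => Ψ.Q₂ x + (-1 : ℝ) ^ (p + (p + q + 2) + p * (p + q + 2)) •
        hodge deg₁₂ (Ψ.Q₁ x)) (fun x => rfl) (fun x => rfl) (shift_identity hn φ)

end Gauge

/-! ### Equations of motion -/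

section Motion

open MeasureTheory

variable {p q : ℕ}

theorem contDiff_jet {Ψ : Config p q} (hΨ : Ψ.Smooth) : ContDiff ℝ ∞ (jet Ψ) := by
  obtain ⟨h1, h2, h3, h4, h5⟩ := hΨ
  exact h5.prodMk ((contDiff_extDeriv h1).prodMk ((contDiff_extDeriv h2).prodMk
    ((contDiff_extDeriv h3).prodMk (contDiff_extDeriv h4))))

theorem hasCompactSupport_jet {δ : Config p q} (hδ : δ.Compact) :
    HasCompactSupport (jet δ) := by
  obtain ⟨h1, h2, h3, h4, h5⟩ := hδ
  refine HasCompactSupport.intro' (K := tsupport δ.a ∪ (tsupport δ.A₁ ∪ (tsupport δ.A₂ ∪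
    (tsupport δ.R₁ ∪ tsupport δ.R₂)))) ?_ ?_ ?_
  · exact h5.isCompact.union (h1.isCompact.union (h2.isCompact.union
      (h3.isCompact.union h4.isCompact)))
  · exact (isClosed_tsupport _).union ((isClosed_tsupport _).union ((isClosed_tsupport _).union
      ((isClosed_tsupport _).union (isClosed_tsupport _))))
  · intro x hx
    simp only [Set.mem_union, not_or] at hx
    obtain ⟨k5, k1, k2, k3, k4⟩ := hx
    have hz : ∀ {k : ℕ} {α : Form (p + q + 2) k}, x ∉ tsupport α → extDeriv α x = 0 :=
      fun {k α} h => image_eq_zero_of_notMem_tsupport fun h' => h (tsupport_extDeriv_subset _ h')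
    simp only [jet, Config.F₁, Config.F₂, Config.Q₁, Config.Q₂, hz k1, hz k2, hz k3, hz k4,
      image_eq_zero_of_notMem_tsupport k5]
    rfl

theorem hasCompactSupport_currentK (Ψ : Config p q) {δ : Config p q} (hδ : δ.Compact) :
    HasCompactSupport (currentK Ψ δ) := by
  obtain ⟨h1, h2, h3, h4, -⟩ := hδ
  have hc : IsCompact (tsupport δ.A₁ ∪ (tsupport δ.A₂ ∪ (tsupport δ.R₁ ∪ tsupport δ.R₂))) :=
    h1.isCompact.union (h2.isCompact.union (h3.isCompact.union h4.isCompact))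
  refine hc.of_isClosed_subset (isClosed_tsupport _)
    (tsupport_currentK_subset Ψ δ hc.isClosed ?_ ?_ ?_ ?_)
  · exact Set.subset_union_left
  · exact Set.subset_union_left.trans Set.subset_union_right
  · exact Set.subset_union_left.trans (Set.subset_union_right.trans Set.subset_union_right)
  · exact Set.subset_union_right.trans (Set.subset_union_right.trans Set.subset_union_right)

/-- The pairing of a variation with the equations of motion. -/
def eomPairing (𝓕 : Alt (p + q + 2) (p + 1) → ℝ) (Ψ δ : Config p q)
    (x : Spacetime (p + q + 2)) : ℝ :=
  2 * ip (Jet.D 𝓕 (jet Ψ x)) (Jet.varY (jet Ψ x) (jet δ x)) +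
    4 * (density (wedge deg₂₁ (Ψ.Q₂ x) (daWedge rfl Ψ.a (fun y => δ.A₁ y + Ψ.a y • δ.R₁ y) x)) -
      density (wedge deg₂₁ (daWedge rfl Ψ.a (fun y => δ.A₂ y + Ψ.a y • δ.R₂ y) x) (Ψ.Q₁ x)))

theorem density_firstVar (𝓕 : Alt (p + q + 2) (p + 1) → ℝ) {Ψ δ : Config p q} (hΨ : Ψ.Smooth)
    (hδ : δ.Smooth) (x : Spacetime (p + q + 2)) :
    density (Jet.firstVar 𝓕 (jet Ψ x) (jet δ x)) =
      eomPairing 𝓕 Ψ δ x + density (extDeriv (currentK Ψ δ) x) := by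
  rw [firstVar_eq 𝓕 hΨ hδ, ← densityL_apply, map_add, map_add, map_smul, map_smul, map_sub,
    densityL_apply, density_vol]
  simp only [densityL_apply, smul_eq_mul, mul_one, eomPairing]

/-- Stationarity of the action, with the total derivative integrated away. -/
theorem stationary_iff {𝓕 : Alt (p + q + 2) (p + 1) → ℝ} (h𝓕 : ContDiff ℝ 1 𝓕)
    {Ψ δ : Config p q} (hΨ : Ψ.Smooth) (hδ : δ.Smooth) (hc : δ.Compact) :
    Stationary 𝓕 Ψ δ ↔ ∫ x, eomPairing 𝓕 Ψ δ x = 0 := by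
  have hL : ContDiff ℝ 1 fun v : Jet p q => density (Jet.lagr 𝓕 v) :=
    (densityL (d := p + q + 2)).contDiff.comp (Jet.contDiff_lagr h𝓕)
  have hfd : ∀ v w : Jet p q, fderiv ℝ (fun v : Jet p q => density (Jet.lagr 𝓕 v)) v w =
      density (Jet.firstVar 𝓕 v w) := by
    intro v w
    have h1 : HasDerivAt (fun t : ℝ => density (Jet.lagr 𝓕 (v + t • w)))
        (density (Jet.firstVar 𝓕 v w)) 0 :=
      (densityL (d := p + q + 2)).hasFDerivAt.comp_hasDerivAt 0 (Jet.hasDerivAt_lagr h𝓕 v w)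
    have h2 : HasDerivAt (fun t : ℝ => v + t • w) w 0 := by
      simpa using ((hasDerivAt_id (0 : ℝ)).smul_const w).const_add v
    have h3 := (hL.differentiable one_ne_zero (v + (0 : ℝ) • w)).hasFDerivAt.comp_hasDerivAt 0 h2
    rw [zero_smul, add_zero] at h3
    exact h3.unique h1
  have hj := (contDiff_jet hΨ).continuous
  have hk := (contDiff_jet hδ).continuous
  have hkc := hasCompactSupport_jet hc
  have hder := hasDerivAt_integral_comp_add_smul hL hj hk hkc
  have hact : (fun t : ℝ => ∫ x, (density (Jet.lagr 𝓕 (jet Ψ x + t • jet δ x)) -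
      density (Jet.lagr 𝓕 (jet Ψ x)))) = fun t => actionDiff 𝓕 Ψ (Ψ.vary t δ) := by
    funext t
    simp only [actionDiff, lagrangian_eq, jet_vary hΨ hδ]
  rw [hact] at hder
  have hint : Integrable fun x => density (Jet.firstVar 𝓕 (jet Ψ x) (jet δ x)) := by
    simp only [← hfd]
    have hcont : Continuous fun x => fderiv ℝ (fun v : Jet p q => density (Jet.lagr 𝓕 v))
        (jet Ψ x) (jet δ x) :=
      ((hL.continuous_fderiv one_ne_zero).comp hj).clm_apply hk
    refine hcont.integrable_of_hasCompactSupport (hkc.mono fun x hx hx' => hx ?_)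
    simp [hx']
  have hK := contDiff_currentK hΨ hδ
  have hKc := hasCompactSupport_currentK Ψ hc
  have hintK : Integrable fun x => density (extDeriv (currentK Ψ δ) x) := by
    have hcont : Continuous fun x => density (extDeriv (currentK Ψ δ) x) :=
      (densityL (d := p + q + 2)).continuous.comp (contDiff_extDeriv hK).continuous
    refine hcont.integrable_of_hasCompactSupport (HasCompactSupport.of_support_subset_isCompact
      hKc.isCompact fun x hx => ?_)
    by_contra hx'
    refine hx ?_
    have h0 : extDeriv (currentK Ψ δ) x = 0 :=
      image_eq_zero_of_notMem_tsupport fun h => hx' (tsupport_extDeriv_subset _ h)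
    change density (extDeriv (currentK Ψ δ) x) = 0
    rw [h0]
    rfl
  have hval : ∫ x, fderiv ℝ (fun v : Jet p q => density (Jet.lagr 𝓕 v)) (jet Ψ x) (jet δ x) =
      ∫ x, eomPairing 𝓕 Ψ δ x := by
    have h1 : ∀ x, eomPairing 𝓕 Ψ δ x = density (Jet.firstVar 𝓕 (jet Ψ x) (jet δ x)) -
        density (extDeriv (currentK Ψ δ) x) := fun x => by
      rw [density_firstVar 𝓕 hΨ hδ, add_sub_cancel_right]
    simp only [hfd, h1]
    rw [integral_sub hint hintK, integral_density_extDeriv hK hKc, sub_zero]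
  rw [hval] at hder
  exact ⟨fun h => hder.unique h, fun h => by rwa [h] at hder⟩

theorem wedge_wedge_one {d k l m r n : ℕ} (h₁ : 1 + l = m) (h : k + m = n) (h₂ : 1 + k = r)
    (h' : r + l = n) (α : Alt d k) (μ : Alt d 1) (β : Alt d l) :
    wedge h α (wedge h₁ μ β) = (-1 : ℝ) ^ k • wedge h' (wedge h₂ μ α) β := by
  rw [wedge_one_comm h₂ (by omega), wedge_smul_left, smul_smul, ← mul_pow, neg_one_mul, neg_neg,
    one_pow, one_smul, wedge_assoc _ h' h₁ h]

theorem wedge_one_wedge {d k l m r n : ℕ} (h₁ : 1 + k = m) (h : m + l = n) (h₂ : 1 + l = r)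
    (h' : k + r = n) (α : Alt d k) (μ : Alt d 1) (β : Alt d l) :
    wedge h (wedge h₁ μ α) β = (-1 : ℝ) ^ k • wedge h' α (wedge h₂ μ β) := by
  rw [wedge_wedge_one h₂ h' h₁ h, smul_smul, ← mul_pow, neg_one_mul, neg_neg, one_pow, one_smul]

/-- The twisted duality relation and `da ∧ dR_i = 0` imply the equations of motion of all fields,
including that of `a`. -/
theorem onShell_of {𝓕 : Alt (p + q + 2) (p + 1) → ℝ} (h𝓕 : ContDiff ℝ 1 𝓕) {Ψ : Config p q}
    (hΨ : Ψ.Smooth) (hD : ∀ x, TwistedDuality 𝓕 (Ψ.H₁ x) (Ψ.H₂ x))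
    (h₁ : ∀ x, daWedge rfl Ψ.a Ψ.Q₁ x = 0) (h₂ : ∀ x, daWedge rfl Ψ.a Ψ.Q₂ x = 0) :
    OnShell 𝓕 Ψ := by
  intro δ hδ hc
  rw [stationary_iff h𝓕 hΨ hδ hc]
  have hz : ∀ x, eomPairing 𝓕 Ψ δ x = 0 := by
    intro x
    have e0 : Jet.D 𝓕 (jet Ψ x) = 0 := hD x
    have e1 : wedge deg₂₁ (Ψ.Q₂ x) (daWedge rfl Ψ.a (fun y => δ.A₁ y + Ψ.a y • δ.R₁ y) x) = 0 := by
      have := h₂ x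
      rw [daWedge] at this ⊢
      rw [wedge_wedge_one _ _ (add_comm 1 (q + 1)) (by omega), this, wedge_zero_left, smul_zero]
    have e2 : wedge deg₂₁ (daWedge rfl Ψ.a (fun y => δ.A₂ y + Ψ.a y • δ.R₂ y) x) (Ψ.Q₁ x) = 0 := by
      have := h₁ x
      rw [daWedge] at this ⊢
      rw [wedge_one_wedge _ _ (add_comm 1 (p + 1)) (by omega), this, wedge_zero_right, smul_zero]
    rw [eomPairing, e0, e1, e2, ip_zero_left]
    simp
  simp [hz]

/-- The test variation with `δR_i = g ρ_i` and `δA_i + a δR_i = g α_i`, for constant forms `ρ_i`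
and `α_i` and a scalar `g`. -/
def testVar (a g : Spacetime (p + q + 2) → ℝ) (α₁ ρ₁ : Alt (p + q + 2) p)
    (α₂ ρ₂ : Alt (p + q + 2) q) : Config p q :=
  ⟨fun x => g x • α₁ - a x • g x • ρ₁, fun x => g x • α₂ - a x • g x • ρ₂, fun x => g x • ρ₁,
    fun x => g x • ρ₂, 0⟩

theorem testVar_smooth {a g : Spacetime (p + q + 2) → ℝ} (ha : ContDiff ℝ ∞ a)
    (hg : ContDiff ℝ ∞ g) (α₁ ρ₁ : Alt (p + q + 2) p) (α₂ ρ₂ : Alt (p + q + 2) q) :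
    (testVar a g α₁ ρ₁ α₂ ρ₂).Smooth :=
  ⟨(hg.smul contDiff_const).sub (ha.smul (hg.smul contDiff_const)),
    (hg.smul contDiff_const).sub (ha.smul (hg.smul contDiff_const)), hg.smul contDiff_const,
    hg.smul contDiff_const, contDiff_const⟩

theorem testVar_compact (a : Spacetime (p + q + 2) → ℝ) {g : Spacetime (p + q + 2) → ℝ}
    (hg : HasCompactSupport g) (α₁ ρ₁ : Alt (p + q + 2) p) (α₂ ρ₂ : Alt (p + q + 2) q) :
    (testVar a g α₁ ρ₁ α₂ ρ₂).Compact := by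
  refine ⟨hg.mono ?_, hg.mono ?_, hg.mono ?_, hg.mono ?_, HasCompactSupport.zero⟩ <;>
  · intro x hx hgx
    refine hx ?_
    simp [testVar, hgx]

/-- Localisation of the equations of motion: if the pairing with a family of test variations is
`g f` for every bump function `g`, then the continuous coefficient `f` vanishes. -/
theorem eom_local {𝓕 : Alt (p + q + 2) (p + 1) → ℝ} (h𝓕 : ContDiff ℝ 1 𝓕) {Ψ : Config p q}
    (hΨ : Ψ.Smooth) (h : OnShellForms 𝓕 Ψ) (α₁ ρ₁ : Alt (p + q + 2) p)
    (α₂ ρ₂ : Alt (p + q + 2) q) {f : Spacetime (p + q + 2) → ℝ} (hf : Continuous f)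
    (hfg : ∀ g : Spacetime (p + q + 2) → ℝ, ContDiff ℝ ∞ g → ∀ x,
      eomPairing 𝓕 Ψ (testVar Ψ.a g α₁ ρ₁ α₂ ρ₂) x = g x * f x) (x : Spacetime (p + q + 2)) :
    f x = 0 := by
  refine eq_zero_of_integral_smooth_mul hf (fun g hg hgc => ?_) x
  have hs := testVar_smooth hΨ.2.2.2.2 hg α₁ ρ₁ α₂ ρ₂
  have hc := testVar_compact Ψ.a hgc α₁ ρ₁ α₂ ρ₂
  have := (stationary_iff h𝓕 hΨ hs hc).1 (h _ hs hc rfl)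
  simpa only [hfg g hg] using this

theorem continuous_D {𝓕 : Alt (p + q + 2) (p + 1) → ℝ} (h𝓕 : ContDiff ℝ 1 𝓕) :
    Continuous (Jet.D 𝓕) := by
  have h1 : Continuous (Jet.H₁ : Jet p q → _) := (Jet.contDiff_H₁ (m := 0)).continuous
  have h2 : Continuous (Jet.H₂ : Jet p q → _) := (Jet.contDiff_H₂ (m := 0)).continuous
  have h3 : Continuous (Jet.Y : Jet p q → _) := (Jet.contDiff_Y (m := 0)).continuous
  have h4 : Continuous (halfGrad 𝓕) := by
    have hs : Continuous fun Y => ∑ i : Fin (p + 1) → Fin (p + q + 2),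
        ((∏ m, eta (i m)) * fderiv ℝ 𝓕 Y (dx i)) • (dx i : Alt (p + q + 2) (p + 1)) :=
      continuous_finsetSum _ fun i _ => (continuous_const.mul
        ((h𝓕.continuous_fderiv one_ne_zero).clm_apply continuous_const)).smul continuous_const
    exact (hs.const_smul ((p + 1).factorial : ℝ)⁻¹).const_smul (1 / 2 : ℝ)
  have h5 : Continuous fun v : Jet p q => hodge deg₂₁ v.H₂ := (hodgeL deg₂₁).continuous.comp h2
  have h6 : Continuous fun v : Jet p q => halfGrad 𝓕 v.Y := h4.comp h3
  exact (h1.sub h5).add h6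

theorem testVar_c₁ (a g : Spacetime (p + q + 2) → ℝ) (α₁ ρ₁ : Alt (p + q + 2) p)
    (α₂ ρ₂ : Alt (p + q + 2) q) :
    (fun y => (testVar a g α₁ ρ₁ α₂ ρ₂).A₁ y + a y • (testVar a g α₁ ρ₁ α₂ ρ₂).R₁ y) =
      fun y => g y • α₁ :=
  funext fun _ => sub_add_cancel _ _

theorem testVar_c₂ (a g : Spacetime (p + q + 2) → ℝ) (α₁ ρ₁ : Alt (p + q + 2) p)
    (α₂ ρ₂ : Alt (p + q + 2) q) :
    (fun y => (testVar a g α₁ ρ₁ α₂ ρ₂).A₂ y + a y • (testVar a g α₁ ρ₁ α₂ ρ₂).R₂ y) =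
      fun y => g y • α₂ :=
  funext fun _ => sub_add_cancel _ _

/-- The equations of motion of `A₁`, `A₂`, `R₁`, `R₂` imply the twisted duality relation and
`da ∧ dR_i = 0`. Variations with `δA_i = -a δR_i` give `⟨D, da ∧ ρ⟩ = 0` and
`⟨D, ⋆(da ∧ ρ)⟩ = 0` for the twisted duality expression `D`, hence `ι_{da} D = 0` and `da ∧ D = 0`,
which forces `D = 0`; no derivative of `D` is taken, so that `𝓕` need only be `C¹`. -/
theorem eom_of_onShellForms {𝓕 : Alt (p + q + 2) (p + 1) → ℝ} (h𝓕 : ContDiff ℝ 1 𝓕)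
    {Ψ : Config p q} (hΨ : Ψ.Smooth) (hn : Nonnull Ψ.a) (h : OnShellForms 𝓕 Ψ) :
    (∀ x, TwistedDuality 𝓕 (Ψ.H₁ x) (Ψ.H₂ x)) ∧ (∀ x, daWedge rfl Ψ.a Ψ.Q₁ x = 0) ∧
      (∀ x, daWedge rfl Ψ.a Ψ.Q₂ x = 0) := by
  have hd : 0 < p + q + 2 := by omega
  have hj := (contDiff_jet hΨ).continuous
  have hDc : Continuous fun x => Jet.D 𝓕 (jet Ψ x) := (continuous_D h𝓕).comp hj
  have hda := (contDiff_dScalar hΨ.2.2.2.2).continuous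
  have hdac : ∀ {k : ℕ} (ρ : Alt (p + q + 2) k),
      Continuous fun x => wedge (add_comm 1 k) (dScalar Ψ.a x) ρ := fun {k} ρ =>
    ((wedgeL (add_comm 1 k)).continuous.comp hda).clm_apply continuous_const
  have hsm : ∀ {k : ℕ} (g : Spacetime (p + q + 2) → ℝ) (ρ : Alt (p + q + 2) k) x,
      daWedge rfl Ψ.a (fun y => g y • ρ) x =
        g x • wedge (add_comm 1 k) (dScalar Ψ.a x) ρ := fun g ρ x => wedge_smul_right _ _ _ _
  have hz : ∀ (g : Spacetime (p + q + 2) → ℝ) (k : ℕ),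
      (fun y => g y • (0 : Alt (p + q + 2) k)) = 0 := fun g k => by funext y; simp
  -- variations with `δA_i = -a δR_i`
  have hpair : ∀ (ρ₁ : Alt (p + q + 2) p) (ρ₂ : Alt (p + q + 2) q) x,
      ip (Jet.D 𝓕 (jet Ψ x)) (wedge (add_comm 1 p) (dScalar Ψ.a x) ρ₁ +
        hodge deg₂₁ (wedge (add_comm 1 q) (dScalar Ψ.a x) ρ₂)) = 0 := by
    intro ρ₁ ρ₂ x
    have hcont : Continuous fun x => (-2) * ip (Jet.D 𝓕 (jet Ψ x))
        (wedge (add_comm 1 p) (dScalar Ψ.a x) ρ₁ +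
          hodge deg₂₁ (wedge (add_comm 1 q) (dScalar Ψ.a x) ρ₂)) :=
      continuous_const.mul ((ipL.continuous.comp hDc).clm_apply
        ((hdac ρ₁).add ((hodgeL deg₂₁).continuous.comp (hdac ρ₂))))
    have := eom_local h𝓕 hΨ h 0 ρ₁ 0 ρ₂ hcont (fun g hg y => ?_) x
    · linarith
    · have hs := testVar_smooth hΨ.2.2.2.2 hg (0 : Alt (p + q + 2) p) ρ₁ (0 : Alt (p + q + 2) q) ρ₂
      have e1 : Jet.varY (jet Ψ y) (jet (testVar Ψ.a g 0 ρ₁ 0 ρ₂) y) =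
          (-g y) • (wedge (add_comm 1 p) (dScalar Ψ.a y) ρ₁ +
            hodge deg₂₁ (wedge (add_comm 1 q) (dScalar Ψ.a y) ρ₂)) := by
        rw [Jet.varY, varH₁_jet hΨ hs, varH₂_jet hΨ hs, testVar_c₁, testVar_c₂, hz, hz,
          extDeriv_zero, extDeriv_zero]
        have f1 : daWedge rfl Ψ.a (testVar Ψ.a g 0 ρ₁ 0 ρ₂).R₁ y = _ := hsm g ρ₁ y
        have f2 : daWedge rfl Ψ.a (testVar Ψ.a g 0 ρ₁ 0 ρ₂).R₂ y = _ := hsm g ρ₂ y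
        have f3 : (testVar Ψ.a g 0 ρ₁ 0 ρ₂).a y = 0 := rfl
        rw [f1, f2, f3, zero_smul, zero_smul, Pi.zero_apply, Pi.zero_apply, zero_sub, zero_sub,
          add_zero, add_zero, hodge_neg, hodge_smul]
        ext u
        simp only [ContinuousAlternatingMap.smul_apply, ContinuousAlternatingMap.add_apply,
          ContinuousAlternatingMap.neg_apply, smul_eq_mul]
        ring
      rw [eomPairing, e1, testVar_c₁, testVar_c₂, hz, hz, daWedge_zero, daWedge_zero,
        ip_smul_right]
      have g1 : wedge deg₂₁ (Ψ.Q₂ y) ((0 : Form (p + q + 2) (p + 1)) y) = 0 := wedge_zero_right _ _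
      have g2 : wedge deg₂₁ ((0 : Form (p + q + 2) (q + 1)) y) (Ψ.Q₁ y) = 0 := wedge_zero_left _ _
      rw [g1, g2]
      ring
  have hD : ∀ x, Jet.D 𝓕 (jet Ψ x) = 0 := by
    intro x
    have i1 : iota Ψ.a x (Jet.D 𝓕 (jet Ψ x)) = 0 := by
      refine ip_nondegenerate fun ρ => ?_
      have := hpair ρ 0 x
      rw [wedge_zero_right, hodge_zero, add_zero, ip_wedge_one] at this
      exact this
    have i2 : wedge (add_comm 1 (p + 1)) (dScalar Ψ.a x) (Jet.D 𝓕 (jet Ψ x)) = 0 := by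
      refine wedge_nondegenerate_right hd (k := q) (by omega) fun ρ => ?_
      have := hpair 0 ρ x
      rw [wedge_zero_right, zero_add, ip_hodge hd, wedge_one_wedge _ _ (add_comm 1 (p + 1))
        (by omega), density_smul, neg_eq_zero] at this
      exact (mul_eq_zero.1 this).resolve_left (pow_ne_zero _ (by norm_num))
    rw [eq_daWedge_iota (hn x) (add_comm 1 (p + 1)) (add_comm 1 p) _ i2, i1, smul_zero,
      wedge_zero_right]
  -- now that `D = 0`, variations of `A_i` alone give the remaining equations
  refine ⟨hD, fun x => ?_, fun x => ?_⟩
  · have hwedge : ∀ α₂ : Alt (p + q + 2) q, density (wedge deg₂₁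
        (wedge (add_comm 1 q) (dScalar Ψ.a x) α₂) (Ψ.Q₁ x)) = 0 := by
      intro α₂
      have hQ : Continuous Ψ.Q₁ := (contDiff_extDeriv hΨ.2.2.1).continuous
      have hcont : Continuous fun x => (-4) * density (wedge deg₂₁
          (wedge (add_comm 1 q) (dScalar Ψ.a x) α₂) (Ψ.Q₁ x)) :=
        continuous_const.mul ((densityL (d := p + q + 2)).continuous.comp
          (((wedgeL deg₂₁).continuous.comp (hdac α₂)).clm_apply hQ))
      have := eom_local h𝓕 hΨ h 0 0 α₂ 0 hcont (fun g hg y => ?_) x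
      · linarith
      · rw [eomPairing, hD, testVar_c₁, testVar_c₂, hz, daWedge_zero, hsm, ip_zero_left,
          wedge_smul_left, density_smul]
        have g1 : wedge deg₂₁ (Ψ.Q₂ y) ((0 : Form (p + q + 2) (p + 1)) y) = 0 :=
          wedge_zero_right _ _
        have g0 : density (0 : Alt (p + q + 2) (p + q + 2)) = 0 := rfl
        rw [g1, g0]
        ring
    refine wedge_nondegenerate_right hd (k := q) (by omega) fun ρ => ?_
    have := hwedge ρ
    rw [wedge_one_wedge _ _ (add_comm 1 (p + 1)) (by omega), density_smul] at this
    exact (mul_eq_zero.1 this).resolve_left (pow_ne_zero _ (by norm_num))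
  · have hwedge : ∀ α₁ : Alt (p + q + 2) p, density (wedge deg₂₁ (Ψ.Q₂ x)
        (wedge (add_comm 1 p) (dScalar Ψ.a x) α₁)) = 0 := by
      intro α₁
      have hQ : Continuous Ψ.Q₂ := (contDiff_extDeriv hΨ.2.2.2.1).continuous
      have hcont : Continuous fun x => 4 * density (wedge deg₂₁ (Ψ.Q₂ x)
          (wedge (add_comm 1 p) (dScalar Ψ.a x) α₁)) :=
        continuous_const.mul ((densityL (d := p + q + 2)).continuous.comp
          (((wedgeL deg₂₁).continuous.comp hQ).clm_apply (hdac α₁)))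
      have := eom_local h𝓕 hΨ h α₁ 0 0 0 hcont (fun g hg y => ?_) x
      · linarith
      · rw [eomPairing, hD, testVar_c₁, testVar_c₂, hz, daWedge_zero, hsm, ip_zero_left,
          wedge_smul_right, density_smul]
        have g1 : wedge deg₂₁ ((0 : Form (p + q + 2) (q + 1)) y) (Ψ.Q₁ y) = 0 :=
          wedge_zero_left _ _
        have g0 : density (0 : Alt (p + q + 2) (p + q + 2)) = 0 := rfl
        rw [g1, g0]
        ring
    refine wedge_nondegenerate_left hd (l := p) (by omega) fun ρ => ?_
    have := hwedge ρ
    rw [wedge_wedge_one _ _ (add_comm 1 (q + 1)) (by omega), density_smul] at this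
    exact (mul_eq_zero.1 this).resolve_left (pow_ne_zero _ (by norm_num))

theorem OnShell.onShellForms {𝓕 : Alt (p + q + 2) (p + 1) → ℝ} {Ψ : Config p q}
    (h : OnShell 𝓕 Ψ) : OnShellForms 𝓕 Ψ := fun δ hδ hc _ => h δ hδ hc

theorem onShell_iff {𝓕 : Alt (p + q + 2) (p + 1) → ℝ} (h𝓕 : ContDiff ℝ 1 𝓕) {Ψ : Config p q}
    (hΨ : Ψ.Smooth) (hn : Nonnull Ψ.a) :
    OnShell 𝓕 Ψ ↔ (∀ x, TwistedDuality 𝓕 (Ψ.H₁ x) (Ψ.H₂ x)) ∧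
      (∀ x, daWedge rfl Ψ.a Ψ.Q₁ x = 0) ∧ (∀ x, daWedge rfl Ψ.a Ψ.Q₂ x = 0) :=
  ⟨fun h => eom_of_onShellForms h𝓕 hΨ hn h.onShellForms,
    fun h => onShell_of h𝓕 hΨ h.1 h.2.1 h.2.2⟩

end Motion

/-! ### Integrals depending on a parameter -/

section Parameter

open ContinuousLinearMap in
/-- Differentiation under the integral sign. -/
theorem hasFDerivAt_integral_parameter {E G : Type*} [NormedAddCommGroup E] [NormedSpace ℝ E]
    [FiniteDimensional ℝ E] [NormedAddCommGroup G] [NormedSpace ℝ G] [CompleteSpace G]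
    {f : ℝ × E → G} (hf : ContDiff ℝ 1 f) (x : E) :
    HasFDerivAt (fun y => ∫ s in (0 : ℝ)..1, f (s, y))
      (∫ s in (0 : ℝ)..1, (fderiv ℝ f (s, x)).comp (inr ℝ ℝ E)) x := by
  have : ProperSpace E := FiniteDimensional.proper ℝ E
  have hf' : Continuous fun z : ℝ × E => (fderiv ℝ f z).comp (inr ℝ ℝ E) :=
    (hf.continuous_fderiv one_ne_zero).clm_comp continuous_const
  obtain ⟨M, hM⟩ := ((isCompact_Icc (a := (0 : ℝ)) (b := 1)).prod
    (isCompact_closedBall x 1)).exists_bound_of_continuousOn hf'.continuousOn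
  refine intervalIntegral.hasFDerivAt_integral_of_dominated_of_fderiv_le
    (F := fun y s => f (s, y)) (F' := fun y s => (fderiv ℝ f (s, y)).comp (inr ℝ ℝ E))
    (bound := fun _ => M) (Metric.ball_mem_nhds x one_pos) ?_ ?_ ?_ ?_ ?_ ?_
  · refine Filter.Eventually.of_forall fun y => ?_
    exact (hf.continuous.comp (by fun_prop : Continuous fun s : ℝ => (s, y))).aestronglyMeasurable
  · exact (hf.continuous.comp (by fun_prop : Continuous fun s : ℝ => (s, x))).intervalIntegrable
      _ _
  · exact (hf'.comp (by fun_prop : Continuous fun s : ℝ => (s, x))).aestronglyMeasurable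
  · refine Filter.Eventually.of_forall fun s hs y hy => hM (s, y) ⟨?_, ?_⟩
    · rw [Set.uIoc_of_le zero_le_one] at hs
      exact Set.Ioc_subset_Icc_self hs
    · exact Metric.ball_subset_closedBall hy
  · exact intervalIntegrable_const
  · refine Filter.Eventually.of_forall fun s _ y _ => ?_
    have h1 : HasFDerivAt f (fderiv ℝ f (s, y)) (s, y) :=
      (hf.differentiable one_ne_zero _).hasFDerivAt
    exact h1.comp y (hasFDerivAt_prodMk_right s y)

theorem clm_integral_fderiv {E G : Type*} [NormedAddCommGroup E] [NormedSpace ℝ E]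
    [NormedAddCommGroup G] [NormedSpace ℝ G] [CompleteSpace G] {f : ℝ × E → G}
    (hf : ContDiff ℝ 1 f) (x : E) (L : (E →L[ℝ] G) →L[ℝ] ℝ) :
    L (∫ s in (0 : ℝ)..1, (fderiv ℝ f (s, x)).comp (ContinuousLinearMap.inr ℝ ℝ E)) =
      ∫ s in (0 : ℝ)..1, L ((fderiv ℝ f (s, x)).comp (ContinuousLinearMap.inr ℝ ℝ E)) := by
  have hc : Continuous fun s : ℝ =>
      (fderiv ℝ f (s, x)).comp (ContinuousLinearMap.inr ℝ ℝ E) :=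
    ((hf.continuous_fderiv one_ne_zero).comp
      (by fun_prop : Continuous fun s : ℝ => (s, x))).clm_comp continuous_const
  exact (L.intervalIntegral_comp_comm (hc.intervalIntegrable 0 1)).symm

/-- The induction for `contDiff_integral_parameter`. The codomain varies, since the derivative
takes values in `E →L[ℝ] G`; to stay in one universe, both spaces are in `Type`. -/
theorem contDiff_integral_parameter_nat {E : Type} [NormedAddCommGroup E] [NormedSpace ℝ E]
    [FiniteDimensional ℝ E] (n : ℕ) :
    ∀ {G : Type} [NormedAddCommGroup G] [NormedSpace ℝ G] [CompleteSpace G]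
      {f : ℝ × E → G}, ContDiff ℝ ∞ f → ContDiff ℝ n fun y => ∫ s in (0 : ℝ)..1, f (s, y) := by
  induction n with
  | zero =>
    intro G _ _ _ f hf
    have h1 : Continuous fun y => ∫ s in (0 : ℝ)..1, f (s, y) := by
      have h2 : Differentiable ℝ fun y => ∫ s in (0 : ℝ)..1, f (s, y) := fun y =>
        (hasFDerivAt_integral_parameter (hf.of_le (by exact_mod_cast le_top)) y).differentiableAt
      exact h2.continuous
    exact contDiff_zero.2 h1
  | succ n ih =>
    intro G _ _ _ f hf
    have h1 : ContDiff ℝ ∞ fun z : ℝ × E =>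
        (fderiv ℝ f z).comp (ContinuousLinearMap.inr ℝ ℝ E) :=
      (hf.fderiv_right (m := ∞) (by simp)).clm_comp contDiff_const
    push_cast
    exact contDiff_succ_iff_hasFDerivAt.2 ⟨_, ih h1, fun y =>
      hasFDerivAt_integral_parameter (hf.of_le (by exact_mod_cast le_top)) y⟩

theorem contDiff_integral_parameter {E G : Type} [NormedAddCommGroup E] [NormedSpace ℝ E]
    [FiniteDimensional ℝ E] [NormedAddCommGroup G] [NormedSpace ℝ G] [CompleteSpace G]
    {f : ℝ × E → G} (hf : ContDiff ℝ ∞ f) :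
    ContDiff ℝ ∞ fun y => ∫ s in (0 : ℝ)..1, f (s, y) :=
  contDiff_infty.2 fun n => contDiff_integral_parameter_nat n hf

variable {d k : ℕ}

theorem integral_alt_apply {f : ℝ → Alt d k} (hf : Continuous f) (w : Fin k → Spacetime d) :
    (∫ s in (0 : ℝ)..1, f s) w = ∫ s in (0 : ℝ)..1, f s w :=
  ((ContinuousAlternatingMap.apply ℝ (Spacetime d) ℝ w).intervalIntegral_comp_comm
    (hf.intervalIntegrable 0 1)).symm

theorem extDeriv_integral {γ : ℝ × Spacetime d → Alt d k} (hγ : ContDiff ℝ ∞ γ)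
    (x : Spacetime d) (w : Fin (k + 1) → Spacetime d) :
    extDeriv (fun y => ∫ s in (0 : ℝ)..1, γ (s, y)) x w =
      ∫ s in (0 : ℝ)..1, extDeriv (fun y => γ (s, y)) x w := by
  have h1 : ∀ s : ℝ, extDeriv (fun y => γ (s, y)) x =
      ContinuousAlternatingMap.alternatizeUncurryFinCLM ℝ (Spacetime d) ℝ
        ((fderiv ℝ γ (s, x)).comp (ContinuousLinearMap.inr ℝ ℝ (Spacetime d))) := by
    intro s
    have h2 : HasFDerivAt γ (fderiv ℝ γ (s, x)) (s, x) :=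
      (hγ.differentiable (by simp) _).hasFDerivAt
    have h3 := (h2.comp x (hasFDerivAt_prodMk_right s x)).fderiv
    rw [extDeriv]
    exact congrArg _ h3
  have h2 : extDeriv (fun y => ∫ s in (0 : ℝ)..1, γ (s, y)) x =
      ContinuousAlternatingMap.alternatizeUncurryFinCLM ℝ (Spacetime d) ℝ
        (∫ s in (0 : ℝ)..1,
          (fderiv ℝ γ (s, x)).comp (ContinuousLinearMap.inr ℝ ℝ (Spacetime d))) := by
    rw [extDeriv, (hasFDerivAt_integral_parameter (hγ.of_le (by exact_mod_cast le_top)) x).fderiv]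
    rfl
  simp only [h2, h1]
  exact clm_integral_fderiv (hγ.of_le (by exact_mod_cast le_top)) x
    ((ContinuousAlternatingMap.apply ℝ (Spacetime d) ℝ w).comp
      (ContinuousAlternatingMap.alternatizeUncurryFinCLM ℝ (Spacetime d) ℝ))

end Parameter

/-! ### The homotopy operator -/

section Homotopy

variable {d k : ℕ} {E : Type*} [NormedAddCommGroup E] [NormedSpace ℝ E]

theorem contDiff_of_apply {m : WithTop ℕ∞} {f : E → Alt d k}
    (hf : ∀ w, ContDiff ℝ m fun z => f z w) : ContDiff ℝ m f := by
  have h1 : f = fun z => (k.factorial : ℝ)⁻¹ •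
      ∑ i : Fin k → Fin d, f z (fun m => e (i m)) • dx i := funext fun z => eq_sum_dx (f z)
  rw [h1]
  refine ContDiff.const_smul (k.factorial : ℝ)⁻¹ (ContDiff.sum fun i _ => ?_)
  exact (hf fun m => e (i m)).smul contDiff_const

theorem contDiff_alt_apply {m : WithTop ℕ∞} {f : E → Alt d k} {v : E → Fin k → Spacetime d}
    (hf : ContDiff ℝ m f) (hv : ContDiff ℝ m v) : ContDiff ℝ m fun z => f z (v z) := by
  have h1 : (fun z => f z (v z)) = fun z => (k.factorial : ℝ)⁻¹ *
      ∑ i : Fin k → Fin d, f z (fun m => e (i m)) * dx i (v z) := by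
    funext z
    conv_lhs => rw [eq_sum_dx (f z)]
    rw [ContinuousAlternatingMap.smul_apply, ContinuousAlternatingMap.sum_apply, smul_eq_mul]
    simp only [ContinuousAlternatingMap.smul_apply, smul_eq_mul]
  rw [h1]
  refine contDiff_const.mul (ContDiff.sum fun i _ => ContDiff.mul ?_ ?_)
  · have h2 := (ContinuousAlternatingMap.apply ℝ (Spacetime d) ℝ
      (fun m => e (i m))).contDiff (n := m) |>.comp hf
    exact h2
  · have h2 := (dx i).toContinuousMultilinearMap.contDiff (n := m) |>.comp hv
    exact h2

/-- The pullback of `α` along the map `h (s, ·)`, as a function of `z = (s, x)`. -/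
def slicePullback (h : ℝ × Spacetime d → Spacetime d) (α : Form d k) (z : ℝ × Spacetime d) :
    Alt d k :=
  (α (h z)).compContinuousLinearMap
    ((fderiv ℝ h z).comp (ContinuousLinearMap.inr ℝ ℝ (Spacetime d)))

/-- The contraction of the pullback of `α` along the homotopy `h` with the direction of its
parameter, restricted to a slice of constant parameter. -/
def homotopyContract (h : ℝ × Spacetime d → Spacetime d) (α : Form d (k + 1))
    (z : ℝ × Spacetime d) : Alt d k :=
  ((α (h z)).curryLeft (fderiv ℝ h z (1, 0))).compContinuousLinearMap
    ((fderiv ℝ h z).comp (ContinuousLinearMap.inr ℝ ℝ (Spacetime d)))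

theorem slicePullback_apply (h : ℝ × Spacetime d → Spacetime d) (α : Form d k)
    (z : ℝ × Spacetime d) (w : Fin k → Spacetime d) :
    slicePullback h α z w = α (h z) fun i => fderiv ℝ h z (0, w i) := rfl

theorem homotopyContract_apply (h : ℝ × Spacetime d → Spacetime d) (α : Form d (k + 1))
    (z : ℝ × Spacetime d) (w : Fin k → Spacetime d) :
    homotopyContract h α z w =
      α (h z) (Fin.cons (fderiv ℝ h z (1, 0)) fun i => fderiv ℝ h z (0, w i)) := rfl

theorem contDiff_slicePullback {h : ℝ × Spacetime d → Spacetime d} {α : Form d k}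
    (hh : ContDiff ℝ ∞ h) (hα : ContDiff ℝ ∞ α) : ContDiff ℝ ∞ (slicePullback h α) := by
  refine contDiff_of_apply fun w => ?_
  simp only [slicePullback_apply]
  refine contDiff_alt_apply (hα.comp hh) (contDiff_pi.2 fun i => ?_)
  exact (hh.fderiv_right (m := ∞) (by simp)).clm_apply contDiff_const

theorem contDiff_homotopyContract {h : ℝ × Spacetime d → Spacetime d} {α : Form d (k + 1)}
    (hh : ContDiff ℝ ∞ h) (hα : ContDiff ℝ ∞ α) : ContDiff ℝ ∞ (homotopyContract h α) := by
  refine contDiff_of_apply fun w => ?_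
  simp only [homotopyContract_apply]
  refine contDiff_alt_apply (hα.comp hh) (contDiff_pi.2 fun i => ?_)
  have hD : ContDiff ℝ ∞ (fderiv ℝ h) := hh.fderiv_right (m := ∞) (by simp)
  refine Fin.cases ?_ (fun j => ?_) i
  · exact hD.clm_apply contDiff_const
  · exact hD.clm_apply contDiff_const

/-- Cartan's formula for the derivative of the pullback along a homotopy. It is the evaluation of
`d(h^* α) = h^* dα` on `∂_s, w₀, …, w_k`, where `h` is regarded as a map on `ℝ × ℝ^d`. -/
theorem hasDerivAt_slicePullback {h : ℝ × Spacetime d → Spacetime d} {α : Form d (k + 1)}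
    (hh : ContDiff ℝ ∞ h) (hα : ContDiff ℝ ∞ α) (s : ℝ) (x : Spacetime d)
    (w : Fin (k + 1) → Spacetime d) :
    HasDerivAt (fun s => slicePullback h α (s, x) w)
      (homotopyContract h (extDeriv α) (s, x) w +
        extDeriv (fun y => homotopyContract h α (s, y)) x w) s := by
  set Ω : ℝ × Spacetime d → (ℝ × Spacetime d) [⋀^Fin (k + 1)]→L[ℝ] ℝ :=
    fun z => (α (h z)).compContinuousLinearMap (fderiv ℝ h z) with hΩ
  have hD : ContDiff ℝ ∞ (fderiv ℝ h) := hh.fderiv_right (m := ∞) (by simp)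
  have hΩd : Differentiable ℝ Ω := fun z =>
    DifferentiableAt.continuousAlternatingMapCompContinuousLinearMap
      ((hα.differentiable (by simp) _).comp z (hh.differentiable (by simp) z))
      (hD.differentiable (by simp) z)
  set W : Fin (k + 2) → ℝ × Spacetime d := Fin.cons (1, 0) fun i => (0, w i) with hW
  have h1 : extDeriv Ω (s, x) W = homotopyContract h (extDeriv α) (s, x) w := by
    rw [hΩ, extDeriv_pullback (r := ∞) (hα.differentiable (by simp) _) hh.contDiffAt
      minSmoothness_le_infty]
    change extDeriv α (h (s, x)) _ = extDeriv α (h (s, x)) _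
    congr 1
    funext i
    refine Fin.cases ?_ (fun j => ?_) i <;> rfl
  rw [extDeriv_apply (hΩd _), Fin.sum_univ_succ] at h1
  have hsl : ∀ y, HasFDerivAt (fun y : Spacetime d => ((s, y) : ℝ × Spacetime d))
      (ContinuousLinearMap.inr ℝ ℝ (Spacetime d)) y := fun y => hasFDerivAt_prodMk_right s y
  have h2 : extDeriv (fun y => homotopyContract h α (s, y)) x w =
      - ∑ i : Fin (k + 1), (-1) ^ (i.succ : ℕ) •
        fderiv ℝ (fun z => Ω z (i.succ.removeNth W)) (s, x) (W i.succ) := by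
    have hc := contDiff_homotopyContract hh hα
    have hcs : DifferentiableAt ℝ (fun y => homotopyContract h α (s, y)) x :=
      (hc.differentiable (by simp) _).comp x (hsl x).differentiableAt
    rw [extDeriv_apply hcs, ← Finset.sum_neg_distrib]
    refine Finset.sum_congr rfl fun i _ => ?_
    have h3 : (fun y => homotopyContract h α (s, y) (i.removeNth w)) =
        (fun z => Ω z (i.succ.removeNth W)) ∘ fun y => (s, y) := by
      funext y
      change α _ _ = α _ _
      congr 1
      funext j
      refine Fin.cases rfl (fun j => ?_) j
      change fderiv ℝ h (s, y) (0, w (i.succAbove j)) =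
        fderiv ℝ h (s, y) (W (i.succ.succAbove j.succ))
      rw [Fin.succ_succAbove_succ]
      rfl
    have h4 : DifferentiableAt ℝ (fun z => Ω z (i.succ.removeNth W)) (s, x) :=
      (hΩd _).continuousAlternatingMap_apply (fun _ => differentiableAt_const _)
    rw [h3, (h4.hasFDerivAt.comp x (hsl x)).fderiv, Fin.val_succ, pow_succ]
    simp [hW]
  have h3 : HasDerivAt (fun s => slicePullback h α (s, x) w)
      (fderiv ℝ (fun z => Ω z ((0 : Fin (k + 2)).removeNth W)) (s, x) (1, 0)) s := by
    have h4 : DifferentiableAt ℝ (fun z => Ω z ((0 : Fin (k + 2)).removeNth W)) (s, x) :=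
      (hΩd _).continuousAlternatingMap_apply (fun _ => differentiableAt_const _)
    have h5 : HasDerivAt (fun s : ℝ => (s, x)) ((1 : ℝ), (0 : Spacetime d)) s :=
      (hasDerivAt_id s).prodMk (hasDerivAt_const s x)
    exact h4.hasFDerivAt.comp_hasDerivAt s h5
  refine h3.congr_deriv ?_
  rw [h2, ← h1]
  simp [hW]

/-- The homotopy formula, Cartan's formula integrated over the parameter. -/
theorem slicePullback_sub {h : ℝ × Spacetime d → Spacetime d} {α : Form d (k + 1)}
    (hh : ContDiff ℝ ∞ h) (hα : ContDiff ℝ ∞ α) (x : Spacetime d) :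
    slicePullback h α (1, x) - slicePullback h α (0, x) =
      (∫ s in (0 : ℝ)..1, homotopyContract h (extDeriv α) (s, x)) +
        extDeriv (fun y => ∫ s in (0 : ℝ)..1, homotopyContract h α (s, y)) x := by
  have hc := contDiff_homotopyContract hh hα
  have hc' := contDiff_homotopyContract hh (contDiff_extDeriv hα)
  have hs : Continuous fun s : ℝ => (s, x) := by fun_prop
  ext w
  have hap : ∀ {m : ℕ} (v : Fin m → Spacetime d) {g : ℝ → Alt d m}, Continuous g →
      Continuous fun s => g s v := fun v g hg =>
    (ContinuousAlternatingMap.apply ℝ (Spacetime d) ℝ v).continuous.comp hg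
  have hcs : Continuous fun s : ℝ => homotopyContract h (extDeriv α) (s, x) :=
    hc'.continuous.comp hs
  have hi1 : Continuous fun s : ℝ => homotopyContract h (extDeriv α) (s, x) w :=
    hap w (hc'.continuous.comp hs)
  have hi2 : Continuous fun s : ℝ => extDeriv (fun y => homotopyContract h α (s, y)) x w := by
    have h1 : ∀ s : ℝ, extDeriv (fun y => homotopyContract h α (s, y)) x w =
        fderiv ℝ (fun z => slicePullback h α z w) (s, x) (1, 0) -
          homotopyContract h (extDeriv α) (s, x) w := by
      intro s
      have h2 : ContDiff ℝ ∞ fun z => slicePullback h α z w :=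
        contDiff_alt_apply (contDiff_slicePullback hh hα) contDiff_const
      have h3 : HasDerivAt (fun s : ℝ => (s, x)) ((1 : ℝ), (0 : Spacetime d)) s :=
        (hasDerivAt_id s).prodMk (hasDerivAt_const s x)
      have h4 : HasDerivAt (fun s => slicePullback h α (s, x) w)
          (fderiv ℝ (fun z => slicePullback h α z w) (s, x) (1, 0)) s := by
        have h5 : HasFDerivAt (fun z => slicePullback h α z w)
            (fderiv ℝ (fun z => slicePullback h α z w) (s, x)) (s, x) :=
          (h2.differentiable (by simp) (s, x)).hasFDerivAt
        exact h5.comp_hasDerivAt s h3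
      rw [h4.unique (hasDerivAt_slicePullback hh hα s x w)]
      ring
    simp only [h1]
    have h2 : ContDiff ℝ ∞ fun z => slicePullback h α z w :=
      contDiff_alt_apply (contDiff_slicePullback hh hα) contDiff_const
    exact (((h2.continuous_fderiv (by simp)).comp hs).clm_apply continuous_const).sub hi1
  rw [ContinuousAlternatingMap.sub_apply, ContinuousAlternatingMap.add_apply,
    integral_alt_apply hcs, extDeriv_integral hc,
    ← intervalIntegral.integral_add (hi1.intervalIntegrable 0 1) (hi2.intervalIntegrable 0 1)]
  exact (intervalIntegral.integral_eq_sub_of_hasDerivAt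
    (fun s _ => hasDerivAt_slicePullback hh hα s x w)
    ((hi1.add hi2).intervalIntegrable 0 1)).symm

end Homotopy

/-! ### The Poincaré lemma relative to the level sets of a function -/

section Relative

variable {d k : ℕ}

/-- A smooth homotopy `h` that, over `N`, moves along the level sets of `a` and contracts `N`
at parameter `0` onto a set transversal to them: the map `h (0, ·)` is infinitesimally constant
along the level sets. -/
structure ContractsLevels (a : Spacetime d → ℝ) (N : Set (Spacetime d))
    (h : ℝ × Spacetime d → Spacetime d) : Prop where
  smooth : ContDiff ℝ ∞ h
  one : ∀ x ∈ N, h (1, x) = x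
  level : ∀ x ∈ N, ∀ s ∈ Set.Ioo (-1 : ℝ) 2, a (h (s, x)) = a x
  zero : ∀ x ∈ N, ∀ v, fderiv ℝ a x v = 0 → fderiv ℝ h (0, x) (0, v) = 0

/-- Where the homotopy moves along the level sets of `a`, contraction anticommutes with
`da ∧`. -/
theorem homotopyContract_daWedge {a : Spacetime d → ℝ} {h : ℝ × Spacetime d → Spacetime d}
    {z : ℝ × Spacetime d} (S : Form d (k + 1)) (h' : 1 + k = k + 1)
    (h₀ : fderiv ℝ a (h z) (fderiv ℝ h z (1, 0)) = 0)
    (h₁ : ∀ v, fderiv ℝ a (h z) (fderiv ℝ h z (0, v)) = fderiv ℝ a z.2 v) :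
    homotopyContract h (daWedge rfl a S) z =
      -wedge h' (dScalar a z.2) (homotopyContract h S z) := by
  ext w
  rw [ContinuousAlternatingMap.neg_apply, wedge_one_apply, homotopyContract_apply]
  refine (wedge_one_apply _ _ _ _).trans ?_
  rw [Fin.sum_univ_succ, ← Finset.sum_neg_distrib]
  simp only [dScalar_apply, Fin.cons_zero, Fin.cons_succ, h₀, h₁, mul_zero, zero_mul, zero_add]
  refine Finset.sum_congr rfl fun i _ => ?_
  have h2 : S (h z) (Fin.removeNth (α := fun _ => Spacetime d) i.succ
      (Fin.cons (fderiv ℝ h z (1, 0)) fun j => fderiv ℝ h z (0, w j))) =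
      homotopyContract h S z (i.removeNth w) := by
    rw [homotopyContract_apply]
    congr 1
    funext j
    refine Fin.cases rfl (fun j => ?_) j
    simp only [Fin.removeNth, Fin.succ_succAbove_succ, Fin.cons_succ]
  rw [h2, Fin.val_succ, pow_succ]
  ring

/-- A pullback along a linear map that vanishes on the kernel of `da` is annihilated by `da ∧`. -/
theorem wedge_dScalar_comp_eq_zero {a : Spacetime d → ℝ} {x : Spacetime d}
    (hx : gradSq a x ≠ 0) (h : 1 + (k + 1) = k + 1 + 1) (α : Alt d (k + 1))
    (T : Spacetime d →L[ℝ] Spacetime d) (hT : ∀ v, fderiv ℝ a x v = 0 → T v = 0) :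
    wedge h (dScalar a x) (α.compContinuousLinearMap T) = 0 := by
  set u := gradVec a x with hu
  have hu0 : fderiv ℝ a x u ≠ 0 := by rwa [hu, fderiv_gradVec]
  have hTv : ∀ v, T v = fderiv ℝ a x v • (fderiv ℝ a x u)⁻¹ • T u := by
    intro v
    have h1 : T (v - (fderiv ℝ a x v * (fderiv ℝ a x u)⁻¹) • u) = 0 := by
      refine hT _ ?_
      rw [map_sub, map_smul, smul_eq_mul, inv_mul_cancel_right₀ hu0, sub_self]
    rw [map_sub, map_smul, sub_eq_zero] at h1
    rw [h1, smul_smul]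
  set m := (fderiv ℝ a x u)⁻¹ • T u
  have h2 : ∀ w : Fin (k + 1) → Spacetime d, α.compContinuousLinearMap T w =
      (∏ i, fderiv ℝ a x (w i)) * α fun _ => m := by
    intro w
    change α (fun i => T (w i)) = _
    have h3 : (fun i => T (w i)) = fun i => fderiv ℝ a x (w i) • m := funext fun i => hTv (w i)
    rw [h3, α.map_smul_univ, smul_eq_mul]
  cases k with
  | zero =>
    -- the pullback is a multiple of `da`
    have h4 : α.compContinuousLinearMap T =
        wedge (rfl : 1 + 0 = 1) (dScalar a x)
          (ContinuousAlternatingMap.constOfIsEmpty ℝ (Spacetime d) (Fin 0) (α fun _ => m)) := by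
      ext w
      rw [h2, wedge_one_apply]
      simp only [Nat.reduceAdd, Finset.univ_unique, Fin.default_eq_zero, Fin.isValue,
        Finset.prod_singleton, Finset.sum_singleton, Fin.val_zero, pow_zero, one_mul,
        dScalar_apply]
      rfl
    rw [h4, wedge_self]
  | succ k =>
    have h4 : α.compContinuousLinearMap T = 0 := by
      ext w
      rw [h2, α.map_eq_zero_of_eq (fun _ => m) (i := 0) (j := 1) rfl (by simp), mul_zero]
      rfl
    rw [h4, wedge_zero_right]

theorem ContractsLevels.fderiv_eq {a : Spacetime d → ℝ} (ha : ContDiff ℝ ∞ a)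
    {N : Set (Spacetime d)} (hN : IsOpen N) {h : ℝ × Spacetime d → Spacetime d}
    (hh : ContractsLevels a N h) {x : Spacetime d} (hx : x ∈ N) {s : ℝ}
    (hs : s ∈ Set.Ioo (-1 : ℝ) 2) (z : ℝ × Spacetime d) :
    fderiv ℝ a (h (s, x)) (fderiv ℝ h (s, x) z) = fderiv ℝ a x z.2 := by
  have h1 : (fun z => a (h z)) =ᶠ[𝓝 (s, x)] fun z => a z.2 := by
    filter_upwards [(isOpen_Ioo.prod hN).mem_nhds (Set.mk_mem_prod hs hx)] with z hz
    exact hh.level z.2 hz.2 z.1 hz.1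
  have h2 : HasFDerivAt (fun z => a (h z))
      ((fderiv ℝ a (h (s, x))).comp (fderiv ℝ h (s, x))) (s, x) :=
    (ha.differentiable (by simp) _).hasFDerivAt.comp _
      (hh.smooth.differentiable (by simp) _).hasFDerivAt
  have h3 : HasFDerivAt (fun z : ℝ × Spacetime d => a z.2)
      ((fderiv ℝ a x).comp (ContinuousLinearMap.snd ℝ ℝ (Spacetime d))) (s, x) :=
    (ha.differentiable (by simp) x).hasFDerivAt.comp (s, x) hasFDerivAt_snd
  exact congrArg (fun L : ℝ × Spacetime d →L[ℝ] ℝ => L z)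
    ((h2.congr_of_eventuallyEq h1.symm).unique h3)

theorem ContractsLevels.slicePullback_one {a : Spacetime d → ℝ} {N : Set (Spacetime d)}
    (hN : IsOpen N) {h : ℝ × Spacetime d → Spacetime d} (hh : ContractsLevels a N h)
    (α : Form d k) {x : Spacetime d} (hx : x ∈ N) : slicePullback h α (1, x) = α x := by
  have h1 : HasFDerivAt (fun y => h (1, y))
      ((fderiv ℝ h (1, x)).comp (ContinuousLinearMap.inr ℝ ℝ (Spacetime d))) x :=
    (hh.smooth.differentiable (by simp) (1, x)).hasFDerivAt.comp x
      (hasFDerivAt_prodMk_right (1 : ℝ) x)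
  have h2 : (fun y => h (1, y)) =ᶠ[𝓝 x] id := by
    filter_upwards [hN.mem_nhds hx] with y hy using hh.one y hy
  have h3 := (h1.congr_of_eventuallyEq h2.symm).unique (hasFDerivAt_id x)
  rw [slicePullback, h3, hh.one x hx]
  rfl

theorem integral_neg_wedge (h : 1 + k = k + 1) (μ : Alt d 1) {γ : ℝ → Alt d k}
    (hγ : Continuous γ) :
    ∫ s in (0 : ℝ)..1, -wedge h μ (γ s) = -wedge h μ (∫ s in (0 : ℝ)..1, γ s) := by
  have h1 := (wedgeL h μ).intervalIntegral_comp_comm (hγ.intervalIntegrable 0 1)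
    (μ := MeasureTheory.volume)
  rw [intervalIntegral.integral_neg]
  exact congrArg _ h1

/-- Where the level sets of `a` contract, a form `α` with `da ∧ dα = 0`, that is, whose
restrictions to the level sets are closed, is of the form `dB + da ∧ C`. Since `dα = da ∧ S`, the
term of the homotopy formula that contains `dα` is again a multiple of `da`, and so is the pullback
of `α` along the map at the end of the homotopy. -/
theorem exists_potential {a : Spacetime d → ℝ} (ha : ContDiff ℝ ∞ a) (hn : Nonnull a)
    {N : Set (Spacetime d)} (hN : IsOpen N) {h : ℝ × Spacetime d → Spacetime d}
    (hh : ContractsLevels a N h) {α : Form d (k + 1)} (hα : ContDiff ℝ ∞ α)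
    (hd : ∀ x, daWedge rfl a (extDeriv α) x = 0) :
    ∃ B C : Form d k, ContDiff ℝ ∞ B ∧ ContDiff ℝ ∞ C ∧
      ∀ x ∈ N, α x = extDeriv B x + daWedge rfl a C x := by
  set S : Form d (k + 1) := fun y => (gradSq a y)⁻¹ • iota a y (extDeriv α y)
  have hinv : ContDiff ℝ ∞ fun y => (gradSq a y)⁻¹ := (contDiff_gradSq ha).inv hn
  have hSs : ContDiff ℝ ∞ S := hinv.smul (contDiff_iota ha (contDiff_extDeriv hα))
  have hαS : extDeriv α = daWedge rfl a S := funext fun x =>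
    eq_daWedge_iota (hn x) _ _ _ (hd x)
  have hcS := contDiff_homotopyContract hh.smooth hSs
  have hβ : ContDiff ℝ ∞ fun x => slicePullback h α (0, x) :=
    (contDiff_slicePullback hh.smooth hα).comp (contDiff_prodMk_right (0 : ℝ))
  refine ⟨fun x => ∫ s in (0 : ℝ)..1, homotopyContract h α (s, x),
    fun x => (gradSq a x)⁻¹ • iota a x (slicePullback h α (0, x)) -
      ∫ s in (0 : ℝ)..1, homotopyContract h S (s, x),
    contDiff_integral_parameter (contDiff_homotopyContract hh.smooth hα),
    (hinv.smul (contDiff_iota ha hβ)).sub (contDiff_integral_parameter hcS), fun x hx => ?_⟩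
  have h' : 1 + k = k + 1 := Nat.add_comm 1 k
  have h1 := slicePullback_sub hh.smooth hα x
  have h2 : (∫ s in (0 : ℝ)..1, homotopyContract h (extDeriv α) (s, x)) =
      -wedge h' (dScalar a x) (∫ s in (0 : ℝ)..1, homotopyContract h S (s, x)) := by
    have hc : Continuous fun s : ℝ => homotopyContract h S (s, x) :=
      hcS.continuous.comp (by fun_prop)
    rw [← integral_neg_wedge h' _ hc]
    refine intervalIntegral.integral_congr fun s hs => ?_
    rw [Set.uIcc_of_le zero_le_one] at hs
    have hs' : s ∈ Set.Ioo (-1 : ℝ) 2 := ⟨by linarith [hs.1], by linarith [hs.2]⟩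
    have h3 := hh.fderiv_eq ha hN hx hs'
    simp only [hαS]
    refine homotopyContract_daWedge S h' ?_ fun v => h3 (0, v)
    rw [h3, map_zero]
  have h3 : slicePullback h α (0, x) = wedge h' (dScalar a x)
      ((gradSq a x)⁻¹ • iota a x (slicePullback h α (0, x))) := by
    refine eq_daWedge_iota (hn x) (Nat.add_comm 1 (k + 1)) h' _ ?_
    exact wedge_dScalar_comp_eq_zero (hn x) _ _ _ fun v hv => hh.zero x hx v hv
  rw [hh.slicePullback_one hN α hx, h2, sub_eq_iff_eq_add] at h1
  change α x = _ + wedge h' (dScalar a x) _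
  rw [wedge_sub_right, ← h3, h1]
  ext w
  simp only [ContinuousAlternatingMap.add_apply, ContinuousAlternatingMap.sub_apply,
    ContinuousAlternatingMap.neg_apply]
  ring

theorem Nonnull.fderiv_ne_zero {a : Spacetime d → ℝ} (hn : Nonnull a) (x : Spacetime d) :
    fderiv ℝ a x ≠ 0 := by
  intro h
  apply hn x
  rw [← fderiv_gradVec, h]
  rfl

/-- A function that is constant on the level sets of `a` has derivative zero along them, because
it has a constrained extremum at every point, so that Lagrange multipliers apply. -/
theorem fderiv_eq_zero_of_level {a g : Spacetime d → ℝ} (ha : ContDiff ℝ ∞ a)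
    (hn : Nonnull a) (hg : ContDiff ℝ ∞ g) (hag : ∀ x y, a x = a y → g x = g y)
    (x v : Spacetime d) (hv : fderiv ℝ a x v = 0) : fderiv ℝ g x v = 0 := by
  have h1 : IsLocalExtrOn g {y | a y = a x} x :=
    Or.inl (by
      filter_upwards [self_mem_nhdsWithin] with y hy
      exact (hag y x hy).ge)
  obtain ⟨b, c, hbc, h2⟩ := h1.exists_multipliers_of_hasStrictFDerivAt_1d
    (ha.contDiffAt.hasStrictFDerivAt (by simp)) (hg.contDiffAt.hasStrictFDerivAt (by simp))
  have hc : c ≠ 0 := by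
    rintro rfl
    rw [zero_smul, add_zero] at h2
    rcases smul_eq_zero.1 h2 with h3 | h3
    · exact hbc (by rw [h3]; rfl)
    · exact hn.fderiv_ne_zero x h3
  have h3 := congrArg (fun L : Spacetime d →L[ℝ] ℝ => L v) h2
  change b * fderiv ℝ a x v + c * fderiv ℝ g x v = 0 at h3
  rw [hv, mul_zero, zero_add] at h3
  exact (mul_eq_zero.1 h3).resolve_left hc

theorem fderiv_eq_zero_of_level_pi {a : Spacetime d → ℝ} (ha : ContDiff ℝ ∞ a)
    (hn : Nonnull a) {h : ℝ × Spacetime d → Spacetime d} (hs : ContDiff ℝ ∞ h)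
    (h0 : ∀ x y, a x = a y → h (0, x) = h (0, y)) (x v : Spacetime d)
    (hv : fderiv ℝ a x v = 0) : fderiv ℝ h (0, x) (0, v) = 0 := by
  have hs0 : HasFDerivAt (fun y => h (0, y))
      ((fderiv ℝ h (0, x)).comp (ContinuousLinearMap.inr ℝ ℝ (Spacetime d))) x :=
    (hs.differentiable (by simp) (0, x)).hasFDerivAt.comp x
      (hasFDerivAt_prodMk_right (0 : ℝ) x)
  funext i
  have hi : HasFDerivAt (fun y => h (0, y) i) ((ContinuousLinearMap.proj i).comp
      ((fderiv ℝ h (0, x)).comp (ContinuousLinearMap.inr ℝ ℝ (Spacetime d)))) x :=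
    (hasFDerivAt_pi'.1 hs0) i
  have hg : ContDiff ℝ ∞ fun y => h (0, y) i :=
    contDiff_pi.1 (hs.comp (contDiff_prodMk_right (0 : ℝ))) i
  have h2 := fderiv_eq_zero_of_level ha hn hg (fun x y hxy => by rw [h0 x y hxy]) x v hv
  rw [hi.fderiv] at h2
  exact h2

theorem LevelsContractible.exists_contractsLevels {a : Spacetime d → ℝ} (ha : ContDiff ℝ ∞ a)
    (hn : Nonnull a) (h : LevelsContractible a) : ∃ h, ContractsLevels a Set.univ h := by
  obtain ⟨h, hs, h1, hl, h0⟩ := h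
  exact ⟨h, hs, fun x _ => h1 x, fun x _ s _ => hl s x,
    fun x _ v hv => fderiv_eq_zero_of_level_pi ha hn hs h0 x v hv⟩

/-- The inverse function theorem, with an inverse that is smooth on a whole ball. -/
theorem exists_local_inverse {Φ : Spacetime d → Spacetime d} (hΦ : ContDiff ℝ ∞ Φ)
    {x₀ : Spacetime d} (hx₀ : Φ x₀ = x₀)
    (hD : HasFDerivAt Φ (ContinuousLinearMap.id ℝ (Spacetime d)) x₀) :
    ∃ (Θ : Spacetime d → Spacetime d) (r : ℝ), 0 < r ∧
      (∀ y ∈ Metric.closedBall x₀ r, ContDiffAt ℝ ∞ Θ y ∧ Φ (Θ y) = y) ∧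
      ∀ᶠ x in 𝓝 x₀, Θ (Φ x) = x := by
  have hD' : HasFDerivAt Φ (ContinuousLinearEquiv.refl ℝ (Spacetime d) :
      Spacetime d →L[ℝ] Spacetime d) x₀ := hD
  set f := hΦ.contDiffAt.toOpenPartialHomeomorph Φ hD' (by simp)
  have hfΦ : (f : Spacetime d → Spacetime d) = Φ := rfl
  have hsrc : x₀ ∈ f.source := hΦ.contDiffAt.mem_toOpenPartialHomeomorph_source hD' (by simp)
  have htgt : x₀ ∈ f.target := by
    have := f.map_source hsrc
    rwa [hfΦ, hx₀] at this
  have hsymm : f.symm x₀ = x₀ := by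
    have := f.left_inv hsrc
    rwa [hfΦ, hx₀] at this
  have hinv : ∀ᶠ y in 𝓝 x₀, fderiv ℝ Φ (f.symm y) ∈
      Set.range ((↑) : (Spacetime d ≃L[ℝ] Spacetime d) → Spacetime d →L[ℝ] Spacetime d) := by
    have hc : ContinuousAt (fun y => fderiv ℝ Φ (f.symm y)) x₀ :=
      (hΦ.continuous_fderiv (by simp)).continuousAt.comp (f.continuousAt_symm htgt)
    refine hc ?_
    beta_reduce
    rw [hsymm, hD'.fderiv]
    exact ContinuousLinearEquiv.nhds _
  obtain ⟨r, hr, hball⟩ := Metric.nhds_basis_closedBall.mem_iff.1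
    (hinv.and (f.open_target.mem_nhds htgt))
  refine ⟨f.symm, r, hr, fun y hy => ?_, ?_⟩
  · obtain ⟨⟨L, hL⟩, hyt⟩ := hball hy
    refine ⟨f.contDiffAt_symm (f₀' := L) hyt ?_ hΦ.contDiffAt, f.right_inv hyt⟩
    rw [hL]
    exact (hΦ.differentiable (by simp) _).hasFDerivAt
  · filter_upwards [f.open_source.mem_nhds hsrc] with x hx using f.left_inv hx

/-- Near every point the level sets of a function without critical points contract: in
coordinates in which `a` is affine, they are hyperplanes. -/
theorem exists_contractsLevels_nhds {a : Spacetime d → ℝ} (ha : ContDiff ℝ ∞ a)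
    (hn : Nonnull a) (x₀ : Spacetime d) :
    ∃ N h, IsOpen N ∧ x₀ ∈ N ∧ ContractsLevels a N h := by
  set L : Spacetime d →L[ℝ] ℝ := fderiv ℝ a x₀ with hL
  obtain ⟨u, hLu⟩ : ∃ u, L u = 1 := by
    refine ⟨(gradSq a x₀)⁻¹ • gradVec a x₀, ?_⟩
    rw [map_smul, hL, fderiv_gradVec, smul_eq_mul, inv_mul_cancel₀ (hn x₀)]
  -- `Φ` straightens the level sets: `a = a x₀ + L (Φ - x₀)`
  set Φ : Spacetime d → Spacetime d := fun x => x + (a x - a x₀ - L (x - x₀)) • u with hΦ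
  have hΦs : ContDiff ℝ ∞ Φ := by
    have h1 : ContDiff ℝ ∞ fun x => L (x - x₀) := L.contDiff.comp (contDiff_id.sub contDiff_const)
    exact contDiff_id.add (((ha.sub contDiff_const).sub h1).smul contDiff_const)
  have hΦ₀ : Φ x₀ = x₀ := by simp [hΦ]
  have hLΦ : ∀ x, L (Φ x - x₀) = a x - a x₀ := by
    intro x
    have h1 : Φ x - x₀ = (x - x₀) + (a x - a x₀ - L (x - x₀)) • u := by
      simp only [hΦ]; abel
    rw [h1, map_add, map_smul, hLu, smul_eq_mul]
    ring
  have hD : HasFDerivAt Φ (ContinuousLinearMap.id ℝ (Spacetime d)) x₀ := by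
    have h1 : HasFDerivAt a L x₀ := (ha.differentiable (by simp) x₀).hasFDerivAt
    have h2 : HasFDerivAt (fun x => L (x - x₀)) L x₀ :=
      L.hasFDerivAt.comp x₀ ((hasFDerivAt_id x₀).sub_const x₀)
    have h3 := (hasFDerivAt_id x₀).add (((h1.sub_const (a x₀)).sub h2).smul_const u)
    refine h3.congr_fderiv ?_
    ext v
    simp
  -- `Φ` has derivative `id` at `x₀`, where the correction term vanishes to second order
  obtain ⟨Θ, r, hr, hΘ, hΘΦ⟩ := exists_local_inverse hΦs hΦ₀ hD
  let χ : ContDiffBump x₀ := ⟨r / 2, r, by linarith, by linarith⟩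
  -- the inverse of `Φ`, cut off to a smooth map on the whole space
  set Θ' : Spacetime d → Spacetime d := fun y => χ y • Θ y with hΘ'
  have hΘ's : ContDiff ℝ ∞ Θ' := by
    refine contDiff_iff_contDiffAt.2 fun y => ?_
    by_cases hy : y ∈ tsupport χ
    · rw [χ.tsupport_eq] at hy
      exact χ.contDiff.contDiffAt.smul (hΘ y hy).1
    · refine contDiffAt_const (c := (0 : Spacetime d)) |>.congr_of_eventuallyEq ?_
      filter_upwards [notMem_tsupport_iff_eventuallyEq.1 hy] with z hz
      change χ z • Θ z = 0
      rw [hz, Pi.zero_apply, zero_smul]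
  have hΘ'eq : ∀ y ∈ Metric.closedBall x₀ (r / 2), Θ' y = Θ y := by
    intro y hy
    simp only [hΘ']
    rw [χ.one_of_mem_closedBall hy, one_smul]
  -- the affine contraction of the hyperplanes `L = const` onto the line through `x₀` along `u`
  set P : ℝ × Spacetime d → Spacetime d := fun z =>
    x₀ + (a z.2 - a x₀) • u + z.1 • (Φ z.2 - x₀ - (a z.2 - a x₀) • u) with hP
  have hPs : ContDiff ℝ ∞ P := by
    have h1 : ContDiff ℝ ∞ fun z : ℝ × Spacetime d => (a z.2 - a x₀) • u :=
      ((ha.comp contDiff_snd).sub contDiff_const).smul contDiff_const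
    exact (contDiff_const.add h1).add
      (contDiff_fst.smul (((hΦs.comp contDiff_snd).sub contDiff_const).sub h1))
  have hLP : ∀ s x, L (P (s, x) - x₀) = a x - a x₀ := by
    intro s x
    have h1 : P (s, x) - x₀ =
        (a x - a x₀) • u + s • (Φ x - x₀ - (a x - a x₀) • u) := by
      simp only [hP]; abel
    rw [h1, map_add, map_smul, map_smul, map_sub, map_smul, hLu, hLΦ]
    simp only [smul_eq_mul]
    ring
  have haΘ : ∀ y ∈ Metric.closedBall x₀ r, a (Θ y) - a x₀ = L (y - x₀) := by
    intro y hy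
    rw [← hLΦ, (hΘ y hy).2]
  -- by compactness the segments `P ([-1, 2] × {x})` stay in the ball for `x` near `x₀`
  have htube : ∀ᶠ x in 𝓝 x₀, ∀ s ∈ Set.Icc (-1 : ℝ) 2,
      P (s, x) ∈ Metric.closedBall x₀ (r / 2) := by
    refine isCompact_Icc.eventually_forall_of_forall_eventually fun s _ => ?_
    have h1 : Filter.Tendsto (fun z : Spacetime d × ℝ => P (z.2, z.1)) (𝓝 (x₀, s)) (𝓝 x₀) := by
      have h2 : Continuous fun z : Spacetime d × ℝ => P (z.2, z.1) :=
        hPs.continuous.comp (by fun_prop)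
      have h3 := h2.tendsto (x₀, s)
      have h4 : P (s, x₀) = x₀ := by simp [hP, hΦ₀]
      rwa [h4] at h3
    exact h1 (Metric.closedBall_mem_nhds x₀ (by linarith))
  obtain ⟨N, hN, hNo, hx₀N⟩ := eventually_nhds_iff.1 (htube.and hΘΦ)
  have hsub : Metric.closedBall x₀ (r / 2) ⊆ Metric.closedBall x₀ r :=
    Metric.closedBall_subset_closedBall (by linarith)
  refine ⟨N, fun z => Θ' (P z), hNo, hx₀N, hΘ's.comp hPs, fun x hx => ?_, fun x hx s hs => ?_,
    fun x _ v hv => ?_⟩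
  · have h1 := (hN x hx).1 1 (by norm_num)
    have h2 : P (1, x) = Φ x := by simp only [hP, one_smul]; abel
    rw [hΘ'eq _ h1, h2, (hN x hx).2]
  · have h1 := (hN x hx).1 s (Set.Ioo_subset_Icc_self hs)
    have h2 := haΘ _ (hsub h1)
    rw [hLP] at h2
    rw [hΘ'eq _ h1]
    linarith
  · refine fderiv_eq_zero_of_level_pi ha hn (hΘ's.comp hPs) (fun x y hxy => ?_) x v hv
    simp only [Function.comp_apply, hP, zero_smul, hxy]

end Relative

/-! ### Gauging away the auxiliary fields -/

section Reduction

variable {d k n : ℕ}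

theorem extDeriv_daWedge_extD (h : k + 1 = n) {a : Spacetime d → ℝ} {C : Form d k}
    (ha : ContDiff ℝ ∞ a) (hC : ContDiff ℝ ∞ C) (x : Spacetime d) :
    extDeriv (daWedge h a C) x = -daWedge rfl a (extD h C) x := by
  subst h
  exact extDeriv_daWedge ha hC x

/-- The effect of a gauge transformation on `dR`. -/
theorem extDeriv_gauge_R (h : k + 1 = n) {a : Spacetime d → ℝ} {B C : Form d k} {R : Form d n}
    (ha : ContDiff ℝ ∞ a) (hB : ContDiff ℝ ∞ B) (hC : ContDiff ℝ ∞ C) (hR : ContDiff ℝ ∞ R)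
    (x : Spacetime d) :
    extDeriv (fun y => R y + (extD h B y + daWedge h a C y)) x =
      extDeriv R x - daWedge rfl a (extD h C) x := by
  have h1 := contDiff_extD h hB
  have h2 := contDiff_daWedge h ha hC
  rw [extDeriv_add_fun hR (h1.add h2), extDeriv_add_fun h1 h2, extDeriv_extD h hB,
    extDeriv_daWedge_extD h ha hC, Pi.zero_apply, zero_add, sub_eq_add_neg]

/-- The effect of a gauge transformation on `dA`. -/
theorem extDeriv_gauge_A (h : k + 1 = n) {a : Spacetime d → ℝ} {C : Form d k} {A : Form d n}
    (ha : ContDiff ℝ ∞ a) (hC : ContDiff ℝ ∞ C) (hA : ContDiff ℝ ∞ A) (x : Spacetime d) :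
    extDeriv (fun y => A y - a y • daWedge h a C y) x =
      extDeriv A x + a x • daWedge rfl a (extD h C) x := by
  have h2 := contDiff_daWedge h ha hC
  have h3 : ContDiff ℝ ∞ fun y => a y • daWedge h a C y := ha.smul h2
  rw [extDeriv_sub' hA h3, extDeriv_smul_fun ha h2, daWedge_daWedge,
    extDeriv_daWedge_extD h ha hC, zero_add, smul_neg, sub_neg_eq_add]

theorem exists_gauge_parameters (h : k + 1 = n) {a : Spacetime d → ℝ} (ha : ContDiff ℝ ∞ a)
    (hn : Nonnull a) {N : Set (Spacetime d)} (hN : IsOpen N)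
    {g : ℝ × Spacetime d → Spacetime d} (hg : ContractsLevels a N g) {R : Form d n}
    (hR : ContDiff ℝ ∞ R) (hd : ∀ x, daWedge rfl a (extDeriv R) x = 0) :
    ∃ B C : Form d k, ContDiff ℝ ∞ B ∧ ContDiff ℝ ∞ C ∧
      ∀ x ∈ N, R x + (extD h B x + daWedge h a C x) = 0 := by
  subst h
  have hR' : ContDiff ℝ ∞ fun y => (-1 : ℝ) • R y := hR.const_smul (-1 : ℝ)
  have hd' : ∀ x, daWedge rfl a (extDeriv fun y => (-1 : ℝ) • R y) x = 0 := by
    intro x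
    have h1 : extDeriv (fun y => (-1 : ℝ) • R y) x = (-1 : ℝ) • extDeriv R x :=
      extDeriv_fun_smul (-1 : ℝ) R
    have h2 := hd x
    rw [daWedge] at h2 ⊢
    rw [h1, wedge_smul_right, h2, smul_zero]
  obtain ⟨B, C, hB, hC, hBC⟩ := exists_potential ha hn hN hg hR' hd'
  refine ⟨B, C, hB, hC, fun x hx => ?_⟩
  change R x + (extDeriv B x + daWedge rfl a C x) = 0
  rw [← hBC x hx]
  ext w
  change R x w + -1 * R x w = 0
  ring

variable {p q l : ℕ}

theorem gaugeTransform_eq (hk : k + 1 = p) (hl : l + 1 = q) (Ψ : Config p q)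
    (B₁ C₁ : Form (p + q + 2) k) (B₂ C₂ : Form (p + q + 2) l) :
    gaugeTransform hk hl Ψ B₁ C₁ B₂ C₂ =
      ⟨fun x => Ψ.A₁ x - Ψ.a x • daWedge hk Ψ.a C₁ x,
        fun x => Ψ.A₂ x - Ψ.a x • daWedge hl Ψ.a C₂ x,
        fun x => Ψ.R₁ x + (extD hk B₁ x + daWedge hk Ψ.a C₁ x),
        fun x => Ψ.R₂ x + (extD hl B₂ x + daWedge hl Ψ.a C₂ x), Ψ.a⟩ := by
  simp only [gaugeTransform, Config.vary, gaugeR₁, gaugeR₂, gaugeS₁, gaugeS₂, Config.mk.injEq]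
  refine ⟨?_, ?_, ?_, ?_, ?_⟩
  · funext x
    ext w
    change Ψ.A₁ x w + 1 * 0 + 1 * 0 + 1 * -(Ψ.a x * daWedge hk Ψ.a C₁ x w) + 1 * 0 =
      Ψ.A₁ x w - Ψ.a x * daWedge hk Ψ.a C₁ x w
    ring
  · funext x
    ext w
    change Ψ.A₂ x w + 1 * 0 + 1 * 0 + 1 * 0 + 1 * -(Ψ.a x * daWedge hl Ψ.a C₂ x w) =
      Ψ.A₂ x w - Ψ.a x * daWedge hl Ψ.a C₂ x w
    ring
  · funext x
    ext w
    change Ψ.R₁ x w + 1 * extD hk B₁ x w + 1 * 0 + 1 * daWedge hk Ψ.a C₁ x w + 1 * 0 =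
      Ψ.R₁ x w + (extD hk B₁ x w + daWedge hk Ψ.a C₁ x w)
    ring
  · funext x
    ext w
    change Ψ.R₂ x w + 1 * 0 + 1 * extD hl B₂ x w + 1 * 0 + 1 * daWedge hl Ψ.a C₂ x w =
      Ψ.R₂ x w + (extD hl B₂ x w + daWedge hl Ψ.a C₂ x w)
    ring
  · funext x
    change Ψ.a x + 1 * 0 + 1 * 0 + 1 * 0 + 1 * 0 = Ψ.a x
    ring

/-- A form field vanishing on an open set has vanishing exterior derivative there. -/
theorem extDeriv_eq_zero_of_isOpen {R : Form d k} {N : Set (Spacetime d)} (hN : IsOpen N)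
    (hR : ∀ x ∈ N, R x = 0) {x : Spacetime d} (hx : x ∈ N) : extDeriv R x = 0 := by
  have h1 : R =ᶠ[𝓝 x] (0 : Form d k) := by
    filter_upwards [hN.mem_nhds hx] with y hy using hR y hy
  rw [h1.extDeriv_eq, extDeriv_zero]
  rfl

/-- The gauge transformations change neither `H₁`, `H₂` nor the equations `da ∧ dRᵢ = 0`. Hence
they preserve the solutions, and where the transformed `R₁`, `R₂` vanish the twisted duality
relation holds for `F₁`, `F₂`. -/
theorem reducesOn_of_contractsLevels {𝓕 : Alt (p + q + 2) (p + 1) → ℝ} (h𝓕 : ContDiff ℝ 1 𝓕)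
    (hk : k + 1 = p) (hl : l + 1 = q) {Ψ : Config p q} (hΨ : Ψ.Smooth) (hn : Nonnull Ψ.a)
    (hs : OnShell 𝓕 Ψ) {N : Set (Spacetime (p + q + 2))} (hN : IsOpen N)
    {g : ℝ × Spacetime (p + q + 2) → Spacetime (p + q + 2)} (hg : ContractsLevels Ψ.a N g) :
    ReducesOn 𝓕 hk hl Ψ N := by
  obtain ⟨hA₁, hA₂, hR₁, hR₂, ha⟩ := id hΨ
  obtain ⟨hD, hd₁, hd₂⟩ := (onShell_iff h𝓕 hΨ hn).1 hs
  obtain ⟨B₁, C₁, hB₁, hC₁, h₁⟩ := exists_gauge_parameters hk ha hn hN hg hR₁ hd₁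
  obtain ⟨B₂, C₂, hB₂, hC₂, h₂⟩ := exists_gauge_parameters hl ha hn hN hg hR₂ hd₂
  refine ⟨B₁, C₁, B₂, C₂, hB₁, hC₁, hB₂, hC₂, ?_⟩
  set Ψ' := gaugeTransform hk hl Ψ B₁ C₁ B₂ C₂ with hΨ'
  rw [gaugeTransform_eq] at hΨ'
  have ha' : Ψ'.a = Ψ.a := by rw [hΨ']
  have hsm : Ψ'.Smooth := by
    rw [hΨ']
    exact ⟨hA₁.sub (ha.smul (contDiff_daWedge hk ha hC₁)),
      hA₂.sub (ha.smul (contDiff_daWedge hl ha hC₂)),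
      hR₁.add ((contDiff_extD hk hB₁).add (contDiff_daWedge hk ha hC₁)),
      hR₂.add ((contDiff_extD hl hB₂).add (contDiff_daWedge hl ha hC₂)), ha⟩
  have hQ₁ : ∀ x, Ψ'.Q₁ x = Ψ.Q₁ x - daWedge rfl Ψ.a (extD hk C₁) x := fun x => by
    rw [hΨ']
    exact extDeriv_gauge_R hk ha hB₁ hC₁ hR₁ x
  have hQ₂ : ∀ x, Ψ'.Q₂ x = Ψ.Q₂ x - daWedge rfl Ψ.a (extD hl C₂) x := fun x => by
    rw [hΨ']
    exact extDeriv_gauge_R hl ha hB₂ hC₂ hR₂ x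
  have hF₁ : ∀ x, Ψ'.F₁ x = Ψ.F₁ x + Ψ.a x • daWedge rfl Ψ.a (extD hk C₁) x := fun x => by
    rw [hΨ']
    exact extDeriv_gauge_A hk ha hC₁ hA₁ x
  have hF₂ : ∀ x, Ψ'.F₂ x = Ψ.F₂ x + Ψ.a x • daWedge rfl Ψ.a (extD hl C₂) x := fun x => by
    rw [hΨ']
    exact extDeriv_gauge_A hl ha hC₂ hA₂ x
  have hH₁ : ∀ x, Ψ'.H₁ x = Ψ.H₁ x := fun x => by
    rw [Config.H₁, Config.H₁, hF₁, hQ₁, ha', smul_sub]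
    abel
  have hH₂ : ∀ x, Ψ'.H₂ x = Ψ.H₂ x := fun x => by
    rw [Config.H₂, Config.H₂, hF₂, hQ₂, ha', smul_sub]
    abel
  have hD' : ∀ x, TwistedDuality 𝓕 (Ψ'.H₁ x) (Ψ'.H₂ x) := fun x => by
    rw [hH₁, hH₂]
    exact hD x
  refine ⟨onShell_of h𝓕 hsm hD' (fun x => ?_) (fun x => ?_), fun x hx => ?_⟩
  · rw [ha', daWedge, hQ₁, wedge_sub_right]
    exact sub_eq_zero.2 ((hd₁ x).trans (daWedge_daWedge rfl rfl Ψ.a (extD hk C₁) x).symm)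
  · rw [ha', daWedge, hQ₂, wedge_sub_right]
    exact sub_eq_zero.2 ((hd₂ x).trans (daWedge_daWedge rfl rfl Ψ.a (extD hl C₂) x).symm)
  · have hR₁' : ∀ y ∈ N, Ψ'.R₁ y = 0 := by
      rw [hΨ']
      exact h₁
    have hR₂' : ∀ y ∈ N, Ψ'.R₂ y = 0 := by
      rw [hΨ']
      exact h₂
    have h3 := hD' x
    have hq₁ : Ψ'.Q₁ x = 0 := extDeriv_eq_zero_of_isOpen hN hR₁' hx
    have hq₂ : Ψ'.Q₂ x = 0 := extDeriv_eq_zero_of_isOpen hN hR₂' hx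
    rw [Config.H₁, Config.H₂, hq₁, hq₂, smul_zero, smul_zero, add_zero, add_zero] at h3
    exact ⟨hR₁' x hx, hR₂' x hx, h3⟩

theorem Q₁_eq_zero {Ψ : Config p q} (h : Ψ.R₁ = 0) : Ψ.Q₁ = 0 := by
  rw [Config.Q₁, h, extDeriv_zero]

theorem Q₂_eq_zero {Ψ : Config p q} (h : Ψ.R₂ = 0) : Ψ.Q₂ = 0 := by
  rw [Config.Q₂, h, extDeriv_zero]

theorem H₁_eq_F₁ {Ψ : Config p q} (h : Ψ.R₁ = 0) : Ψ.H₁ = Ψ.F₁ := by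
  funext x
  rw [Config.H₁, Q₁_eq_zero h, Pi.zero_apply, smul_zero, add_zero]

theorem H₂_eq_F₂ {Ψ : Config p q} (h : Ψ.R₂ = 0) : Ψ.H₂ = Ψ.F₂ := by
  funext x
  rw [Config.H₂, Q₂_eq_zero h, Pi.zero_apply, smul_zero, add_zero]

theorem gaugeShift_eq {Ψ : Config p q} (h₁ : Ψ.R₁ = 0) (h₂ : Ψ.R₂ = 0)
    (φ : Spacetime (p + q + 2) → ℝ) : gaugeShift Ψ φ = ⟨0, 0, 0, 0, φ⟩ := by
  have hi : ∀ {m : ℕ} (x : Spacetime (p + q + 2)),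
      iota Ψ.a x (0 : Alt (p + q + 2) (m + 1)) = 0 := fun x => rfl
  have hs₁ : shiftR₁ Ψ φ = 0 := by
    funext x
    simp only [shiftR₁, Q₁_eq_zero h₁, Q₂_eq_zero h₂, Pi.zero_apply, hodge_zero, add_zero, hi,
      smul_zero]
  have hs₂ : shiftR₂ Ψ φ = 0 := by
    funext x
    simp only [shiftR₂, Q₁_eq_zero h₁, Q₂_eq_zero h₂, Pi.zero_apply, hodge_zero, add_zero, hi,
      smul_zero]
  rw [gaugeShift, hs₁, hs₂]
  simp only [Config.mk.injEq, and_true]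
  constructor <;>
  · funext x
    rw [Pi.zero_apply, smul_zero, neg_zero]

end Reduction

end Democratic

end

theorem mainTheorem2 (p q : ℕ)
    (𝓕 : Democratic.Alt (p + q + 2) (p + 1) → ℝ) (h𝓕 : ContDiff ℝ 1 𝓕) :
    -- the interacting Lagrangian has all the gauge symmetries of the free one
    (∀ Ψ : Democratic.Config p q, Ψ.Smooth →
      ∀ (δ : Democratic.Config p q) (S : Set (Democratic.Spacetime (p + q + 2))),
        Democratic.GaugeVariation Ψ δ S →
        δ.Smooth ∧
        (∀ x, HasDerivAt (fun t : ℝ => (Ψ.vary t δ).Y x) 0 0) ∧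
        ∃ K : Democratic.Form (p + q + 2) (p + q + 1), ContDiff ℝ ∞ K ∧ tsupport K ⊆ S ∧
          ∀ x,
            HasDerivAt (fun t : ℝ => Democratic.lagrangian (fun _ => 0) (Ψ.vary t δ) x)
              (extDeriv K x) 0 ∧
            HasDerivAt (fun t : ℝ => Democratic.lagrangian 𝓕 (Ψ.vary t δ) x)
              (extDeriv K x) 0) ∧
    -- the equations of motion, and that of `a` follows from the others
    (∀ Ψ : Democratic.Config p q, Ψ.Smooth → Democratic.Nonnull Ψ.a →
      (Democratic.OnShell 𝓕 Ψ ↔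
        (∀ x, Democratic.TwistedDuality 𝓕 (Ψ.H₁ x) (Ψ.H₂ x)) ∧
        (∀ x, Democratic.daWedge rfl Ψ.a Ψ.Q₁ x = 0) ∧
        (∀ x, Democratic.daWedge rfl Ψ.a Ψ.Q₂ x = 0)) ∧
      (Democratic.OnShellForms 𝓕 Ψ → Democratic.OnShell 𝓕 Ψ)) ∧
    -- the fields `R₁`, `R₂` are pure gauge on shell
    (∀ (k l : ℕ) (hk : k + 1 = p) (hl : l + 1 = q) (Ψ : Democratic.Config p q), Ψ.Smooth →
      Democratic.Nonnull Ψ.a → Democratic.OnShell 𝓕 Ψ →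
      (∀ x, ∃ N ∈ 𝓝 x, Democratic.ReducesOn 𝓕 hk hl Ψ N) ∧
      (Democratic.LevelsContractible Ψ.a → Democratic.ReducesOn 𝓕 hk hl Ψ Set.univ)) ∧
    -- the remaining dynamics is the twisted duality relation, and `a` is arbitrary
    (∀ Ψ : Democratic.Config p q, Ψ.Smooth → Ψ.R₁ = 0 → Ψ.R₂ = 0 →
      (Democratic.Nonnull Ψ.a →
        (Democratic.OnShell 𝓕 Ψ ↔ ∀ x, Democratic.TwistedDuality 𝓕 (Ψ.F₁ x) (Ψ.F₂ x))) ∧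
      ((∀ x, Democratic.TwistedDuality 𝓕 (Ψ.F₁ x) (Ψ.F₂ x)) → Democratic.OnShell 𝓕 Ψ) ∧
      (∀ φ : Democratic.Spacetime (p + q + 2) → ℝ,
        Democratic.gaugeShift Ψ φ = ⟨0, 0, 0, 0, φ⟩)) := by
  refine ⟨fun Ψ hΨ δ S h => Democratic.gaugeVariation_symmetry h𝓕 hΨ h,
    fun Ψ hΨ hn => ⟨Democratic.onShell_iff h𝓕 hΨ hn, fun h => ?_⟩,
    fun k l hk hl Ψ hΨ hn hs => ⟨fun x => ?_, fun hc => ?_⟩,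
    fun Ψ hΨ h₁ h₂ => ⟨fun hn => ?_, fun hD => ?_, Democratic.gaugeShift_eq h₁ h₂⟩⟩
  · exact (Democratic.onShell_iff h𝓕 hΨ hn).2 (Democratic.eom_of_onShellForms h𝓕 hΨ hn h)
  · obtain ⟨N, g, hN, hx, hg⟩ := Democratic.exists_contractsLevels_nhds hΨ.2.2.2.2 hn x
    exact ⟨N, hN.mem_nhds hx,
      Democratic.reducesOn_of_contractsLevels h𝓕 hk hl hΨ hn hs hN hg⟩
  · obtain ⟨g, hg⟩ := hc.exists_contractsLevels hΨ.2.2.2.2 hn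
    exact Democratic.reducesOn_of_contractsLevels h𝓕 hk hl hΨ hn hs isOpen_univ hg
  · rw [Democratic.onShell_iff h𝓕 hΨ hn, Democratic.H₁_eq_F₁ h₁, Democratic.H₂_eq_F₂ h₂,
      Democratic.Q₁_eq_zero h₁, Democratic.Q₂_eq_zero h₂, Democratic.daWedge_zero,
      Democratic.daWedge_zero]
    exact ⟨fun h => h.1, fun h => ⟨h, fun _ => rfl, fun _ => rfl⟩⟩
  · refine Democratic.onShell_of h𝓕 hΨ ?_ (fun x => ?_) fun x => ?_
    · rwa [Democratic.H₁_eq_F₁ h₁, Democratic.H₂_eq_F₂ h₂]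
    · rw [Democratic.Q₁_eq_zero h₁, Democratic.daWedge_zero]
      rfl
    · rw [Democratic.Q₂_eq_zero h₂, Democratic.daWedge_zero]
      rfl
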